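/- **Setting.** Let $n\ge 1$. Let $\mathbb D\subset\mathbb C$ be the closed disc of radius $n+1$ around $0$ with the $2n$ base points $z_j=-(n+1-j)$ and $w_j=n+1-j$ $(1\le j\le n)$; let $\mathbb D_n=\mathbb D\setminus\{z_j,w_j\}_j$ and let $C_n=\mathrm{Conf}_{n-1}(\mathbb D_n)$ be the unordered configuration space. For $1\le k\le n-1$ put $r_k=n-k$. * $a_k$ is the upper half circle $|p|=r_k$, $\mathrm{Im}\,p\ge 0$, from $z_{k+1}$ to $w_{k+1}$, and $d_k=ir_k$ is its top. * $b_k$ is the oval $s\mapsto E_k(\cos s,\sin s)$, where $E_k(u,v)=(r_k+\tfrac u4)e^{i(-\pi/2+3\pi v/4)}$. It bounds a thin disc around the lower half circle from $z_{k+1}$ to $w_{k+1}$. Its left-hand side is $\sin s\le 0$ and its right-hand side is $\sin s\ge 0$. * $\eta_k$ (sign $-$) and $\eta_k'$ (sign $+$) are the paths $\tau\mapsto E_k\bigl(-\tfrac\tau2,\pm(\tfrac43+\tau(\tfrac{\sqrt3}2-\tfrac43))\bigr)$, $0\le\tau\le1$. They run from $d_k$, below $a_k$, to the left-hand and to the right-hand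 side of $b_k$, respectively. Let $\beta_n\in B_n=\pi_1(\mathrm{Conf}_n(\mathbb C),\{z_1,\dots,z_n\})$ be a braid whose closure is a knot. Let $h$ be a homeomorphism representing its action on the punctured disc: $h=h_1$ for an ambient isotopy $(h_t)_{0\le t\le1}$ with $h_0=\mathrm{id}$, supported in the disc with centre $-\frac{n+1}2$ and radius $\frac n2$ (which contains all the $z_j$ and no $w_j$), that moves $\{z_1,\dots,z_n\}$ along a geometric braid in the class $\beta_n$. Let $\pi$ be the permutation with $h(z_j)=z_{\pi(j)}$ and put $a_k'=h(a_k)$. Assume that the arcs $a_i'$ meet the curves $b_k$ in finitely many points (for example, transversely). **Grading in the disc.** Let $\varphi\colon\pi_1(C_n)\to\mathbb Z$ be the homomorphism that counts $+1$ for a counterclockwise turn of one particle around a $z_j$, $-1$ for a counterclockwise turn around a $w_j$, and $0$ for the exchange of two particles. Let $I\subset C_n$ be the set of configurations that have one point on each (open) arc $a_i'$ and that have one point on each curve $b_k$. For $\bar x=\{x_1,\dots,x_{n-1}\}\in I$ with $x_k\in b_k\cap a_{\rho(k)}'$ ($\rho$ a permutation), let $l_{\bar x}$ be the loop in $C_n$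 based at $\{d_1,\dots,d_{n-1}\}$ that first moves, simultaneously for all $k$, the point $d_k$ along $\eta_k$ and then along the left-hand side of $b_k$ to $x_k$ if $x_k$ lies on this side (along $\eta_k'$ and the right-hand side of $b_k$ otherwise), and then moves each $x_k$ along $a'_{\rho(k)}$ to $d_{\rho(k)}$. Put $A^{\mathrm{Pd}}(\bar x)=\varphi(l_{\bar x})$. **Grading in the Heegaard diagram.** Glue a disc to $\partial\mathbb D$ to obtain a sphere. For $\varepsilon\in(0,\frac12)$ so small that the closed discs $h(\bar B_\varepsilon(z_{i+1}))$ and $\bar B_\varepsilon(w_{i+1})$, $1\le i\le n-1$, are disjoint from all $b_k$, remove the open discs $h(B_\varepsilon(z_{i+1}))$ and $B_\varepsilon(w_{i+1})$, and for each $i$ identify the boundary circle of the first with that of the second by $h(\zeta)\sim-\bar\zeta$. This gives a closed surface $\Sigma$ of genus $n-1$ (surgery of the sphere along the $0$-spheres $\partial a_i'$). Let $\alpha_i$ be the closed curve formed by the remaining part of $a_i'$, let $\beta_k=b_k$, $z=z_{\pi(1)}$ and $w=w_1$. Orient $\Sigma$ as the boundary of the $\alpha$-handlebody, which lies above $\mathbb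 D$; this is opposite to the orientation of the plane. A domain $D$ is an integral linear combination of the components of $\Sigma\setminus(\boldsymbol\alpha\cup\boldsymbol\beta)$, and $n_p(D)$ is its coefficient at the component of $p$. It connects $\bar x\in I$ to $\bar y\in I$ if $\partial D\cap\boldsymbol\alpha$ is a $1$-chain with boundary $\bar x-\bar y$ and $\partial D\cap\boldsymbol\beta$ is a $1$-chain with boundary $\bar y-\bar x$. Here $I$ is identified with $\mathbb T_\alpha\cap\mathbb T_\beta\subset\mathrm{Sym}^{n-1}(\Sigma)$ by regarding the points of a configuration as points of $\Sigma$. **Theorem.** For all $\bar x,\bar y\in I$ there is a domain connecting $\bar x$ to $\bar y$, and every such domain $D$ satisfies $$A^{\mathrm{Pd}}(\bar x)-A^{\mathrm{Pd}}(\bar y)=n_z(D)-n_w(D).$$ In particular the right-hand side, which is the relative Alexander grading $A^{\mathrm{HF}}(\bar x)-A^{\mathrm{HF}}(\bar y)$, does not depend on $D$. -/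

import Mathlib

noncomputable section

open Set Filter
open scoped Topology

namespace BraidModel

/-! ### Configuration spaces -/

/-- Ordered configurations of `m` distinct points of `X`. -/
abbrev OrdConf (m : ℕ) (X : Type) : Type := {f : Fin m → X // Function.Injective f}

/-- Two ordered configurations are identified if they differ by a permutation of the labels. -/
def confSetoid (m : ℕ) (X : Type) : Setoid (OrdConf m X) where
  r f f' := ∃ σ : Equiv.Perm (Fin m), ∀ k, f'.1 k = f.1 (σ k)
  iseqv :=
    { refl := fun _ => ⟨1, fun _ => rfl⟩
      symm := by
        rintro f f' ⟨σ, h⟩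
        exact ⟨σ.symm, fun k => by rw [h, Equiv.apply_symm_apply]⟩
      trans := by
        rintro f f' f'' ⟨σ, h⟩ ⟨τ, h'⟩
        exact ⟨τ.trans σ, fun k => by rw [h', h]; rfl⟩ }

/-- The unordered configuration space `Conf_m(X)`, with the quotient topology. -/
def Conf (m : ℕ) (X : Type) : Type := Quotient (confSetoid m X)

instance (m : ℕ) (X : Type) [TopologicalSpace X] : TopologicalSpace (Conf m X) :=
  inferInstanceAs (TopologicalSpace (Quotient (confSetoid m X)))

namespace Conf

variable {m : ℕ} {X : Type}

/-- The unordered configuration underlying an ordered one. -/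
def mk (f : OrdConf m X) : Conf m X := Quotient.mk (confSetoid m X) f

theorem mk_eq_mk_iff {f f' : OrdConf m X} :
    mk f = mk f' ↔ ∃ σ : Equiv.Perm (Fin m), ∀ k, f'.1 k = f.1 (σ k) :=
  Quotient.eq (r := confSetoid m X)

theorem continuous_mk [TopologicalSpace X] : Continuous (mk : OrdConf m X → Conf m X) :=
  continuous_quotient_mk'

/-- The set of points of a configuration. -/
def points (c : Conf m X) : Set X :=
  Quotient.lift (fun f : OrdConf m X => range f.1) (by
    rintro f f' ⟨σ, h⟩
    have : f'.1 = f.1 ∘ σ := funext h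
    simp only [this]
    rw [EquivLike.range_comp]) c

/-- A family of paths that are disjoint at every time, viewed as a path of configurations. -/
def path [TopologicalSpace X] {p q : Fin m → X} (γ : ∀ k, Path (p k) (q k))
    (hγ : ∀ t : unitInterval, Function.Injective fun k => γ k t)
    (hp : Function.Injective p) (hq : Function.Injective q) :
    Path (mk ⟨p, hp⟩) (mk ⟨q, hq⟩) where
  toFun t := mk ⟨fun k => γ k t, hγ t⟩
  continuous_toFun := continuous_mk.comp
    (Continuous.subtype_mk (continuous_pi fun k => (γ k).continuous) _)
  source' := by simp
  target' := by simp

/-- For `p ∉ S`, the map `Conf_m(S) → ℂ \ {0}` sending `{x_1, …, x_m}` to `∏ (x_k - p)`. -/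
def prodSub {S : Set ℂ} (p : ℂ) (hp : p ∉ S) : C(Conf m S, {u : ℂ // u ≠ 0}) where
  toFun := Quotient.lift
    (fun f : OrdConf m S => (⟨∏ k, ((f.1 k : ℂ) - p), Finset.prod_ne_zero_iff.2 fun k _ h =>
      hp (sub_eq_zero.1 h ▸ (f.1 k).2)⟩ : {u : ℂ // u ≠ 0})) (by
      rintro f f' ⟨σ, h⟩
      refine Subtype.ext ?_
      simp only [h]
      exact (Equiv.prod_comp σ fun k => ((f.1 k : ℂ) - p)).symm)
  continuous_toFun := by
    refine Continuous.quotient_lift ?_ _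
    refine Continuous.subtype_mk ?_ _
    refine continuous_finsetProd _ fun k _ => ?_
    exact (continuous_subtype_val.comp
      ((continuous_apply k).comp continuous_subtype_val)).sub continuous_const

end Conf

/-! ### The winding number homomorphism -/

/-- The universal covering `exp : ℂ → ℂ \ {0}`. -/
def expCover (z : ℂ) : {u : ℂ // u ≠ 0} := ⟨Complex.exp z, z.exp_ne_zero⟩

theorem isCoveringMap_expCover : IsCoveringMap expCover := Complex.isCoveringMap_exp

theorem exists_winding {u : {u : ℂ // u ≠ 0}} (γ : Path.Homotopic.Quotient u u) :
    ∃ N : ℤ, ∀ e : expCover ⁻¹' {u},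
      (isCoveringMap_expCover.monodromy γ e).1 = e.1 + N * (2 * Real.pi * Complex.I) := by
  have hfib : ∀ e e' : expCover ⁻¹' {u},
      ∃ N : ℤ, e'.1 = e.1 + N * (2 * Real.pi * Complex.I) := fun e e' =>
    Complex.exp_eq_exp_iff_exists_int.1
      (congrArg Subtype.val ((show expCover e'.1 = u from e'.2).trans
        (show expCover e.1 = u from e.2).symm))
  have e₀ : expCover ⁻¹' {u} := ⟨Complex.log u.1, Subtype.ext (Complex.exp_log u.2)⟩
  obtain ⟨N, hN⟩ := hfib e₀ (isCoveringMap_expCover.monodromy γ e₀)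
  refine ⟨N, fun e => ?_⟩
  obtain ⟨M, hM⟩ := hfib e₀ e
  induction γ using Path.Homotopic.Quotient.ind with
  | _ γ =>
  have h0 : γ 0 = expCover e₀.1 := γ.source.trans (show expCover e₀.1 = u from e₀.2).symm
  have h1 : γ 0 = expCover e.1 := γ.source.trans (show expCover e.1 = u from e.2).symm
  have hc : Continuous fun t => isCoveringMap_expCover.liftPath γ e₀.1 h0 t +
      M * (2 * Real.pi * Complex.I) := by fun_prop
  have key : (⟨_, hc⟩ : C(unitInterval, ℂ)) = isCoveringMap_expCover.liftPath γ e.1 h1 := by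
    rw [isCoveringMap_expCover.eq_liftPath_iff']
    constructor
    · have := isCoveringMap_expCover.liftPath_lifts γ e₀.1 h0
      rw [← this]
      funext t
      refine Subtype.ext ?_
      simp [expCover, Complex.exp_add, Complex.exp_int_mul_two_pi_mul_I]
    · simp [isCoveringMap_expCover.liftPath_zero, hM]
  change isCoveringMap_expCover.liftPath γ e₀.1 h0 1 = _ at hN
  change isCoveringMap_expCover.liftPath γ e.1 h1 1 = _
  rw [← key]
  change isCoveringMap_expCover.liftPath γ e₀.1 h0 1 + _ = _
  rw [hN, hM]
  ring

/-- The winding number around `0` of a homotopy class of loops in `ℂ \ {0}`: every lift of the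
loop along `exp` changes by `2πi` times this integer. -/
def winding {u : {u : ℂ // u ≠ 0}} (γ : Path.Homotopic.Quotient u u) : ℤ :=
  (exists_winding γ).choose

theorem monodromy_eq_winding {u : {u : ℂ // u ≠ 0}} (γ : Path.Homotopic.Quotient u u)
    (e : expCover ⁻¹' {u}) :
    (isCoveringMap_expCover.monodromy γ e).1 = e.1 + winding γ * (2 * Real.pi * Complex.I) :=
  (exists_winding γ).choose_spec e

theorem winding_eq {u : {u : ℂ // u ≠ 0}} (γ : Path.Homotopic.Quotient u u) (N : ℤ)
    (e : expCover ⁻¹' {u}) (h : (isCoveringMap_expCover.monodromy γ e).1 =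
      e.1 + N * (2 * Real.pi * Complex.I)) : winding γ = N := by
  rw [monodromy_eq_winding γ e] at h
  have h' := mul_right_cancel₀ Complex.two_pi_I_ne_zero (add_left_cancel h)
  exact_mod_cast h'

/-- The winding number as a homomorphism `π₁(ℂ \ {0}) → ℤ`. -/
def windingHom (u : {u : ℂ // u ≠ 0}) :
    FundamentalGroup {u : ℂ // u ≠ 0} u →* Multiplicative ℤ where
  toFun γ := Multiplicative.ofAdd (winding (FundamentalGroup.toPath γ))
  map_one' := by
    have e₀ : expCover ⁻¹' {u} := ⟨Complex.log u.1, Subtype.ext (Complex.exp_log u.2)⟩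
    rw [ofAdd_eq_one]
    refine winding_eq _ 0 e₀ ?_
    rw [FundamentalGroup.one_def, FundamentalGroup.toPath, FundamentalGroup.toArrow,
      IsCoveringMap.monodromy_refl]
    simp
  map_mul' γ γ' := by
    have e₀ : expCover ⁻¹' {u} := ⟨Complex.log u.1, Subtype.ext (Complex.exp_log u.2)⟩
    rw [← ofAdd_add]
    congr 1
    refine winding_eq _ _ e₀ ?_
    rw [FundamentalGroup.mul_def, FundamentalGroup.toPath, FundamentalGroup.toArrow,
      IsCoveringMap.monodromy_trans_apply, monodromy_eq_winding, monodromy_eq_winding]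
    push_cast
    ring

/-- The total winding number of a loop of configurations around a point `p ∉ S`. On
`π₁(Conf_m(S))` this is the homomorphism that counts how often the particles run
counterclockwise around `p`; exchanging two particles away from `p` does not contribute. -/
def windingAbout {m : ℕ} {S : Set ℂ} (p : ℂ) (hp : p ∉ S) (c : Conf m S) :
    FundamentalGroup (Conf m S) c →* Multiplicative ℤ :=
  (windingHom (Conf.prodSub p hp c)).comp (FundamentalGroup.map (Conf.prodSub p hp) c)

/-! ### The punctured disc, the arcs and the ovals

The number of strands is `n = g + 1`. The disc is the closed disc of radius `n + 1` around `0`.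
Punctures are numbered by `j : Fin (g + 1)`, starting from `0`, and arcs and ovals by
`k : Fin g`, so that the arc and the oval with number `k` belong to the punctures `k.succ`. -/

/-- The distance of the `j`-th pair of punctures from the origin. -/
def rad (g : ℕ) (j : Fin (g + 1)) : ℝ := (g : ℝ) + 1 - (j : ℕ)

/-- The points `z_j`: from left to right `z_0 = -(g+1), …, z_g = -1`. -/
def zPt (g : ℕ) (j : Fin (g + 1)) : ℂ := -(rad g j : ℂ)

/-- The points `w_j`: from left to right `w_g = 1, …, w_0 = g + 1`. -/
def wPt (g : ℕ) (j : Fin (g + 1)) : ℂ := (rad g j : ℂ)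

/-- The disc with its `2 (g + 1)` punctures removed. -/
def puncturedDisc (g : ℕ) : Set ℂ :=
  Metric.closedBall 0 ((g : ℝ) + 2) \ (range (zPt g) ∪ range (wPt g))

theorem zPt_notMem (g : ℕ) (j : Fin (g + 1)) : zPt g j ∉ puncturedDisc g :=
  fun h => h.2 (Or.inl ⟨j, rfl⟩)

theorem wPt_notMem (g : ℕ) (j : Fin (g + 1)) : wPt g j ∉ puncturedDisc g :=
  fun h => h.2 (Or.inr ⟨j, rfl⟩)

/-- The configuration space of `n - 1 = g` points in the punctured disc. -/
abbrev DiscConf (g : ℕ) : Type := Conf g (puncturedDisc g)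

/-- The local system `φ : π₁(Conf_{n-1}(𝔻_n)) → ℤ`: a counterclockwise turn of one particle around
a puncture `z_j` counts `1`, around a puncture `w_j` it counts `-1`, and the exchange of two
particles counts `0`. -/
def localSystem (g : ℕ) (c : DiscConf g) : FundamentalGroup (DiscConf g) c →* Multiplicative ℤ :=
  (∏ j, windingAbout (zPt g j) (zPt_notMem g j) c) /
    ∏ j, windingAbout (wPt g j) (wPt_notMem g j) c

/-- The arc `a_k`, the upper half circle from `z_{k.succ}` (at `t = 0`) to `w_{k.succ}`
(at `t = 1`). -/
def arc (g : ℕ) (k : Fin g) (t : ℝ) : ℂ :=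
  (rad g k.succ : ℂ) * Complex.exp ((Real.pi * (1 - t) : ℝ) * Complex.I)

/-- Polar coordinates adapted to the `k`-th pair of punctures: the line `u = 0` is the circle
through `z_{k.succ}` and `w_{k.succ}`, the point `(0, 0)` is the lowest point of this circle, and
`(0, -2/3)`, `(0, 2/3)` are the punctures `z_{k.succ}` and `w_{k.succ}`. -/
def ovalCoord (g : ℕ) (k : Fin g) (u v : ℝ) : ℂ :=
  ((rad g k.succ + u / 4 : ℝ) : ℂ) *
    Complex.exp ((-(Real.pi / 2) + 3 * Real.pi / 4 * v : ℝ) * Complex.I)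

/-- The simple closed curve `b_k`, traversed counterclockwise, of period `2π`. It is a thin oval
around the lower half circle from `z_{k.succ}` to `w_{k.succ}`. -/
def oval (g : ℕ) (k : Fin g) (s : ℝ) : ℂ := ovalCoord g k (Real.cos s) (Real.sin s)

/-- The open disc bounded by `b_k`. -/
def ovalInside (g : ℕ) (k : Fin g) : Set ℂ :=
  {p | ∃ u v : ℝ, u ^ 2 + v ^ 2 < 1 ∧ p = ovalCoord g k u v}

/-- The complement of the closed disc bounded by `b_k`. -/
def ovalOutside (g : ℕ) (k : Fin g) : Set ℂ :=
  {p | ∀ u v : ℝ, u ^ 2 + v ^ 2 ≤ 1 → p ≠ ovalCoord g k u v}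

/-- The part of the disc in which the braid acts. It contains `z_0, …, z_g` and none of the
points `w_j`. -/
def braidDisc (g : ℕ) : Set ℂ :=
  Metric.closedBall (-(((g : ℝ) + 2) / 2 : ℝ) : ℂ) (((g : ℝ) + 1) / 2)

/-! ### Braids -/

theorem zPt_injective (g : ℕ) : Function.Injective (zPt g) := by
  intro i j h
  have h' : rad g i = rad g j := by
    have := neg_injective h
    exact_mod_cast this
  simp only [rad] at h'
  exact Fin.ext (by exact_mod_cast (by linarith : ((i : ℕ) : ℝ) = (j : ℕ)))

/-- The configuration `{z_0, …, z_g}` in the plane. -/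
def zConf (g : ℕ) : Conf (g + 1) ℂ := Conf.mk ⟨zPt g, zPt_injective g⟩

/-- The braid group on `n = g + 1` strands. -/
abbrev BraidGroup (g : ℕ) : Type := FundamentalGroup (Conf (g + 1) ℂ) (zConf g)

/-- The closure of a geometric braid, as a subset of `ℂ × ℝ/ℤ`, which is an open solid torus
standardly embedded in `S³`. -/
def braidClosure {g : ℕ} (γ : Path (zConf g) (zConf g)) : Set (ℂ × AddCircle (1 : ℝ)) :=
  {q | ∃ t : unitInterval, q.1 ∈ (γ t).points ∧ q.2 = ((t : ℝ) : AddCircle (1 : ℝ))}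

/-- A representative of the action of the braid `β` on the punctured disc: the end of an ambient
isotopy, supported in `braidDisc g`, that moves the points `z_j` along a geometric braid in the
class `β`. Homeomorphisms of the disc that fix the complement of `braidDisc g` are extended by the
identity to the plane. -/
structure BraidRep {g : ℕ} (β : BraidGroup g) where
  /-- a geometric braid -/
  strands : Path (zConf g) (zConf g)
  strands_eq : FundamentalGroup.fromPath (Path.Homotopic.Quotient.mk strands) = β
  /-- the ambient isotopy -/
  isotopy : unitInterval → (ℂ ≃ₜ ℂ)
  continuous_isotopy : Continuous fun q : unitInterval × ℂ => isotopy q.1 q.2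
  isotopy_zero : ∀ p, isotopy 0 p = p
  isotopy_support : ∀ t, ∀ p ∉ braidDisc g, isotopy t p = p
  isotopy_strands : ∀ t, Conf.mk ⟨fun j => isotopy t (zPt g j),
    (isotopy t).injective.comp (zPt_injective g)⟩ = strands t

/-- The homeomorphism at the end of the isotopy. -/
def BraidRep.toHomeo {g : ℕ} {β : BraidGroup g} (R : BraidRep β) : ℂ ≃ₜ ℂ := R.isotopy 1

/-- The closure of `β` is a knot: it has exactly one component. -/
def BraidRep.ClosureIsKnot {g : ℕ} {β : BraidGroup g} (R : BraidRep β) : Prop :=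
  IsConnected (braidClosure R.strands)

/-! ### Elementary facts about the disc model -/

section Facts

variable {g : ℕ}

theorem rad_pos (j : Fin (g + 1)) : 1 ≤ rad g j := by
  have : ((j : ℕ) : ℝ) ≤ g := by exact_mod_cast Nat.lt_succ_iff.1 j.2
  simp only [rad]; linarith

theorem rad_succ_le (k : Fin g) : rad g k.succ ≤ g := by
  have : (0 : ℝ) ≤ ((k : ℕ) : ℝ) := Nat.cast_nonneg _
  simp only [rad, Fin.val_succ]; push_cast; linarith

theorem rad_sub (i j : Fin (g + 1)) : ∃ N : ℤ, rad g i - rad g j = N ∧ (N = 0 ↔ i = j) := by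
  refine ⟨(j : ℕ) - (i : ℕ), by simp only [rad]; push_cast; ring, ?_⟩
  rw [Fin.ext_iff]; omega

theorem rad_eq_of_near {i j : Fin (g + 1)} {c d : ℝ} (hc : |c| ≤ 1 / 4) (hd : |d| ≤ 1 / 4)
    (h : rad g i + c = rad g j + d) : i = j := by
  obtain ⟨N, hN, hN'⟩ := rad_sub i j
  rw [abs_le] at hc hd
  have h1 : (N : ℝ) < 1 := by linarith
  have h2 : (-1 : ℝ) < N := by linarith
  have h3 : N < 1 := by exact_mod_cast h1
  have h4 : -1 < N := by exact_mod_cast h2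
  exact hN'.1 (by omega)

theorem norm_ovalCoord (k : Fin g) {u : ℝ} (hu : |u| ≤ 1) (v : ℝ) :
    ‖ovalCoord g k u v‖ = rad g k.succ + u / 4 := by
  have := rad_pos k.succ
  rw [abs_le] at hu
  rw [ovalCoord, norm_mul, Complex.norm_exp_ofReal_mul_I, Complex.norm_real, mul_one,
    Real.norm_of_nonneg (by linarith)]

theorem norm_arc (k : Fin g) (t : ℝ) : ‖arc g k t‖ = rad g k.succ := by
  have := rad_pos k.succ
  rw [arc, norm_mul, Complex.norm_exp_ofReal_mul_I, Complex.norm_real, mul_one,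
    Real.norm_of_nonneg (by linarith)]

theorem norm_zPt (j : Fin (g + 1)) : ‖zPt g j‖ = rad g j := by
  have := rad_pos j
  rw [zPt, norm_neg, Complex.norm_real, Real.norm_of_nonneg (by linarith)]

theorem norm_wPt (j : Fin (g + 1)) : ‖wPt g j‖ = rad g j := by
  have := rad_pos j
  rw [wPt, Complex.norm_real, Real.norm_of_nonneg (by linarith)]

theorem im_ovalCoord (k : Fin g) (u v : ℝ) :
    (ovalCoord g k u v).im = -(rad g k.succ + u / 4) * Real.cos (3 * Real.pi / 4 * v) := by
  rw [ovalCoord, Complex.im_ofReal_mul, Complex.exp_ofReal_mul_I_im, neg_add_eq_sub,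
    Real.sin_sub_pi_div_two]
  ring

theorem mem_puncturedDisc_of {p : ℂ} (h1 : ‖p‖ ≤ g + 2)
    (h2 : p.im ≠ 0 ∨ ∀ j : Fin (g + 1), ‖p‖ ≠ rad g j) : p ∈ puncturedDisc g := by
  refine ⟨by simpa using h1, ?_⟩
  rintro (⟨j, rfl⟩ | ⟨j, rfl⟩)
  · rcases h2 with h2 | h2
    · simp [zPt] at h2
    · exact h2 j (norm_zPt j)
  · rcases h2 with h2 | h2
    · simp [wPt] at h2
    · exact h2 j (norm_wPt j)

theorem ovalCoord_mem (k : Fin g) {u v : ℝ} (hu : |u| ≤ 1)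
    (h : u ≠ 0 ∨ Real.cos (3 * Real.pi / 4 * v) ≠ 0) : ovalCoord g k u v ∈ puncturedDisc g := by
  have hn := norm_ovalCoord k hu v
  have hr := rad_pos k.succ
  have hu' := abs_le.1 hu
  refine mem_puncturedDisc_of ?_ ?_
  · rw [hn]; have := rad_succ_le k; linarith
  · rcases h with h | h
    · refine Or.inr fun j hj => ?_
      rw [hn] at hj
      have hk : k.succ = j := rad_eq_of_near (c := u / 4) (d := 0)
        (by rw [abs_div, abs_of_pos (by norm_num : (0 : ℝ) < 4)]; linarith) (by norm_num)
        (by linarith)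
      rw [hk] at hj
      exact h (by linarith)
    · refine Or.inl ?_
      rw [im_ovalCoord]
      exact mul_ne_zero (by linarith) h

theorem oval_mem (k : Fin g) (s : ℝ) : oval g k s ∈ puncturedDisc g := by
  refine ovalCoord_mem k (Real.abs_cos_le_one s) ?_
  by_cases h : Real.cos s = 0
  · right
    have h1 : Real.sin s = 1 ∨ Real.sin s = -1 := by
      have := Real.sin_sq_add_cos_sq s
      rw [h] at this
      exact mul_self_eq_one_iff.1 (by linarith)
    have h2 : Real.cos (3 * Real.pi / 4) < 0 :=
      Real.cos_neg_of_pi_div_two_lt_of_lt (by linarith [Real.pi_pos]) (by linarith [Real.pi_pos])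
    rcases h1 with h1 | h1 <;> rw [h1]
    · rw [mul_one]; exact h2.ne
    · rw [mul_neg, mul_one, Real.cos_neg]; exact h2.ne
  · exact Or.inl h

theorem continuous_ovalCoord (k : Fin g) : Continuous fun q : ℝ × ℝ => ovalCoord g k q.1 q.2 := by
  unfold ovalCoord; fun_prop

theorem continuous_arc (k : Fin g) : Continuous (arc g k) := by
  unfold arc; fun_prop

theorem injective_of_norm_near {p : Fin g → ℂ}
    (h : ∀ k, |‖p k‖ - rad g k.succ| ≤ 1 / 4) : Function.Injective p := by
  intro i j hij
  refine Fin.succ_injective _ (rad_eq_of_near (h i) (h j) ?_)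
  simp only [hij, add_sub_cancel]

theorem abs_norm_ovalCoord (k : Fin g) {u : ℝ} (hu : |u| ≤ 1) (v : ℝ) :
    |‖ovalCoord g k u v‖ - rad g k.succ| ≤ 1 / 4 := by
  rw [norm_ovalCoord k hu, add_sub_cancel_left, abs_div, abs_of_pos (by norm_num : (0 : ℝ) < 4)]
  linarith

theorem re_of_mem_braidDisc {p : ℂ} (h : p ∈ braidDisc g) : p.re < 0 := by
  rw [braidDisc, Metric.mem_closedBall, dist_eq_norm] at h
  have := (Complex.abs_re_le_norm _).trans h
  have h' := (abs_le.1 this).2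
  simp at h'
  linarith

theorem braidDisc_subset {p : ℂ} (h : p ∈ braidDisc g) : ‖p‖ ≤ g + 2 := by
  rw [braidDisc, Metric.mem_closedBall, dist_eq_norm] at h
  have h1 : ‖(-(((g : ℝ) + 2) / 2 : ℝ) : ℂ)‖ = ((g : ℝ) + 2) / 2 := by
    rw [norm_neg, Complex.norm_real, Real.norm_of_nonneg (by positivity)]
  have h2 := norm_add_le (p - (-(((g : ℝ) + 2) / 2 : ℝ) : ℂ)) (-(((g : ℝ) + 2) / 2 : ℝ) : ℂ)
  rw [sub_add_cancel, h1] at h2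
  linarith

variable {β : BraidGroup g} (R : BraidRep β)

theorem toHomeo_of_notMem {p : ℂ} (h : p ∉ braidDisc g) : R.toHomeo p = p :=
  R.isotopy_support 1 p h

/-- The permutation `π` of the points `z_j` induced by the braid. -/
theorem exists_perm : ∃ π : Equiv.Perm (Fin (g + 1)), ∀ j, R.toHomeo (zPt g j) = zPt g (π j) := by
  have h := R.isotopy_strands 1
  rw [R.strands.target, zConf, Conf.mk_eq_mk_iff] at h
  obtain ⟨τ, h⟩ := h
  refine ⟨τ.symm, fun j => ?_⟩
  have h' := h (τ.symm j)
  simp only [Equiv.apply_symm_apply] at h'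
  exact h'.symm

theorem toHomeo_norm_le {p : ℂ} (h : ‖p‖ ≤ g + 2) : ‖R.toHomeo p‖ ≤ g + 2 := by
  by_cases hp : R.toHomeo p ∈ braidDisc g
  · exact braidDisc_subset hp
  · have := R.toHomeo.injective (toHomeo_of_notMem R hp)
    rwa [this]

theorem toHomeo_mem {p : ℂ} (h : p ∈ puncturedDisc g) : R.toHomeo p ∈ puncturedDisc g := by
  obtain ⟨π, hπ⟩ := exists_perm R
  refine ⟨by simpa using toHomeo_norm_le R (by simpa using h.1), ?_⟩
  rintro (⟨j, hj⟩ | ⟨j, hj⟩)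
  · refine h.2 (Or.inl ⟨π.symm j, R.toHomeo.injective ?_⟩)
    rw [hπ, Equiv.apply_symm_apply, hj]
  · have hw : R.toHomeo (wPt g j) = wPt g j := toHomeo_of_notMem R fun hG => by
      have h1 := re_of_mem_braidDisc hG
      have h2 := rad_pos j
      simp [wPt] at h1
      linarith
    refine h.2 (Or.inr ⟨j, R.toHomeo.injective ?_⟩)
    rw [hw, hj]

theorem arc_mem (k : Fin g) {t : ℝ} (ht : t ∈ Ioo (0 : ℝ) 1) : arc g k t ∈ puncturedDisc g := by
  refine mem_puncturedDisc_of ?_ (Or.inl ?_)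
  · rw [norm_arc]; have := rad_succ_le k; linarith
  · rw [arc, Complex.im_ofReal_mul, Complex.exp_ofReal_mul_I_im]
    have := rad_pos k.succ
    refine mul_ne_zero (by linarith) (Real.sin_pos_of_pos_of_lt_pi ?_ ?_).ne'
    · exact mul_pos Real.pi_pos (by linarith [ht.2])
    · nlinarith [Real.pi_pos, ht.1]

end Facts

/-! ### Intersection points and their loops -/

section Loops

variable {g : ℕ} {β : BraidGroup g} (R : BraidRep β)

/-- The submanifold `(β ∪ 𝕀) 𝒮`: one point on each of the (open) arcs `a_i' = h (a_i)`. -/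
def arcLagrangian : Set (DiscConf g) :=
  {c | ∃ f : OrdConf g (puncturedDisc g), Conf.mk f = c ∧
    ∀ i, ∃ t ∈ Ioo (0 : ℝ) 1, (f.1 i : ℂ) = R.toHomeo (arc g i t)}

variable (g) in
/-- The submanifold `𝒯`: one point on each of the curves `b_k`. -/
def ovalLagrangian : Set (DiscConf g) :=
  {c | ∃ f : OrdConf g (puncturedDisc g), Conf.mk f = c ∧ ∀ k, ∃ s : ℝ, (f.1 k : ℂ) = oval g k s}

/-- The set `I` of intersection points. -/
def intersectionPoints : Set (DiscConf g) := arcLagrangian R ∩ ovalLagrangian g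

/-- The parameters of an intersection point: for each `k` its point on the curve `b_k` is
`b_k(s_k) = a'_{π(k)}(t_k)`. -/
structure InterData where
  /-- the permutation `π` -/
  perm : Equiv.Perm (Fin g)
  /-- the parameters on the ovals -/
  s : Fin g → ℝ
  /-- the parameters on the arcs -/
  t : Fin g → ℝ
  s_mem : ∀ k, s k ∈ Ico 0 (2 * Real.pi)
  t_mem : ∀ k, t k ∈ Ioo (0 : ℝ) 1
  eq : ∀ k, R.toHomeo (arc g (perm k) (t k)) = oval g k (s k)

theorem oval_injective (s : Fin g → ℝ) :
    Function.Injective fun k => (⟨oval g k (s k), oval_mem k (s k)⟩ : puncturedDisc g) := by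
  refine Function.Injective.of_comp (f := Subtype.val) (injective_of_norm_near fun k => ?_)
  exact abs_norm_ovalCoord k (Real.abs_cos_le_one _) _

variable {R} in
/-- The configuration `{x_1, …, x_{n-1}}` with given parameters. -/
def InterData.conf (P : InterData R) : DiscConf g :=
  Conf.mk ⟨fun k => ⟨oval g k (P.s k), oval_mem k (P.s k)⟩, oval_injective P.s⟩

theorem exists_interData {x : DiscConf g} (hx : x ∈ intersectionPoints R) :
    ∃ P : InterData R, P.conf = x := by
  obtain ⟨⟨f, rfl, hf⟩, f', hff', hf'⟩ := hx
  obtain ⟨σ, hσ⟩ := Conf.mk_eq_mk_iff.1 hff'.symm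
  choose t ht hft using hf
  choose s hs using hf'
  have hper : ∀ k, oval g k (toIcoMod Real.two_pi_pos 0 (s k)) = oval g k (s k) := fun k => by
    have := self_sub_toIcoDiv_zsmul Real.two_pi_pos 0 (s k)
    rw [← this, oval, oval, zsmul_eq_mul, Real.cos_sub_int_mul_two_pi,
      Real.sin_sub_int_mul_two_pi]
  refine ⟨⟨σ, fun k => toIcoMod Real.two_pi_pos 0 (s k), fun k => t (σ k), fun k => ?_,
    fun k => ht _, fun k => ?_⟩, ?_⟩
  · simpa using toIcoMod_mem_Ico Real.two_pi_pos 0 (s k)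
  · rw [← hft, hper, ← hs, hσ]
  · rw [hff'.symm, InterData.conf]
    congr 1
    refine Subtype.ext (funext fun k => Subtype.ext ?_)
    simp only [hper, hs]

/-- The segment of a curve `f` in the punctured disc from the parameter `r₀` to `r₁`. -/
def segment (f : ℝ → ℂ) (hf : Continuous f) (r₀ r₁ : ℝ)
    (h : ∀ τ : unitInterval, f (r₀ + τ * (r₁ - r₀)) ∈ puncturedDisc g)
    {p q : puncturedDisc g} (hp : (p : ℂ) = f r₀) (hq : (q : ℂ) = f r₁) : Path p q where
  toFun τ := ⟨f (r₀ + τ * (r₁ - r₀)), h τ⟩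
  continuous_toFun := by fun_prop
  source' := Subtype.ext (by simp [hp])
  target' := Subtype.ext (by simp [hq])

/-- The base point `d_k`, the top of the arc `a_k`. -/
def basePt (k : Fin g) : puncturedDisc g := ⟨arc g k (1 / 2), arc_mem k (by norm_num)⟩

theorem basePt_injective : Function.Injective (basePt (g := g)) := by
  refine Function.Injective.of_comp (f := Subtype.val) (injective_of_norm_near fun k => ?_)
  simp [basePt, norm_arc]

variable (g) in
/-- The base point `𝐝 = {d_1, …, d_{n-1}}` of the configuration space. -/
def baseConf : DiscConf g := Conf.mk ⟨basePt, basePt_injective⟩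

/-- The sign of the side of `b_k` on which the point `b_k(s)`, `0 ≤ s < 2π`, lies: `1` for the
right-hand side and `-1` for the left-hand side. -/
def sideSign (s : ℝ) : ℝ := if s ≤ Real.pi then 1 else -1

/-- The path `η_k` (for `e = -1`) or `η_k'` (for `e = 1`), for `0 ≤ τ ≤ 1`. It starts at `d_k`,
stays below `a_k` and ends on the left-hand side or on the right-hand side of `b_k`. -/
def etaCurve (k : Fin g) (e τ : ℝ) : ℂ :=
  ovalCoord g k (-(τ / 2)) (e * (4 / 3 + τ * (√3 / 2 - 4 / 3)))

/-- The parameter on `b_k` of the end point of `η_k` or `η_k'`. -/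
def landing (e : ℝ) : ℝ := Real.pi - e * (Real.pi / 3)

theorem sideSign_eq (s : ℝ) : sideSign s = 1 ∨ sideSign s = -1 := by
  unfold sideSign; split_ifs <;> simp

theorem continuous_etaCurve (k : Fin g) (e : ℝ) : Continuous (etaCurve k e) :=
  (continuous_ovalCoord k).comp (f := fun τ : ℝ => (-(τ / 2), e * (4 / 3 + τ * (√3 / 2 - 4 / 3))))
    (by fun_prop)

theorem continuous_oval (k : Fin g) : Continuous (oval g k) :=
  (continuous_ovalCoord k).comp (f := fun s : ℝ => (Real.cos s, Real.sin s)) (by fun_prop)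

theorem etaCurve_mem (k : Fin g) {e : ℝ} (he : e = 1 ∨ e = -1) (τ : unitInterval) :
    etaCurve k e τ ∈ puncturedDisc g := by
  refine ovalCoord_mem k ?_ ?_
  · rw [abs_neg, abs_of_nonneg (by linarith [τ.2.1])]; linarith [τ.2.2]
  · by_cases hτ : (τ : ℝ) = 0
    · right
      rw [hτ]
      have : 3 * Real.pi / 4 * (e * (4 / 3 + 0 * (√3 / 2 - 4 / 3))) = e * Real.pi := by ring
      rw [this]
      rcases he with rfl | rfl <;> simp
    · left
      simpa using hτ

theorem basePt_eq (k : Fin g) {e : ℝ} (he : e = 1 ∨ e = -1) :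
    (basePt k : ℂ) = etaCurve k e 0 := by
  have h1 : Complex.exp ((Real.pi * (1 - 1 / 2) : ℝ) * Complex.I) = Complex.I := by
    have : ((Real.pi * (1 - 1 / 2) : ℝ) : ℂ) = Real.pi / 2 := by push_cast; ring
    rw [this, Complex.exp_pi_div_two_mul_I]
  have h2 : Complex.exp ((-(Real.pi / 2) + 3 * Real.pi / 4 *
      (e * (4 / 3 + 0 * (√3 / 2 - 4 / 3))) : ℝ) * Complex.I) = Complex.I := by
    rcases he with rfl | rfl
    · have : ((-(Real.pi / 2) + 3 * Real.pi / 4 * (1 * (4 / 3 + 0 * (√3 / 2 - 4 / 3))) : ℝ) : ℂ) =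
          Real.pi / 2 := by push_cast; ring
      rw [this, Complex.exp_pi_div_two_mul_I]
    · have : ((-(Real.pi / 2) + 3 * Real.pi / 4 * (-1 * (4 / 3 + 0 * (√3 / 2 - 4 / 3))) : ℝ) : ℂ) *
          Complex.I = Real.pi / 2 * Complex.I - 2 * Real.pi * Complex.I := by push_cast; ring
      rw [this, Complex.exp_sub, Complex.exp_pi_div_two_mul_I, Complex.exp_two_pi_mul_I, div_one]
  change (rad g k.succ : ℂ) * Complex.exp ((Real.pi * (1 - 1 / 2) : ℝ) * Complex.I) = _
  rw [etaCurve, ovalCoord, h1, h2]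
  simp

theorem oval_landing (k : Fin g) {e : ℝ} (he : e = 1 ∨ e = -1) :
    oval g k (landing e) = etaCurve k e 1 := by
  have h1 : Real.cos (landing e) = -(1 / 2) := by
    rcases he with rfl | rfl <;> simp [landing, Real.cos_pi_sub, Real.cos_add]
  have h2 : Real.sin (landing e) = e * (√3 / 2) := by
    rcases he with rfl | rfl <;> simp [landing, Real.sin_pi_sub, Real.sin_add]
  rw [oval, etaCurve, h1, h2]
  congr 2
  ring

/-- The path `η_k` or `η_k'` from `d_k` to `b_k`. -/
def etaPath (k : Fin g) {e : ℝ} (he : e = 1 ∨ e = -1) :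
    Path (basePt k) ⟨oval g k (landing e), oval_mem k _⟩ :=
  segment (etaCurve k e) (continuous_etaCurve k e) 0 1
    (fun τ => by simpa using etaCurve_mem k he τ) (basePt_eq k he) (oval_landing k he)

/-- The path along `b_k` between two parameters. -/
def ovalPath (k : Fin g) (s₀ s : ℝ) :
    Path (⟨oval g k s₀, oval_mem k _⟩ : puncturedDisc g) ⟨oval g k s, oval_mem k _⟩ :=
  segment (oval g k) (continuous_oval k) s₀ s (fun _ => oval_mem k _) rfl rfl

theorem norm_etaPath (k : Fin g) {e : ℝ} (he : e = 1 ∨ e = -1) (τ : unitInterval) :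
    |‖(etaPath k he τ : ℂ)‖ - rad g k.succ| ≤ 1 / 4 := by
  change |‖etaCurve k e (0 + τ * (1 - 0))‖ - rad g k.succ| ≤ 1 / 4
  refine abs_norm_ovalCoord k ?_ _
  rw [abs_neg, abs_of_nonneg (by linarith [τ.2.1])]; linarith [τ.2.2]

theorem norm_ovalPath (k : Fin g) (s₀ s : ℝ) (τ : unitInterval) :
    |‖(ovalPath k s₀ s τ : ℂ)‖ - rad g k.succ| ≤ 1 / 4 :=
  abs_norm_ovalCoord k (Real.abs_cos_le_one _) _

namespace InterData

variable {R} (P : InterData R)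

/-- The path `ν̄^k` from `d_k` to `x_k`: first along `η_k` or `η_k'`, depending on the side of `b_k`
on which `x_k` lies, then along this side of `b_k`. -/
def nuBar (k : Fin g) : Path (basePt k) ⟨oval g k (P.s k), oval_mem k _⟩ :=
  (etaPath k (sideSign_eq (P.s k))).trans (ovalPath k (landing (sideSign (P.s k))) (P.s k))

theorem norm_nuBar (k : Fin g) (τ : unitInterval) :
    |‖(P.nuBar k τ : ℂ)‖ - rad g k.succ| ≤ 1 / 4 := by
  rw [nuBar, Path.trans_apply]
  split_ifs
  · exact norm_etaPath _ _ _
  · exact norm_ovalPath _ _ _ _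

theorem nuBar_injective (τ : unitInterval) : Function.Injective fun k => P.nuBar k τ :=
  Function.Injective.of_comp (f := Subtype.val)
    (injective_of_norm_near fun k => P.norm_nuBar k τ)

theorem arc_param_mem (k : Fin g) (τ : unitInterval) :
    P.t k + τ * (1 / 2 - P.t k) ∈ Ioo (0 : ℝ) 1 := by
  have h := P.t_mem k
  have h1 := τ.2.1
  have h2 := τ.2.2
  constructor <;> nlinarith [h.1, h.2]

/-- The path `ν^k` from `x_k` to `d_{π(k)}` along the arc `a'_{π(k)}`. -/
def nu (k : Fin g) :
    Path (⟨oval g k (P.s k), oval_mem k _⟩ : puncturedDisc g) (basePt (P.perm k)) :=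
  segment (fun t => R.toHomeo (arc g (P.perm k) t))
    (R.toHomeo.continuous.comp (continuous_arc _)) (P.t k) (1 / 2)
    (fun τ => toHomeo_mem R (arc_mem _ (P.arc_param_mem k τ))) (P.eq k).symm (by
      refine (toHomeo_of_notMem R fun h => ?_).symm
      have h1 := re_of_mem_braidDisc h
      change ((rad g (P.perm k).succ : ℂ) *
        Complex.exp ((Real.pi * (1 - 1 / 2) : ℝ) * Complex.I)).re < 0 at h1
      rw [Complex.re_ofReal_mul, Complex.exp_ofReal_mul_I_re] at h1
      have h2 : Real.pi * (1 - 1 / 2) = Real.pi / 2 := by ring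
      rw [h2, Real.cos_pi_div_two, mul_zero] at h1
      exact lt_irrefl _ h1)

theorem nu_injective (τ : unitInterval) : Function.Injective fun k => P.nu k τ := by
  intro i j hij
  have h : R.toHomeo (arc g (P.perm i) (P.t i + τ * (1 / 2 - P.t i))) =
      R.toHomeo (arc g (P.perm j) (P.t j + τ * (1 / 2 - P.t j))) := congrArg Subtype.val hij
  have h' := congrArg norm (R.toHomeo.injective h)
  rw [norm_arc, norm_arc] at h'
  exact P.perm.injective (Fin.succ_injective _
    (rad_eq_of_near (c := 0) (d := 0) (by norm_num) (by norm_num) (by simpa using h')))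

/-- The path `η̄_x` from `𝐝` to `x`. -/
def firstHalf : Path (baseConf g) P.conf :=
  Conf.path P.nuBar P.nuBar_injective basePt_injective (oval_injective P.s)

/-- The path `η_x` from `x` to `𝐝`. -/
def secondHalf : Path P.conf (baseConf g) :=
  (Conf.path P.nu P.nu_injective (oval_injective P.s)
    (basePt_injective.comp P.perm.injective)).cast rfl
    (Conf.mk_eq_mk_iff.2 ⟨P.perm.symm, fun k => by simp⟩).symm

/-- The loop `l_x`, based at `𝐝`. -/
def loop : Path (baseConf g) (baseConf g) := P.firstHalf.trans P.secondHalf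

end InterData

/-- The Alexander grading in the disc model, `A^Pd(x) = φ(l_x)`, written additively. -/
def gradingPd (x : intersectionPoints R) : ℤ :=
  (localSystem g (baseConf g) (FundamentalGroup.fromPath (Path.Homotopic.Quotient.mk
    (exists_interData R x.2).choose.loop))).toAdd

end Loops

/-! ### The Heegaard diagram -/

section Heegaard

variable {g : ℕ} {β : BraidGroup g} (R : BraidRep β) (ε : ℝ)

/-- The number `ε` is small enough for attaching the tubes: the discs that are removed around the
end points of the arcs `a_i'` are disjoint from each other and from the curves `b_k`. -/
structure IsTubeRadius : Prop where
  pos : 0 < ε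
  lt_half : ε < 1 / 2
  disjoint_z : ∀ (i k : Fin g) (s : ℝ),
    oval g k s ∉ R.toHomeo '' Metric.closedBall (zPt g i.succ) ε
  disjoint_w : ∀ (i k : Fin g) (s : ℝ), oval g k s ∉ Metric.closedBall (wPt g i.succ) ε

/-- The open discs that are removed around the end points of the arcs `a_i'`. -/
def removedDiscs : Set ℂ :=
  ⋃ i : Fin g, R.toHomeo '' Metric.ball (zPt g i.succ) ε ∪ Metric.ball (wPt g i.succ) ε

/-- The sphere (the disc with a disc glued to its boundary) without the removed discs. -/
def planarPart : Set (OnePoint ℂ) := ((↑) '' removedDiscs R ε)ᶜ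

/-- The boundary circles of the two discs removed at the ends of `a_i'` are identified by the
orientation-reversing homeomorphism induced by the reflection `ζ ↦ -ζ̄`, which exchanges the two
ends of `a_i`. -/
def glue (p q : planarPart R ε) : Prop :=
  ∃ i : Fin g, ∃ ζ ∈ Metric.sphere (zPt g i.succ) ε,
    (p : OnePoint ℂ) = ((R.toHomeo ζ : ℂ) : OnePoint ℂ) ∧
    (q : OnePoint ℂ) = ((-(starRingEnd ℂ ζ) : ℂ) : OnePoint ℂ)

/-- The surface `Σ` of genus `g = n - 1`, the result of surgery on the sphere along the `0`-spheres
`∂a_i'`. -/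
def HeegaardSurface : Type := Quot (glue R ε)

instance : TopologicalSpace (HeegaardSurface R ε) :=
  inferInstanceAs (TopologicalSpace (Quot (glue R ε)))

variable {R ε} in
/-- The projection of the planar part to `Σ`. -/
def toSurface (p : planarPart R ε) : HeegaardSurface R ε := Quot.mk _ p

/-- The curve `α_i`: the part of the arc `a_i'` outside the removed discs. Its two ends are
identified in `Σ`. -/
def alphaCurve (i : Fin g) : Set (HeegaardSurface R ε) :=
  {x | ∃ p : planarPart R ε, toSurface p = x ∧
    ∃ t ∈ Icc (0 : ℝ) 1, (p : OnePoint ℂ) = ((R.toHomeo (arc g i t) : ℂ) : OnePoint ℂ)}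

/-- The curve `β_k = b_k`. -/
def betaCurve (k : Fin g) : Set (HeegaardSurface R ε) :=
  {x | ∃ p : planarPart R ε, toSurface p = x ∧
    ∃ s : ℝ, (p : OnePoint ℂ) = ((oval g k s : ℂ) : OnePoint ℂ)}

/-- The union of all curves `α_i` and `β_k`. -/
def curves : Set (HeegaardSurface R ε) := (⋃ i, alphaCurve R ε i) ∪ ⋃ k, betaCurve R ε k

/-- The regions: the connected components of the complement of the curves. -/
abbrev Region : Type := ConnectedComponents ((curves R ε)ᶜ : Set (HeegaardSurface R ε))

/-- Domains: integral linear combinations of the (finitely many) regions. -/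
abbrev Domain : Type := Region R ε → ℤ

variable {R ε}

open Classical in
/-- The multiplicity `n_p(D)` of a domain at a point `p` of `Σ` that lies on no curve: the coefficient
of the region of `p`. (For the domain of a Whitney disc `u` it is the intersection number of `u`
with the hypersurface `V_p` of the symmetric power.) -/
def Domain.multiplicity (D : Domain R ε) (p : HeegaardSurface R ε) : ℤ :=
  if hp : p ∈ (curves R ε)ᶜ then D (ConnectedComponents.mk ⟨p, hp⟩) else 0

open Classical in
/-- The multiplicity of a domain at a point of the plane that lies outside the removed discs. -/
def Domain.planarMultiplicity (D : Domain R ε) (p : ℂ) : ℤ :=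
  if hp : (p : OnePoint ℂ) ∈ planarPart R ε then D.multiplicity (toSurface ⟨p, hp⟩) else 0

/-- The number `c` is the multiplicity of `D` near `p` on the side `S`. -/
def Domain.IsSideMultiplicity (D : Domain R ε) (S : Set ℂ) (p : ℂ) (c : ℤ) : Prop :=
  ∀ᶠ q in 𝓝[S] p, D.planarMultiplicity q = c

/-- The number `c` is the coefficient of the `1`-chain `∂D` at the point `a_i'(t)` of `α_i`, which
is oriented from `a_i'(0)` to `a_i'(1)`. The surface `Σ` is oriented as the boundary of the
`α`-handlebody, which lies above the disc, so the left-hand side of `α_i` in `Σ` is its right-hand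
side in the plane, the image of the inner side of the half circle `a_i`. -/
def Domain.IsAlphaCoeff (D : Domain R ε) (i : Fin g) (t : ℝ) (c : ℤ) : Prop :=
  ∃ l r : ℤ,
    D.IsSideMultiplicity (R.toHomeo '' {q | ‖q‖ < rad g i.succ}) (R.toHomeo (arc g i t)) l ∧
    D.IsSideMultiplicity (R.toHomeo '' {q | rad g i.succ < ‖q‖}) (R.toHomeo (arc g i t)) r ∧
    c = l - r

/-- The number `c` is the coefficient of the `1`-chain `∂D` at the point `b_k(s)` of `β_k`, which is
oriented counterclockwise in the plane. In `Σ`, its left-hand side is the outer side. -/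
def Domain.IsBetaCoeff (D : Domain R ε) (k : Fin g) (s : ℝ) (c : ℤ) : Prop :=
  ∃ l r : ℤ, D.IsSideMultiplicity (ovalOutside g k) (oval g k s) l ∧
    D.IsSideMultiplicity (ovalInside g k) (oval g k s) r ∧ c = l - r

/-- A `1`-chain on an oriented curve is given by its coefficients `C` on the edges. The coefficient
of its boundary at the parameter `t` is the coefficient of the edge that ends there minus the
coefficient of the edge that starts there. -/
def IsBoundaryCoeff (C : ℝ → ℤ → Prop) (t : ℝ) (m : ℤ) : Prop :=
  ∃ c c' : ℤ, (∀ᶠ r in 𝓝[<] t, C r c) ∧ (∀ᶠ r in 𝓝[>] t, C r c') ∧ c - c' = m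

open Classical in
/-- A configuration as a `0`-chain: the coefficient of the point `p`. The points of an intersection
point of the two Lagrangians lie on the curves `b_k`, hence in the planar part, which embeds in `Σ`
away from the boundary circles. In this way they are the intersection points of the tori
`α_1 × ⋯ × α_g` and `β_1 × ⋯ × β_g` in the symmetric power of `Σ`. -/
def pointCoeff (x : DiscConf g) (p : ℂ) : ℤ := if p ∈ Subtype.val '' x.points then 1 else 0

/-- The domain `D` connects `x` to `y`: the boundary of the `1`-chain `∂D ∩ α` is `x - y` and the
boundary of the `1`-chain `∂D ∩ β` is `y - x`. -/
structure Domain.Connects (D : Domain R ε) (x y : DiscConf g) : Prop where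
  alpha : ∀ (i : Fin g) (t : ℝ), t ∈ Ioo (0 : ℝ) 1 →
    arc g i t ∉ Metric.closedBall (zPt g i.succ) ε →
    arc g i t ∉ Metric.closedBall (wPt g i.succ) ε →
    IsBoundaryCoeff (D.IsAlphaCoeff i) t
      (pointCoeff x (R.toHomeo (arc g i t)) - pointCoeff y (R.toHomeo (arc g i t)))
  beta : ∀ (k : Fin g) (s : ℝ), IsBoundaryCoeff (D.IsBetaCoeff k) s
      (pointCoeff y (oval g k s) - pointCoeff x (oval g k s))

/-- The Alexander grading of a domain, `A^HF(D) = n_z(D) - n_w(D)`, where `z = z_{π(1)}` is the image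
of the leftmost base point under the braid action and `w = w_1` is the rightmost base point. -/
def Domain.alexander (D : Domain R ε) : ℤ :=
  D.planarMultiplicity (R.toHomeo (zPt g 0)) - D.planarMultiplicity (wPt g 0)

end Heegaard

end BraidModel

end

/-!
Both gradings are computed by the winding numbers of one cycle in the plane. Choose parameters of the
points of `x` and of `y` on the ovals and on the arcs. Running on each oval `b_k` from the point of
`y` to the point of `x`, and on each arc `a_i'` from the point of `x` to the point of `y`, one obtains
a cycle `Z` in the punctured disc (`interCycle`). Up to `Z`, the loops `l_x` and `l_y` differ by the
choice between `η_k` and `η_k'`. This choice has no effect: the two ways from `d_k` to `b_k` form a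
loop that the reflection `ζ ↦ -ζ̄` maps to its inverse, while it reverses the orientation of the plane
and exchanges `z_j` and `w_j`, so the loop winds equally often about both (`approach_sub`).
Hence `A^Pd(x) - A^Pd(y)` is the sum over `j` of the winding numbers of `Z` about `z_j` minus
those about `w_j` (`exists_gradingPd_sub`).

The winding number of `Z` jumps across the curves by the multiplicity of the curve in `Z`
(`CurveCycle.exists_wnum_eq`). All winding numbers are defined by the change of a continuous
logarithm (`logChange`).

Let a domain `D` connect `x` to `y`. Its multiplicities are a locally constant function on the
complement of the curves and of the removed discs. The coefficients of `∂D` have the same jumps as the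
multiplicities of `Z`, so they agree with them up to a constant on each curve
(`exists_eq_add_of_boundary`). On `α_i` the constant vanishes: a slit annulus around an end of `a_i'`
joins the two sides of the arc, so that `D` has the same multiplicity on both of them
(`exists_tube_multiplicity`). Therefore, continued over the removed discs by the value on the tubes,
the multiplicity of `D` is the winding number of `Z`, plus a combination of the discs bounded by the
ovals, plus a constant (`exists_capped_eq`); a function on the plane without jumps is constant
(`exists_eq_of_eventually_const`). The continued function takes the same value at `h(z_i)` and
`w_i` for the ends of each tube, so `n_z(D) - n_w(D)` is the sum over all `j` of its values at
`h(z_j)` minus those at `w_j`. The braid permutes the points `z_j`, and each oval encloses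
`z_j` and `w_j` for the same `j`, so this is again the sum of the differences of winding numbers of
`Z` (`alexander_eq`).

For the existence of `D` one needs coefficients of the discs bounded by the ovals such that the
resulting function of the plane takes the same value at both ends of each tube. This prescribes
the differences of the coefficients along the permutation of the braid, except at one point. Since the
closure is a knot, the permutation is a single cycle (`sameCycle_of_closureIsKnot`), and the
coefficients exist (`exists_connects`).
-/

open Set Filter
open scoped Topology

namespace BraidModel

/-! ### The change of the logarithm along a curve -/

open Classical in
/-- The change of a continuous logarithm of `f` along the (possibly reversed) interval from `a` to
`b`. It is `0` if there is no such logarithm. -/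
noncomputable def logChange (f : ℝ → ℂ) (a b : ℝ) : ℂ :=
  if h : ∃ L : ℝ → ℂ, ContinuousOn L (uIcc a b) ∧ ∀ t ∈ uIcc a b, Complex.exp (L t) = f t then
    h.choose b - h.choose a else 0

/-- Two continuous logarithms of the same function on a connected set differ by a constant. -/
theorem log_sub_eq_of_preconnected {X : Type*} [TopologicalSpace X] {s : Set X}
    (hs : IsPreconnected s) {L L' : X → ℂ}
    (hL : ContinuousOn L s) (hL' : ContinuousOn L' s)
    (h : ∀ t ∈ s, Complex.exp (L t) = Complex.exp (L' t)) {a b : X} (ha : a ∈ s) (hb : b ∈ s) :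
    L b - L a = L' b - L' a := by
  have key : ∀ t ∈ s, ∃ N : ℤ, L t - L' t = N * (2 * Real.pi * Complex.I) := fun t ht => by
    obtain ⟨N, hN⟩ := Complex.exp_eq_exp_iff_exists_int.1 (h t ht)
    exact ⟨N, by rw [hN]; ring⟩
  choose! N hN using key
  have hcont : ContinuousOn N s := by
    have h1 : ContinuousOn (fun t => ((L t - L' t) / (2 * Real.pi * Complex.I)).re) s :=
      Complex.continuous_re.comp_continuousOn ((hL.sub hL').div_const _)
    have h2 : ContinuousOn (fun t => ((N t : ℤ) : ℝ)) s := by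
      refine h1.congr fun t ht => ?_
      simp only
      rw [hN t ht, mul_div_cancel_right₀ _ Complex.two_pi_I_ne_zero, Complex.intCast_re]
    exact (Int.isClosedEmbedding_coe_real.isInducing.continuousOn_iff).2 h2
  have := hs.constant hcont ha hb
  have h1 := hN a ha
  have h2 := hN b hb
  rw [this] at h1
  linear_combination h2 - h1

theorem logChange_eq {f L : ℝ → ℂ} {a b : ℝ} (hL : ContinuousOn L (uIcc a b))
    (h : ∀ t ∈ uIcc a b, Complex.exp (L t) = f t) : logChange f a b = L b - L a := by
  have hex : ∃ L : ℝ → ℂ, ContinuousOn L (uIcc a b) ∧ ∀ t ∈ uIcc a b, Complex.exp (L t) = f t :=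
    ⟨L, hL, h⟩
  rw [logChange, dif_pos hex]
  exact log_sub_eq_of_preconnected isPreconnected_uIcc hex.choose_spec.1 hL
    (fun t ht => (hex.choose_spec.2 t ht).trans (h t ht).symm) left_mem_uIcc right_mem_uIcc

/-- A continuous function without zeros on an interval has a continuous logarithm. -/
theorem exists_continuous_log {f : ℝ → ℂ} {a b : ℝ} (hab : a ≤ b) (hf : ContinuousOn f (Icc a b))
    (h0 : ∀ t ∈ Icc a b, f t ≠ 0) :
    ∃ L : ℝ → ℂ, Continuous L ∧ ∀ t ∈ Icc a b, Complex.exp (L t) = f t := by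
  let F : C(ℝ, {u : ℂ // u ≠ 0}) :=
    ⟨fun t => ⟨f (projIcc a b hab t), h0 _ (projIcc a b hab t).2⟩,
      Continuous.subtype_mk ((continuousOn_iff_continuous_domRestrict.1 hf).comp
        continuous_projIcc) _⟩
  have hF : expCover (Complex.log (F 0).1) = F 0 := Subtype.ext (Complex.exp_log (F 0).2)
  obtain ⟨L, ⟨-, hL⟩, -⟩ := isCoveringMap_expCover.existsUnique_continuousMap_lifts F 0 _ hF
  refine ⟨L, L.continuous, fun t ht => ?_⟩
  have h1 : Complex.exp (L t) = f (projIcc a b hab t) := congrArg Subtype.val (congrFun hL t)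
  rwa [projIcc_of_mem hab ht] at h1

theorem exists_continuous_log_uIcc {f : ℝ → ℂ} {a b : ℝ} (hf : ContinuousOn f (uIcc a b))
    (h0 : ∀ t ∈ uIcc a b, f t ≠ 0) :
    ∃ L : ℝ → ℂ, Continuous L ∧ ∀ t ∈ uIcc a b, Complex.exp (L t) = f t :=
  exists_continuous_log inf_le_sup hf h0

theorem logChange_congr {f f' : ℝ → ℂ} {a b : ℝ} (h : EqOn f f' (uIcc a b)) :
    logChange f a b = logChange f' a b := by
  by_cases hf : ∃ L : ℝ → ℂ, ContinuousOn L (uIcc a b) ∧ ∀ t ∈ uIcc a b, Complex.exp (L t) = f t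
  · obtain ⟨L, hL, hL'⟩ := hf
    rw [logChange_eq hL hL', logChange_eq hL fun t ht => (hL' t ht).trans (h ht)]
  · have hf' : ¬∃ L : ℝ → ℂ, ContinuousOn L (uIcc a b) ∧
        ∀ t ∈ uIcc a b, Complex.exp (L t) = f' t := fun ⟨L, hL, hL'⟩ =>
      hf ⟨L, hL, fun t ht => (hL' t ht).trans (h ht).symm⟩
    rw [logChange, logChange, dif_neg hf, dif_neg hf']

theorem exp_logChange {f : ℝ → ℂ} {a b : ℝ} (hf : ContinuousOn f (uIcc a b))
    (h0 : ∀ t ∈ uIcc a b, f t ≠ 0) : Complex.exp (logChange f a b) = f b / f a := by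
  obtain ⟨L, hL, h⟩ := exists_continuous_log_uIcc hf h0
  rw [logChange_eq hL.continuousOn h, Complex.exp_sub, h _ right_mem_uIcc, h _ left_mem_uIcc]

@[simp] theorem logChange_self (f : ℝ → ℂ) (a : ℝ) : logChange f a a = 0 := by
  unfold logChange
  split_ifs <;> simp

/-- The change of the logarithm is additive, provided that the function has no zeros on the hull of
the three points. -/
theorem logChange_add_of_Icc {f : ℝ → ℂ} {m M a b c : ℝ} (hf : ContinuousOn f (Icc m M))
    (h0 : ∀ t ∈ Icc m M, f t ≠ 0) (ha : a ∈ Icc m M) (hb : b ∈ Icc m M) (hc : c ∈ Icc m M) :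
    logChange f a b + logChange f b c = logChange f a c := by
  obtain ⟨L, hL, h⟩ := exists_continuous_log (ha.1.trans ha.2) hf h0
  have key : ∀ {x y}, x ∈ Icc m M → y ∈ Icc m M → logChange f x y = L y - L x := fun hx hy =>
    logChange_eq hL.continuousOn fun t ht => h t (uIcc_subset_Icc hx hy ht)
  rw [key ha hb, key hb hc, key ha hc]
  ring

theorem logChange_add {f : ℝ → ℂ} {a b c : ℝ} (hf : Continuous f)
    (h1 : ∀ t ∈ uIcc a b, f t ≠ 0) (h2 : ∀ t ∈ uIcc b c, f t ≠ 0) :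
    logChange f a b + logChange f b c = logChange f a c := by
  refine logChange_add_of_Icc (m := min a (min b c)) (M := max a (max b c)) hf.continuousOn
    (fun t ht => ?_) (by simp) (by simp) (by simp)
  by_cases ht1 : t ∈ uIcc a b
  · exact h1 t ht1
  · refine h2 t ?_
    simp only [mem_uIcc, mem_Icc] at ht ht1 ⊢
    grind

theorem exp_logChange_sub {γ : ℝ → ℂ} (hγ : Continuous γ) {a b : ℝ} {p : ℂ}
    (h : ∀ t ∈ uIcc a b, γ t - p ≠ 0) :
    Complex.exp (logChange (fun t => γ t - p) a b) = (γ b - p) / (γ a - p) :=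
  exp_logChange (hγ.sub continuous_const).continuousOn h

theorem logChange_sub_add {γ : ℝ → ℂ} (hγ : Continuous γ) {a b c : ℝ} {p : ℂ}
    (h1 : ∀ t ∈ uIcc a b, γ t - p ≠ 0) (h2 : ∀ t ∈ uIcc b c, γ t - p ≠ 0) :
    logChange (fun t => γ t - p) a b + logChange (fun t => γ t - p) b c =
      logChange (fun t => γ t - p) a c :=
  logChange_add (hγ.sub continuous_const) h1 h2

theorem logChange_symm (f : ℝ → ℂ) (a b : ℝ) : logChange f b a = -logChange f a b := by
  by_cases h : ∃ L : ℝ → ℂ, ContinuousOn L (uIcc a b) ∧ ∀ t ∈ uIcc a b, Complex.exp (L t) = f t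
  · obtain ⟨L, hL, h⟩ := h
    rw [logChange_eq hL h, logChange_eq (uIcc_comm a b ▸ hL) (uIcc_comm a b ▸ h)]
    ring
  · rw [logChange, logChange, dif_neg h, dif_neg (uIcc_comm a b ▸ h), neg_zero]

theorem logChange_comp_affine {f : ℝ → ℂ} (c d : ℝ) {a b : ℝ}
    (hf : ContinuousOn f (uIcc (c * a + d) (c * b + d)))
    (h0 : ∀ t ∈ uIcc (c * a + d) (c * b + d), f t ≠ 0) :
    logChange (fun t => f (c * t + d)) a b = logChange f (c * a + d) (c * b + d) := by
  have hmem : ∀ t ∈ uIcc a b, c * t + d ∈ uIcc (c * a + d) (c * b + d) := fun t ht => by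
    rw [mem_uIcc] at ht ⊢
    rcases le_total 0 c with hc | hc <;> rcases ht with ht | ht
    · left; constructor <;> nlinarith [ht.1, ht.2]
    · right; constructor <;> nlinarith [ht.1, ht.2]
    · right; constructor <;> nlinarith [ht.1, ht.2]
    · left; constructor <;> nlinarith [ht.1, ht.2]
  obtain ⟨L, hL, h⟩ := exists_continuous_log_uIcc hf h0
  rw [logChange_eq hL.continuousOn h]
  exact logChange_eq (L := fun t => L (c * t + d)) (by fun_prop) fun t ht => h _ (hmem t ht)

/-- If `f'` stays closer to `f` than `0` does, the changes of their logarithms differ only by the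
changes at the two ends. -/
theorem logChange_eq_add_of_norm_lt {f f' : ℝ → ℂ} {a b : ℝ} (hf : ContinuousOn f (uIcc a b))
    (hf' : ContinuousOn f' (uIcc a b)) (h : ∀ t ∈ uIcc a b, ‖f' t - f t‖ < ‖f t‖) :
    logChange f' a b =
      logChange f a b + (Complex.log (f' b / f b) - Complex.log (f' a / f a)) := by
  have h0 : ∀ t ∈ uIcc a b, f t ≠ 0 := fun t ht => norm_pos_iff.1 ((norm_nonneg _).trans_lt (h t ht))
  have hs : ∀ t ∈ uIcc a b, f' t / f t ∈ Complex.slitPlane := fun t ht => by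
    have h1 : ‖f' t / f t - 1‖ < 1 := by
      rw [div_sub_one (h0 t ht), norm_div, div_lt_one (norm_pos_iff.2 (h0 t ht))]
      exact h t ht
    simpa using Complex.mem_slitPlane_of_norm_lt_one h1
  obtain ⟨L, hL, hL'⟩ := exists_continuous_log_uIcc hf h0
  rw [logChange_eq hL.continuousOn hL',
    logChange_eq (L := fun t => L t + Complex.log (f' t / f t))
      (hL.continuousOn.add ((hf'.div hf h0).clog hs)) fun t ht => ?_]
  · ring
  · rw [Complex.exp_add, hL' t ht, Complex.exp_log (Complex.slitPlane_ne_zero (hs t ht)),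
      mul_div_cancel₀ _ (h0 t ht)]

/-- The change of `log (γ - p)` is continuous in `p` away from the curve `γ`. -/
theorem continuousAt_logChange_sub {γ : ℝ → ℂ} (hγ : Continuous γ) {a b : ℝ} {p₀ : ℂ}
    (h : ∀ t ∈ uIcc a b, γ t ≠ p₀) :
    ContinuousAt (fun p => logChange (fun t => γ t - p) a b) p₀ := by
  have hne : ∀ t ∈ uIcc a b, γ t - p₀ ≠ 0 := fun t ht => sub_ne_zero.2 (h t ht)
  have hnear : ∀ᶠ p in 𝓝 p₀, ∀ t ∈ uIcc a b, ‖(γ t - p) - (γ t - p₀)‖ < ‖γ t - p₀‖ := by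
    refine isCompact_uIcc.eventually_forall_of_forall_eventually fun t ht => ?_
    refine ContinuousAt.eventually_lt (by fun_prop) (by fun_prop) ?_
    simpa using hne t ht
  have hends : ∀ t ∈ uIcc a b,
      ContinuousAt (fun p => Complex.log ((γ t - p) / (γ t - p₀))) p₀ := fun t ht => by
    refine ContinuousAt.clog (by fun_prop) ?_
    rw [div_self (hne t ht)]
    exact Complex.one_mem_slitPlane
  refine ContinuousAt.congr ((continuousAt_const (y := logChange (fun t => γ t - p₀) a b)).add
    ((hends b right_mem_uIcc).sub (hends a left_mem_uIcc))) ?_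
  filter_upwards [hnear] with p hp
  exact (logChange_eq_add_of_norm_lt (by fun_prop) (by fun_prop) hp).symm

/-- Homotopy invariance of the winding number of a closed curve. The parameter space of the
homotopy may be any connected space. -/
theorem logChange_eq_of_homotopy {X : Type*} [TopologicalSpace X] [PreconnectedSpace X]
    {F : X → ℝ → ℂ} (hF : Continuous fun q : X × ℝ => F q.1 q.2) {a b : ℝ}
    (h0 : ∀ x, ∀ t ∈ uIcc a b, F x t ≠ 0) (hclosed : ∀ x, F x a = F x b) (x y : X) :
    logChange (F x) a b = logChange (F y) a b := by
  have hcont : ∀ x, Continuous (F x) := fun x =>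
    hF.comp (Continuous.prodMk continuous_const continuous_id)
  have : IsLocallyConstant fun x => logChange (F x) a b := by
    rw [IsLocallyConstant.iff_eventually_eq]
    intro x
    have : ∀ᶠ y in 𝓝 x, ∀ t ∈ uIcc a b, ‖F y t - F x t‖ < ‖F x t‖ := by
      refine isCompact_uIcc.eventually_forall_of_forall_eventually fun t ht => ?_
      refine ContinuousAt.eventually_lt ?_ ?_ (by simpa using h0 x t ht)
      · exact ((hF.comp (continuous_fst.prodMk continuous_snd)).sub
          ((hcont x).comp continuous_snd)).norm.continuousAt
      · exact ((hcont x).comp continuous_snd).norm.continuousAt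
    filter_upwards [this] with y hy
    rw [logChange_eq_add_of_norm_lt (hcont x).continuousOn (hcont y).continuousOn hy, hclosed x,
      hclosed y]
    simp
  exact this.apply_eq_of_preconnectedSpace x y

/-! ### Simple closed curves and the jump of the winding number -/

/-- A parametrized simple closed curve `γ` of period `T` in the plane, with its two sides: `In`, about
whose points the curve turns `σ = ±1` times, and `Out`, about whose points it does not turn. -/
structure LoopCurve where
  /-- the parametrization -/
  γ : ℝ → ℂ
  /-- the period -/
  T : ℝ
  /-- the sense of rotation -/
  σ : ℤ
  /-- the bounded side -/
  In : Set ℂ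
  /-- the unbounded side -/
  Out : Set ℂ
  continuous : Continuous γ
  T_pos : 0 < T
  sign : σ = 1 ∨ σ = -1
  eq_iff : ∀ s s', γ s = γ s' ↔ ∃ n : ℤ, s' = s + n * T
  cover : ∀ p, p ∈ In ∨ p ∈ Out ∨ p ∈ range γ
  notMem_In : ∀ s, γ s ∉ In
  notMem_Out : ∀ s, γ s ∉ Out
  mem_closure_In : ∀ s, γ s ∈ closure In
  mem_closure_Out : ∀ s, γ s ∈ closure Out
  wind_In : ∀ p ∈ In, logChange (fun t => γ t - p) 0 T = σ * (2 * Real.pi * Complex.I)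
  wind_Out : ∀ p ∈ Out, logChange (fun t => γ t - p) 0 T = 0

/-- A function with integral values that has a limit is eventually constant. -/
theorem exists_eventually_eq_intCast {X : Type*} {l : Filter X} {f : X → ℂ} {z : ℂ}
    (hf : Tendsto f l (𝓝 z)) (hint : ∀ᶠ q in l, ∃ N : ℤ, f q = N) :
    ∃ c : ℤ, ∀ᶠ q in l, f q = c := by
  refine ⟨round z.re, ?_⟩
  have h1 : ∀ᶠ q in l, |(f q).re - z.re| < 1 / 2 :=
    ((Complex.continuous_re.tendsto z).comp hf).eventually (Metric.ball_mem_nhds _ (by norm_num))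
  filter_upwards [hint, h1] with q ⟨N, hN⟩ hq
  rw [hN, Complex.intCast_re] at hq
  have h2 := abs_sub_round z.re
  rw [hN]
  congr 1
  rw [abs_le] at h2
  rw [abs_lt] at hq
  have h3 : (N : ℝ) - (round z.re : ℤ) < 1 := by linarith
  have h4 : -1 < (N : ℝ) - (round z.re : ℤ) := by linarith
  have h5 : N - round z.re < 1 := by exact_mod_cast h3
  have h6 : -1 < N - round z.re := by exact_mod_cast h4
  omega

/-- The function `s ↦ ⌈(v - s) / T⌉` jumps down by `1` at the points of `v + ℤ T`. -/
theorem ceil_jump {T : ℝ} (hT : 0 < T) (v s : ℝ) :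
    (∀ᶠ r in 𝓝[<] s, ⌈(v - r) / T⌉ = ⌊(v - s) / T⌋ + 1) ∧
      ∀ᶠ r in 𝓝[>] s, ⌈(v - r) / T⌉ = ⌈(v - s) / T⌉ := by
  have hc : Tendsto (fun r => (v - r) / T) (𝓝 s) (𝓝 ((v - s) / T)) :=
    Continuous.tendsto (f := fun r => (v - r) / T) (by fun_prop) s
  constructor
  · have h1 : Tendsto (fun r => (v - r) / T) (𝓝[<] s) (𝓝[>] ((v - s) / T)) := by
      refine tendsto_nhdsWithin_iff.2 ⟨hc.mono_left nhdsWithin_le_nhds, ?_⟩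
      filter_upwards [self_mem_nhdsWithin] with r hr
      exact div_lt_div_of_pos_right (sub_lt_sub_left hr v) hT
    exact tendsto_pure.1 ((tendsto_ceil_right_pure_floor_add_one _).comp h1)
  · have h1 : Tendsto (fun r => (v - r) / T) (𝓝[>] s) (𝓝[≤] ((v - s) / T)) := by
      refine tendsto_nhdsWithin_iff.2 ⟨hc.mono_left nhdsWithin_le_nhds, ?_⟩
      filter_upwards [self_mem_nhdsWithin] with r hr
      exact (div_lt_div_of_pos_right (sub_lt_sub_left hr v) hT).le
    exact tendsto_pure.1 ((tendsto_ceil_left_pure_ceil _).comp h1)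

theorem floor_add_one_sub_ceil (r : ℝ) [Decidable (∃ n : ℤ, r = n)] :
    ⌊r⌋ + 1 - ⌈r⌉ = if ∃ n : ℤ, r = n then 1 else 0 := by
  split_ifs with h
  · obtain ⟨n, rfl⟩ := h; simp
  · have h1 : ⌈r⌉ = ⌊r⌋ + 1 := by
      rw [Int.ceil_eq_iff]
      push_cast
      refine ⟨?_, (Int.lt_floor_add_one r).le⟩
      have := lt_of_le_of_ne (Int.floor_le r) fun h' => h ⟨_, h'.symm⟩
      linarith
    omega

namespace LoopCurve

variable (C : LoopCurve)

open Classical in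
/-- The indicator function of the bounded side. -/
noncomputable def ind (p : ℂ) : ℤ := if p ∈ C.In then 1 else 0

theorem ind_of_mem {p : ℂ} (h : p ∈ C.In) : C.ind p = 1 := if_pos h

theorem ind_of_notMem {p : ℂ} (h : p ∉ C.In) : C.ind p = 0 := if_neg h

theorem disjoint {p : ℂ} (h : p ∈ C.In) : p ∉ C.Out := fun h' => by
  have := (C.wind_In p h).symm.trans (C.wind_Out p h')
  refine mul_ne_zero ?_ Complex.two_pi_I_ne_zero this
  rcases C.sign with h | h <;> simp [h]

theorem notMem_range_of_In {p : ℂ} (h : p ∈ C.In) : p ∉ range C.γ := by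
  rintro ⟨s, rfl⟩; exact C.notMem_In s h

theorem notMem_range_of_Out {p : ℂ} (h : p ∈ C.Out) : p ∉ range C.γ := by
  rintro ⟨s, rfl⟩; exact C.notMem_Out s h

theorem ind_of_Out {p : ℂ} (h : p ∈ C.Out) : C.ind p = 0 :=
  C.ind_of_notMem fun h' => C.disjoint h' h

theorem wind_eq {p : ℂ} (h : p ∉ range C.γ) :
    logChange (fun t => C.γ t - p) 0 C.T = C.σ * C.ind p * (2 * Real.pi * Complex.I) := by
  rcases C.cover p with h1 | h1 | h1
  · rw [C.wind_In p h1, C.ind_of_mem h1]; simp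
  · rw [C.wind_Out p h1, C.ind_of_Out h1]; simp
  · exact absurd h1 h

theorem periodic_int (n : ℤ) (s : ℝ) : C.γ (s + n * C.T) = C.γ s :=
  ((C.eq_iff _ _).2 ⟨n, rfl⟩).symm

theorem periodic (s : ℝ) : C.γ (s + C.T) = C.γ s := by
  simpa using C.periodic_int 1 s

theorem range_eq_image : range C.γ = C.γ '' Icc 0 C.T := by
  have h : Function.Periodic C.γ C.T := C.periodic
  have := h.image_Icc C.T_pos 0
  rw [zero_add] at this
  exact this.symm

theorem isCompact_range : IsCompact (range C.γ) :=
  C.range_eq_image ▸ isCompact_Icc.image C.continuous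

theorem sub_ne_zero_of_notMem_range {p : ℂ} (h : p ∉ range C.γ) (t : ℝ) : C.γ t - p ≠ 0 :=
  sub_ne_zero.2 fun h' => h ⟨t, h'⟩

theorem eventually_ind_eq {p : ℂ} (h : p ∉ range C.γ) : ∀ᶠ q in 𝓝 p, C.ind q = C.ind p := by
  have h1 : ∀ᶠ q in 𝓝 p, q ∉ range C.γ := C.isCompact_range.isClosed.isOpen_compl.eventually_mem h
  have hcont : ContinuousAt (fun q => logChange (fun t => C.γ t - q) 0 C.T /
      (2 * Real.pi * Complex.I)) p :=
    (continuousAt_logChange_sub C.continuous fun t _ h' => h ⟨t, h'⟩).div_const _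
  have h2 : ∀ q ∉ range C.γ, logChange (fun t => C.γ t - q) 0 C.T /
      (2 * Real.pi * Complex.I) = ((C.σ * C.ind q : ℤ) : ℂ) := fun q hq => by
    rw [C.wind_eq hq, mul_div_cancel_right₀ _ Complex.two_pi_I_ne_zero]
    push_cast; rfl
  obtain ⟨c, hc⟩ := exists_eventually_eq_intCast hcont.tendsto (h1.mono fun q hq => ⟨_, h2 q hq⟩)
  have hp := hc.self_of_nhds
  filter_upwards [h1, hc] with q hq hqc
  rw [h2 q hq] at hqc
  rw [h2 p h] at hp
  have h3 : C.σ * C.ind q = C.σ * C.ind p := by exact_mod_cast hqc.trans hp.symm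
  rcases C.sign with h | h <;> rw [h] at h3 <;> linarith

theorem logChange_trans {p : ℂ} (h : p ∉ range C.γ) (x y z : ℝ) :
    logChange (fun t => C.γ t - p) x y + logChange (fun t => C.γ t - p) y z =
      logChange (fun t => C.γ t - p) x z :=
  logChange_add (C.continuous.sub continuous_const)
    (fun t _ => C.sub_ne_zero_of_notMem_range h t) (fun t _ => C.sub_ne_zero_of_notMem_range h t)

/-- The change of the logarithm over `n` periods. -/
theorem logChange_int_mul {p : ℂ} (h : p ∉ range C.γ) (a : ℝ) (n : ℤ) :
    logChange (fun t => C.γ t - p) a (a + n * C.T) =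
      n * logChange (fun t => C.γ t - p) 0 C.T := by
  have hc : Continuous fun t => C.γ t - p := C.continuous.sub continuous_const
  have h0 := C.sub_ne_zero_of_notMem_range h
  have hadd := C.logChange_trans h
  have hone : ∀ b, logChange (fun t => C.γ t - p) b (b + C.T) =
      logChange (fun t => C.γ t - p) 0 C.T := fun b => by
    have h1 := logChange_comp_affine (f := fun t => C.γ t - p) 1 C.T (a := 0) (b := b)
      hc.continuousOn fun t _ => h0 t
    simp only [one_mul, zero_add, C.periodic] at h1
    have h2 := hadd 0 C.T (b + C.T)
    have h3 := hadd 0 b (b + C.T)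
    linear_combination h3 - h2 - h1
  induction n using Int.induction_on with
  | zero => simp
  | succ n ih =>
    rw [← hadd a (a + n * C.T)]
    have := hone (a + n * C.T)
    push_cast at ih ⊢
    rw [ih, show a + (n + 1) * C.T = a + n * C.T + C.T by ring, this]
    ring
  | pred n ih =>
    have h1 := hadd a (a + ((-n - 1 : ℤ) : ℝ) * C.T) (a + ((-n : ℤ) : ℝ) * C.T)
    have := hone (a + ((-n - 1 : ℤ) : ℝ) * C.T)
    rw [show a + ((-n - 1 : ℤ) : ℝ) * C.T + C.T = a + ((-n : ℤ) : ℝ) * C.T by push_cast; ring]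
      at this
    rw [ih, this] at h1
    push_cast at h1 ⊢
    linear_combination h1

theorem exists_continuousAt_logChange_half {s v : ℝ} (hv : ∀ n : ℤ, v ≠ s + n * C.T) :
    ∃ G : ℂ → ℂ, ContinuousAt G (C.γ s) ∧ ∀ p ∉ range C.γ,
      logChange (fun t => C.γ t - p) (s + C.T / 2) v =
        G p + (⌈(v - s) / C.T⌉ - 1 : ℤ) * logChange (fun t => C.γ t - p) 0 C.T := by
  have hT := C.T_pos
  set n : ℤ := ⌈(v - s) / C.T⌉ - 1 with hn
  have h1 : s + n * C.T < v := by
    have := Int.ceil_lt_add_one ((v - s) / C.T)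
    have h2 : (n : ℝ) < (v - s) / C.T := by rw [hn]; push_cast; linarith
    rw [lt_div_iff₀ hT] at h2
    linarith
  have h2 : v < s + n * C.T + C.T := by
    have := Int.le_ceil ((v - s) / C.T)
    have h2 : (v - s) / C.T ≤ (n + 1 : ℤ) := by rw [hn]; simpa using this
    rw [div_le_iff₀ hT] at h2
    push_cast at h2
    refine lt_of_le_of_ne (by linarith) ?_
    have := hv (n + 1)
    push_cast at this
    intro h; exact this (by linarith)
  refine ⟨fun p => logChange (fun t => C.γ t - p) (s + C.T / 2 + n * C.T) v, ?_, fun p hp => ?_⟩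
  · refine continuousAt_logChange_sub C.continuous fun t ht h => ?_
    obtain ⟨m, hm⟩ := (C.eq_iff _ _).1 h
    have ht' : s + n * C.T < t ∧ t < s + n * C.T + C.T := by
      rw [mem_uIcc] at ht
      rcases ht with ht | ht <;> constructor <;> linarith [ht.1, ht.2]
    have h3 : ((-m : ℤ) : ℝ) * C.T > n * C.T := by push_cast; linarith
    have h4 : ((-m : ℤ) : ℝ) * C.T < (n + 1 : ℤ) * C.T := by push_cast; linarith
    have h5 := lt_of_mul_lt_mul_right h3 hT.le
    have h6 := lt_of_mul_lt_mul_right h4 hT.le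
    norm_cast at h5 h6
    omega
  · rw [← C.logChange_trans hp _ (s + C.T / 2 + n * C.T), C.logChange_int_mul hp]
    ring

/-- The jump of the change of the logarithm along a part of the curve: up to a function that is
continuous at the point `γ s`, it is the number of times this part passes through `γ s`, times the
change along the whole curve. -/
theorem exists_continuousAt_logChange {s u v : ℝ} (hu : ∀ n : ℤ, u ≠ s + n * C.T)
    (hv : ∀ n : ℤ, v ≠ s + n * C.T) :
    ∃ G : ℂ → ℂ, ContinuousAt G (C.γ s) ∧ ∀ p ∉ range C.γ,
      logChange (fun t => C.γ t - p) u v =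
        G p + (⌈(v - s) / C.T⌉ - ⌈(u - s) / C.T⌉ : ℤ) *
          logChange (fun t => C.γ t - p) 0 C.T := by
  obtain ⟨G, hG, hG'⟩ := C.exists_continuousAt_logChange_half hu
  obtain ⟨H, hH, hH'⟩ := C.exists_continuousAt_logChange_half hv
  refine ⟨fun p => H p - G p, hH.sub hG, fun p hp => ?_⟩
  rw [← C.logChange_trans hp _ (s + C.T / 2), logChange_symm, hG' p hp, hH' p hp]
  push_cast
  ring

end LoopCurve

/-! ### The winding number of a cycle on a family of curves -/

/-- A chain on finitely many simple closed curves: on the `j`-th curve it runs from the parameter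
`y j` to the parameter `x j` if the curve is counterclockwise, and back if it is clockwise. It is
assumed to be a cycle, that is, its total change of the argument is an integral number of turns. -/
structure CurveCycle (J : Type) [Fintype J] where
  /-- the curves -/
  C : J → LoopCurve
  /-- the parameters at which the chain ends -/
  x : J → ℝ
  /-- the parameters at which the chain starts -/
  y : J → ℝ
  cycle : ∀ p, (∀ j, p ∉ (C j).γ '' uIcc (y j) (x j)) →
    Complex.exp (∑ j, (C j).σ * logChange (fun t => (C j).γ t - p) (y j) (x j)) = 1

namespace CurveCycle

variable {J : Type} [Fintype J] (Z : CurveCycle J)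

/-- The points of the chain. -/
def support : Set ℂ := ⋃ j, (Z.C j).γ '' uIcc (Z.y j) (Z.x j)

theorem isClosed_support : IsClosed Z.support :=
  isClosed_iUnion_of_finite fun j => (isCompact_uIcc.image (Z.C j).continuous).isClosed

/-- The number of turns of the chain about `p`, as a complex number. -/
noncomputable def turns (p : ℂ) : ℂ :=
  (∑ j, (Z.C j).σ * logChange (fun t => (Z.C j).γ t - p) (Z.y j) (Z.x j)) /
    (2 * Real.pi * Complex.I)

/-- The winding number of the cycle about `p`. It has no meaning on the cycle. -/
noncomputable def wnum (p : ℂ) : ℤ := round (Z.turns p).re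

theorem turns_eq {p : ℂ} (hp : p ∉ Z.support) : Z.turns p = Z.wnum p := by
  have h : ∀ j, p ∉ (Z.C j).γ '' uIcc (Z.y j) (Z.x j) := by simpa [support] using hp
  obtain ⟨n, hn⟩ := Complex.exp_eq_one_iff.1 (Z.cycle p h)
  have : Z.turns p = n := by rw [turns, hn, mul_div_cancel_right₀ _ Complex.two_pi_I_ne_zero]
  rw [wnum, this, Complex.intCast_re, round_intCast]

theorem eventually_wnum_eq {p : ℂ} (hp : p ∉ Z.support) :
    ∀ᶠ q in 𝓝 p, Z.wnum q = Z.wnum p := by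
  have h : ∀ j, p ∉ (Z.C j).γ '' uIcc (Z.y j) (Z.x j) := by simpa [support] using hp
  have hcont : ContinuousAt Z.turns p := by
    refine ContinuousAt.div_const (tendsto_finsetSum _ fun j _ => ?_) _
    exact (continuousAt_const.mul (continuousAt_logChange_sub (Z.C j).continuous
      fun t ht h' => h j ⟨t, ht, h'⟩))
  have h1 : ∀ᶠ q in 𝓝 p, q ∉ Z.support := Z.isClosed_support.isOpen_compl.eventually_mem hp
  obtain ⟨c, hc⟩ := exists_eventually_eq_intCast hcont.tendsto
    (h1.mono fun q hq => ⟨_, Z.turns_eq hq⟩)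
  have hp' := hc.self_of_nhds
  filter_upwards [h1, hc] with q hq hqc
  rw [Z.turns_eq hq] at hqc
  rw [Z.turns_eq hp] at hp'
  exact_mod_cast hqc.trans hp'.symm

/-- The multiplicity of the `j`-th curve in the chain at the parameter `s`, if the curve is oriented
counterclockwise. -/
noncomputable def mult (j : J) (s : ℝ) : ℤ :=
  ⌈(Z.x j - s) / (Z.C j).T⌉ - ⌈(Z.y j - s) / (Z.C j).T⌉

/-- When a curve of the chain is crossed from the outside to the inside, the winding number of the
cycle increases by the multiplicity of the curve. -/
theorem exists_wnum_eq (j : J) {s : ℝ} (hx : ∀ n : ℤ, Z.x j ≠ s + n * (Z.C j).T)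
    (hy : ∀ n : ℤ, Z.y j ≠ s + n * (Z.C j).T)
    (h : ∀ i, i ≠ j → (Z.C j).γ s ∉ (Z.C i).γ '' uIcc (Z.y i) (Z.x i)) :
    ∃ c : ℤ, ∀ᶠ q in 𝓝[(range (Z.C j).γ)ᶜ] ((Z.C j).γ s),
      Z.wnum q = c + Z.mult j s * (Z.C j).ind q := by
  classical
  obtain ⟨G, hG, hG'⟩ := (Z.C j).exists_continuousAt_logChange hy hx
  let H : ℂ → ℂ := fun p => ((Z.C j).σ * G p + ∑ i ∈ Finset.univ.erase j,
    (Z.C i).σ * logChange (fun t => (Z.C i).γ t - p) (Z.y i) (Z.x i)) / (2 * Real.pi * Complex.I)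
  have hH : ContinuousAt H ((Z.C j).γ s) := by
    refine ContinuousAt.div_const ((continuousAt_const.mul hG).add
      (tendsto_finsetSum _ fun i hi => ?_)) _
    exact (continuousAt_const.mul (continuousAt_logChange_sub (Z.C i).continuous
      fun t ht h' => h i (Finset.ne_of_mem_erase hi) ⟨t, ht, h'⟩))
  have hturns : ∀ q ∉ range (Z.C j).γ, Z.turns q = H q + ((Z.mult j s * (Z.C j).ind q : ℤ) : ℂ) := by
    intro q hq
    have hσ : ((Z.C j).σ : ℂ) * (Z.C j).σ = 1 := by
      rcases (Z.C j).sign with h | h <;> simp [h]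
    rw [turns, ← Finset.add_sum_erase _ _ (Finset.mem_univ j), hG' q hq, (Z.C j).wind_eq hq, mult]
    simp only [H]
    rw [div_add' _ _ _ Complex.two_pi_I_ne_zero]
    push_cast
    congr 1
    linear_combination ((⌈(Z.x j - s) / (Z.C j).T⌉ : ℂ) - ⌈(Z.y j - s) / (Z.C j).T⌉) *
      (Z.C j).ind q * (2 * Real.pi * Complex.I) * hσ
  have hsupp : ∀ᶠ q in 𝓝[(range (Z.C j).γ)ᶜ] ((Z.C j).γ s), q ∉ Z.support := by
    have h1 : ∀ᶠ q in 𝓝 ((Z.C j).γ s), ∀ i, i ≠ j → q ∉ (Z.C i).γ '' uIcc (Z.y i) (Z.x i) := by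
      refine eventually_all.2 fun i => ?_
      by_cases hi : i = j
      · simp [hi]
      · filter_upwards [(isCompact_uIcc.image
          (Z.C i).continuous).isClosed.isOpen_compl.eventually_mem (h i hi)] with q hq _
        exact hq
    filter_upwards [h1.filter_mono nhdsWithin_le_nhds, self_mem_nhdsWithin] with q hq hq'
    simp only [support, mem_iUnion, not_exists]
    intro i
    by_cases hi : i = j
    · subst hi
      exact fun h' => hq' (image_subset_range _ _ h')
    · exact hq i hi
  obtain ⟨c, hc⟩ := exists_eventually_eq_intCast (hH.tendsto.mono_left nhdsWithin_le_nhds) (by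
    filter_upwards [hsupp, self_mem_nhdsWithin] with q hq hq'
    have h1 := hturns q hq'
    rw [Z.turns_eq hq] at h1
    exact ⟨Z.wnum q - Z.mult j s * (Z.C j).ind q, by
      rw [Int.cast_sub, h1]; ring⟩)
  refine ⟨c, ?_⟩
  filter_upwards [hc, hsupp, self_mem_nhdsWithin] with q hq hq' hq''
  have h1 := hturns q hq''
  rw [Z.turns_eq hq', hq] at h1
  exact_mod_cast h1

open Classical in
/-- The boundary of the chain, in terms of its multiplicities. -/
theorem mult_jump (j : J) (s : ℝ) :
    ∃ c c' : ℤ, (∀ᶠ r in 𝓝[<] s, Z.mult j r = c) ∧ (∀ᶠ r in 𝓝[>] s, Z.mult j r = c') ∧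
      c - c' = (if (Z.C j).γ s = (Z.C j).γ (Z.x j) then 1 else 0) -
        if (Z.C j).γ s = (Z.C j).γ (Z.y j) then 1 else 0 := by
  have hT := (Z.C j).T_pos
  have key : ∀ v : ℝ, ⌊(v - s) / (Z.C j).T⌋ + 1 - ⌈(v - s) / (Z.C j).T⌉ =
      if (Z.C j).γ s = (Z.C j).γ v then 1 else 0 := fun v => by
    rw [floor_add_one_sub_ceil]
    congr 1
    rw [(Z.C j).eq_iff]
    refine propext (exists_congr fun n => ?_)
    rw [div_eq_iff hT.ne', sub_eq_iff_eq_add, add_comm]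
  refine ⟨⌊(Z.x j - s) / (Z.C j).T⌋ + 1 - (⌊(Z.y j - s) / (Z.C j).T⌋ + 1),
    ⌈(Z.x j - s) / (Z.C j).T⌉ - ⌈(Z.y j - s) / (Z.C j).T⌉, ?_, ?_, ?_⟩
  · filter_upwards [(ceil_jump hT (Z.x j) s).1, (ceil_jump hT (Z.y j) s).1] with r h1 h2
    rw [mult, h1, h2]
  · filter_upwards [(ceil_jump hT (Z.x j) s).2, (ceil_jump hT (Z.y j) s).2] with r h1 h2
    rw [mult, h1, h2]
  · rw [← key, ← key]; ring

end CurveCycle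

/-! ### The ovals and the arcs as simple closed curves -/

theorem logChange_const (c : ℂ) (a b : ℝ) : logChange (fun _ => c) a b = 0 := by
  by_cases hc : c = 0
  · rw [logChange, dif_neg]
    rintro ⟨L, -, hL⟩
    exact Complex.exp_ne_zero _ ((hL a left_mem_uIcc).trans hc)
  · rw [logChange_eq (L := fun _ => Complex.log c) continuousOn_const
      fun t _ => Complex.exp_log hc, sub_self]

theorem logChange_exp (c : ℂ) (L : ℝ → ℂ) (hL : Continuous L) (hc : c ≠ 0) (a b : ℝ) :
    logChange (fun t => c * Complex.exp (L t)) a b = L b - L a := by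
  rw [logChange_eq (L := fun t => Complex.log c + L t) (by fun_prop) fun t _ => by
    rw [Complex.exp_add, Complex.exp_log hc]]
  ring

section Oval

variable {g : ℕ}

theorem ovalCoord_eq (k : Fin g) (u v : ℝ) :
    ovalCoord g k u v = -Complex.I * (((rad g k.succ + u / 4 : ℝ) : ℂ) *
      Complex.exp ((3 * Real.pi / 4 * v : ℝ) * Complex.I)) := by
  have h : ((-(Real.pi / 2) + 3 * Real.pi / 4 * v : ℝ) : ℂ) * Complex.I =
      (3 * Real.pi / 4 * v : ℝ) * Complex.I - Real.pi / 2 * Complex.I := by push_cast; ring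
  rw [ovalCoord, h, Complex.exp_sub, Complex.exp_pi_div_two_mul_I, Complex.div_I]
  ring

theorem ovalCoord_injOn (k : Fin g) {u v u' v' : ℝ} (hu : |u| < 4) (hv : |v| < 4 / 3) (hu' : |u'| < 4)
    (hv' : |v'| < 4 / 3) (h : ovalCoord g k u v = ovalCoord g k u' v') : u = u' ∧ v = v' := by
  have h1 := congrArg norm h
  have hnorm : ∀ {u v : ℝ}, |u| < 4 → ‖ovalCoord g k u v‖ = rad g k.succ + u / 4 := by
    intro u v hu
    have := rad_pos k.succ
    rw [abs_lt] at hu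
    rw [ovalCoord, norm_mul, Complex.norm_exp_ofReal_mul_I, Complex.norm_real, mul_one,
      Real.norm_of_nonneg (by linarith)]
  rw [hnorm hu, hnorm hu'] at h1
  obtain rfl : u = u' := by linarith
  refine ⟨rfl, ?_⟩
  have hr := rad_pos k.succ
  rw [abs_lt] at hu hv hv'
  have hne : ((rad g k.succ + u / 4 : ℝ) : ℂ) ≠ 0 := by
    rw [Complex.ofReal_ne_zero]; linarith [hu.1]
  obtain ⟨n, hn⟩ := Complex.exp_eq_exp_iff_exists_int.1 (mul_left_cancel₀ hne h)
  have h2 : -(Real.pi / 2) + 3 * Real.pi / 4 * v =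
      -(Real.pi / 2) + 3 * Real.pi / 4 * v' + n * (2 * Real.pi) := by
    have := congrArg Complex.im hn
    simpa using this
  have h3 : 3 * (v - v') = 8 * n := by
    have : Real.pi * (3 * (v - v')) = Real.pi * (8 * n) := by linear_combination 4 * h2
    exact mul_left_cancel₀ Real.pi_ne_zero this
  have h4 : (n : ℝ) < 1 := by linarith
  have h5 : (-1 : ℝ) < n := by linarith
  have h6 : n < 1 := by exact_mod_cast h4
  have h7 : -1 < n := by exact_mod_cast h5
  obtain rfl : n = 0 := by omega
  simp at h3
  linarith

theorem abs_le_one_of_sq_add_sq_le {u v : ℝ} (h : u ^ 2 + v ^ 2 ≤ 1) : |u| ≤ 1 ∧ |v| ≤ 1 := by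
  constructor <;> rw [abs_le_one_iff_mul_self_le_one] <;> nlinarith [sq_nonneg u, sq_nonneg v]

theorem ovalCoord_ne_oval (k : Fin g) {u v : ℝ} (h : u ^ 2 + v ^ 2 < 1) (s : ℝ) :
    oval g k s ≠ ovalCoord g k u v := fun h' => by
  obtain ⟨h1, h2⟩ := abs_le_one_of_sq_add_sq_le h.le
  obtain ⟨rfl, rfl⟩ := ovalCoord_injOn k (by linarith [Real.abs_cos_le_one s])
    (by linarith [Real.abs_sin_le_one s]) (by linarith) (by linarith) h'
  linarith [Real.cos_sq_add_sin_sq s]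

theorem oval_eq_iff (k : Fin g) (s s' : ℝ) :
    oval g k s = oval g k s' ↔ ∃ n : ℤ, s' = s + n * (2 * Real.pi) := by
  constructor
  · intro h
    obtain ⟨h1, h2⟩ := ovalCoord_injOn k (by linarith [Real.abs_cos_le_one s])
      (by linarith [Real.abs_sin_le_one s]) (by linarith [Real.abs_cos_le_one s'])
      (by linarith [Real.abs_sin_le_one s']) h
    obtain ⟨n, hn⟩ := Real.Angle.angle_eq_iff_two_pi_dvd_sub.1
      (Real.Angle.cos_sin_inj h1.symm h2.symm)
    exact ⟨n, by linarith⟩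
  · rintro ⟨n, rfl⟩
    rw [oval, oval, Real.cos_add_int_mul_two_pi, Real.sin_add_int_mul_two_pi]

/-- The oval turns once about the centre of the thin disc: it can be deformed linearly to a round
circle in the complement of the centre. -/
theorem wind_oval_centre (k : Fin g) :
    logChange (fun s => oval g k s - ovalCoord g k 0 0) 0 (2 * Real.pi) =
      2 * Real.pi * Complex.I := by
  have hr := rad_pos k.succ
  let A : ℝ → ℝ := fun s =>
    (rad g k.succ + Real.cos s / 4) * Real.cos (3 * Real.pi / 4 * Real.sin s) - rad g k.succ
  let B : ℝ → ℝ := fun s =>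
    (rad g k.succ + Real.cos s / 4) * Real.sin (3 * Real.pi / 4 * Real.sin s)
  have hAB : ∀ s, oval g k s - ovalCoord g k 0 0 = -Complex.I * (A s + B s * Complex.I) := by
    intro s
    rw [oval, ovalCoord_eq, ovalCoord_eq, Complex.exp_mul_I, ← Complex.ofReal_cos,
      ← Complex.ofReal_sin]
    simp only [A, B]
    push_cast
    simp
    ring
  -- The imaginary part of the linear homotopy has the sign of `sin s`.
  let F : unitInterval → ℝ → ℂ := fun τ s => -Complex.I *
    (((1 - τ) * A s + τ * Real.cos s : ℝ) + ((1 - τ) * B s + τ * Real.sin s : ℝ) * Complex.I)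
  have hF : Continuous fun q : unitInterval × ℝ => F q.1 q.2 := by
    simp only [F, A, B]; fun_prop
  have hne : ∀ τ : unitInterval, ∀ s, F τ s ≠ 0 := by
    intro τ s h
    have h0 := (mul_eq_zero.1 h).resolve_left (neg_ne_zero.2 Complex.I_ne_zero)
    have hre := congrArg Complex.re h0
    have him := congrArg Complex.im h0
    simp only [Complex.add_re, Complex.add_im, Complex.ofReal_re, Complex.ofReal_im,
      Complex.re_ofReal_mul, Complex.im_ofReal_mul, Complex.I_re, Complex.I_im, Complex.zero_re,
      Complex.zero_im, mul_zero, mul_one, add_zero, zero_add] at hre him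
    have hτ0 := τ.2.1
    have hτ1 := τ.2.2
    have hc := abs_le.1 (Real.abs_cos_le_one s)
    have hs := abs_le.1 (Real.abs_sin_le_one s)
    have hρ : 0 < rad g k.succ + Real.cos s / 4 := by linarith
    have hB : 0 < Real.sin s → 0 < B s := fun h => mul_pos hρ <|
      Real.sin_pos_of_pos_of_lt_pi (by positivity) (by nlinarith [Real.pi_pos])
    have hB' : Real.sin s < 0 → B s < 0 := fun h => mul_neg_of_pos_of_neg hρ <|
      Real.sin_neg_of_neg_of_neg_pi_lt (by nlinarith [Real.pi_pos]) (by nlinarith [Real.pi_pos])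
    rcases lt_trichotomy (Real.sin s) 0 with h | h | h
    · have := hB' h
      rcases eq_or_lt_of_le hτ0 with h1 | h1
      · rw [← h1] at him; linarith
      · nlinarith
    · have h1 : Real.cos s = 1 ∨ Real.cos s = -1 := by
        have := Real.sin_sq_add_cos_sq s
        rw [h] at this
        exact mul_self_eq_one_iff.1 (by linarith)
      have hA : A s = Real.cos s / 4 := by simp [A, h]
      rw [hA] at hre
      rcases h1 with h1 | h1 <;> rw [h1] at hre <;> linarith
    · have := hB h
      rcases eq_or_lt_of_le hτ0 with h1 | h1
      · rw [← h1] at him; linarith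
      · nlinarith
  have h1 := logChange_eq_of_homotopy hF (a := 0) (b := 2 * Real.pi) (fun τ s _ => hne τ s)
    (fun τ => by simp [F, A, B]) 0 1
  have h2 : F 0 = fun s => oval g k s - ovalCoord g k 0 0 := by
    funext s; rw [hAB]; simp [F]
  have h3 : F 1 = fun s : ℝ => -Complex.I * Complex.exp (s * Complex.I) := by
    funext s; rw [Complex.exp_mul_I]; simp [F]
  rw [← h2, h1, h3, logChange_exp _ _ (by fun_prop) (neg_ne_zero.2 Complex.I_ne_zero)]
  push_cast; ring

theorem sq_mul_add_sq_mul_le {τ : ℝ} (h0 : 0 ≤ τ) (h1 : τ ≤ 1) (u v : ℝ) :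
    (τ * u) ^ 2 + (τ * v) ^ 2 ≤ u ^ 2 + v ^ 2 := by
  nlinarith [mul_nonneg (add_nonneg (sq_nonneg u) (sq_nonneg v))
    (by nlinarith : 0 ≤ 1 - τ ^ 2)]

theorem wind_oval_inside (k : Fin g) {p : ℂ} (hp : p ∈ ovalInside g k) :
    logChange (fun s => oval g k s - p) 0 (2 * Real.pi) = 2 * Real.pi * Complex.I := by
  obtain ⟨u, v, huv, rfl⟩ := hp
  let F : unitInterval → ℝ → ℂ := fun τ s => oval g k s - ovalCoord g k (τ * u) (τ * v)
  have hF : Continuous fun q : unitInterval × ℝ => F q.1 q.2 :=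
    ((continuous_oval k).comp continuous_snd).sub ((continuous_ovalCoord k).comp
      (f := fun q : unitInterval × ℝ => (q.1 * u, q.1 * v)) (by fun_prop))
  have h1 := logChange_eq_of_homotopy hF (a := 0) (b := 2 * Real.pi)
    (fun τ s _ => sub_ne_zero.2 (ovalCoord_ne_oval k
      ((sq_mul_add_sq_mul_le τ.2.1 τ.2.2 u v).trans_lt huv) s)) (fun τ => by simp [F, oval]) 1 0
  rw [← wind_oval_centre k]
  simpa [F] using h1

theorem wind_oval_outside (k : Fin g) {p : ℂ} (hp : p ∈ ovalOutside g k) :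
    logChange (fun s => oval g k s - p) 0 (2 * Real.pi) = 0 := by
  let F : unitInterval → ℝ → ℂ := fun τ s => ovalCoord g k (τ * Real.cos s) (τ * Real.sin s) - p
  have hF : Continuous fun q : unitInterval × ℝ => F q.1 q.2 :=
    ((continuous_ovalCoord k).comp (f := fun q : unitInterval × ℝ =>
      (q.1 * Real.cos q.2, q.1 * Real.sin q.2)) (by fun_prop)).sub continuous_const
  have h1 := logChange_eq_of_homotopy hF (a := 0) (b := 2 * Real.pi)
    (fun τ s _ => sub_ne_zero.2 (hp _ _ ((sq_mul_add_sq_mul_le τ.2.1 τ.2.2 _ _).trans_eq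
      (Real.cos_sq_add_sin_sq s))).symm) (fun τ => by simp [F]) 1 0
  have h2 : F 0 = fun _ => ovalCoord g k 0 0 - p := by funext s; simp [F]
  rw [h2, logChange_const] at h1
  simpa [F, oval] using h1

/-- The oval `b_k` as a simple closed curve. -/
noncomputable def ovalLoop (g : ℕ) (k : Fin g) : LoopCurve where
  γ := oval g k
  T := 2 * Real.pi
  σ := 1
  In := ovalInside g k
  Out := ovalOutside g k
  continuous := continuous_oval k
  T_pos := Real.two_pi_pos
  sign := Or.inl rfl
  eq_iff := oval_eq_iff k
  cover p := by
    by_cases hp : p ∈ ovalOutside g k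
    · exact Or.inr (Or.inl hp)
    · simp only [ovalOutside, mem_ofPred_eq, not_forall, not_not] at hp
      obtain ⟨u, v, huv, rfl⟩ := hp
      rcases huv.lt_or_eq with h | h
      · exact Or.inl ⟨u, v, h, rfl⟩
      · refine Or.inr (Or.inr ?_)
        obtain ⟨s, hs⟩ : ∃ s : ℝ, Complex.exp (s * Complex.I) = ⟨u, v⟩ := by
          rw [← Complex.norm_eq_one_iff, Complex.norm_def, Complex.normSq_mk,
            Real.sqrt_eq_one]
          linarith
        rw [Complex.exp_mul_I, ← Complex.ofReal_cos, ← Complex.ofReal_sin] at hs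
        have h1 := congrArg Complex.re hs
        have h2 := congrArg Complex.im hs
        simp only [Complex.add_re, Complex.add_im, Complex.ofReal_re, Complex.ofReal_im,
          Complex.re_ofReal_mul, Complex.im_ofReal_mul, Complex.I_re, Complex.I_im, mul_zero,
          mul_one, add_zero, zero_add] at h1 h2
        exact ⟨s, by rw [oval, h1, h2]⟩
  notMem_In s h := by
    obtain ⟨u, v, huv, h⟩ := h
    exact ovalCoord_ne_oval k huv s h
  notMem_Out s h := h _ _ (Real.cos_sq_add_sin_sq s).le rfl
  mem_closure_In s := by
    have hlim : Tendsto (fun τ : ℝ => ovalCoord g k (τ * Real.cos s) (τ * Real.sin s)) (𝓝[<] 1)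
        (𝓝 (oval g k s)) := by
      have : Continuous fun τ : ℝ => ovalCoord g k (τ * Real.cos s) (τ * Real.sin s) :=
        (continuous_ovalCoord k).comp (f := fun τ : ℝ => (τ * Real.cos s, τ * Real.sin s))
          (by fun_prop)
      have h := this.tendsto 1
      simp only [one_mul] at h
      exact h.mono_left nhdsWithin_le_nhds
    refine mem_closure_of_tendsto hlim ?_
    filter_upwards [Ioo_mem_nhdsLT (show (0 : ℝ) < 1 by norm_num)] with τ hτ
    refine ⟨_, _, ?_, rfl⟩
    have h1 := Real.cos_sq_add_sin_sq s
    have h2 : (τ * Real.cos s) ^ 2 + (τ * Real.sin s) ^ 2 = τ ^ 2 := by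
      linear_combination τ ^ 2 * h1
    rw [h2]
    nlinarith [hτ.1, hτ.2]
  mem_closure_Out s := by
    have hlim : Tendsto (fun τ : ℝ => ovalCoord g k (τ * Real.cos s) (τ * Real.sin s)) (𝓝[>] 1)
        (𝓝 (oval g k s)) := by
      have : Continuous fun τ : ℝ => ovalCoord g k (τ * Real.cos s) (τ * Real.sin s) :=
        (continuous_ovalCoord k).comp (f := fun τ : ℝ => (τ * Real.cos s, τ * Real.sin s))
          (by fun_prop)
      have h := this.tendsto 1
      simp only [one_mul] at h
      exact h.mono_left nhdsWithin_le_nhds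
    refine mem_closure_of_tendsto hlim ?_
    filter_upwards [Ioo_mem_nhdsGT (show (1 : ℝ) < 6 / 5 by norm_num)] with τ hτ u v huv h
    obtain ⟨hu, hv⟩ := abs_le_one_of_sq_add_sq_le huv
    have h1 := Real.cos_sq_add_sin_sq s
    have h2 : (τ * Real.cos s) ^ 2 + (τ * Real.sin s) ^ 2 = τ ^ 2 := by
      linear_combination τ ^ 2 * h1
    have hc : |τ * Real.cos s| ≤ 6 / 5 := by
      rw [abs_mul, abs_of_pos (by linarith [hτ.1])]
      nlinarith [Real.abs_cos_le_one s, hτ.1, hτ.2, abs_nonneg (Real.cos s)]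
    have hs : |τ * Real.sin s| ≤ 6 / 5 := by
      rw [abs_mul, abs_of_pos (by linarith [hτ.1])]
      nlinarith [Real.abs_sin_le_one s, hτ.1, hτ.2, abs_nonneg (Real.sin s)]
    obtain ⟨rfl, rfl⟩ := ovalCoord_injOn k (by linarith) (by linarith) (by linarith)
      (by linarith) h
    nlinarith [hτ.1, hτ.2]
  wind_In p hp := by rw [wind_oval_inside k hp]; simp
  wind_Out p hp := wind_oval_outside k hp

end Oval

section Arc

variable {g : ℕ} {β : BraidGroup g} (R : BraidRep β)

theorem arc_eq_iff (k : Fin g) (t t' : ℝ) :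
    arc g k t = arc g k t' ↔ ∃ n : ℤ, t' = t + n * 2 := by
  have hr := rad_pos k.succ
  have hne : (rad g k.succ : ℂ) ≠ 0 := by rw [Complex.ofReal_ne_zero]; linarith
  rw [arc, arc, mul_right_inj' hne, Complex.exp_eq_exp_iff_exists_int]
  refine exists_congr fun n => ?_
  constructor
  · intro h
    have h1 := congrArg Complex.im h
    simp at h1
    have : Real.pi * (1 - t) = Real.pi * (1 - t' + n * 2) := by linear_combination h1
    linarith [mul_left_cancel₀ Real.pi_ne_zero this]
  · rintro rfl
    push_cast; ring

theorem arc_arg (k : Fin g) {q : ℂ} (hq : ‖q‖ = rad g k.succ) :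
    arc g k (1 - q.arg / Real.pi) = q := by
  have h : Real.pi * (1 - (1 - q.arg / Real.pi)) = q.arg := by
    field_simp; ring
  rw [arc, h, ← hq, Complex.norm_mul_exp_arg_mul_I]

theorem im_arc (k : Fin g) (t : ℝ) :
    (arc g k t).im = rad g k.succ * Real.sin (Real.pi * (1 - t)) := by
  rw [arc, Complex.im_ofReal_mul, Complex.exp_ofReal_mul_I_im]

/-- The arc `a_k` is the upper half of its circle. -/
theorem mem_arc_image_iff (k : Fin g) {q : ℂ} :
    q ∈ arc g k '' Icc 0 1 ↔ ‖q‖ = rad g k.succ ∧ 0 ≤ q.im := by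
  have hr := rad_pos k.succ
  constructor
  · rintro ⟨t, ht, rfl⟩
    refine ⟨norm_arc k t, ?_⟩
    rw [im_arc]
    refine mul_nonneg (by linarith) (Real.sin_nonneg_of_nonneg_of_le_pi ?_ ?_)
    · exact mul_nonneg Real.pi_pos.le (by linarith [ht.2])
    · nlinarith [Real.pi_pos, ht.1]
  · rintro ⟨hq, him⟩
    refine ⟨_, ⟨?_, ?_⟩, arc_arg k hq⟩
    · rw [sub_nonneg, div_le_one Real.pi_pos]
      exact Complex.arg_le_pi q
    · rw [sub_le_self_iff]
      exact div_nonneg (Complex.arg_nonneg_iff.2 him) Real.pi_pos.le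

theorem im_arc_pos (k : Fin g) {t : ℝ} (ht : t ∈ Ioo (0 : ℝ) 1) : 0 < (arc g k t).im := by
  have hr := rad_pos k.succ
  rw [im_arc]
  refine mul_pos (by linarith) (Real.sin_pos_of_pos_of_lt_pi ?_ ?_)
  · exact mul_pos Real.pi_pos (by linarith [ht.2])
  · nlinarith [Real.pi_pos, ht.1]

theorem wind_arc_zero (k : Fin g) :
    logChange (fun t => arc g k t - 0) 0 2 = -(2 * Real.pi * Complex.I) := by
  have hr := rad_pos k.succ
  have hne : (rad g k.succ : ℂ) ≠ 0 := by rw [Complex.ofReal_ne_zero]; linarith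
  simp only [sub_zero, arc]
  rw [logChange_exp _ (fun t => (Real.pi * (1 - t) : ℝ) * Complex.I) (by fun_prop) hne]
  push_cast; ring

theorem wind_arc_inside (k : Fin g) {q : ℂ} (hq : ‖q‖ < rad g k.succ) :
    logChange (fun t => arc g k t - q) 0 2 = -(2 * Real.pi * Complex.I) := by
  let F : unitInterval → ℝ → ℂ := fun τ t => arc g k t - τ * q
  have hF : Continuous fun q : unitInterval × ℝ => F q.1 q.2 := by
    have := continuous_arc k
    simp only [F]; fun_prop
  have h1 := logChange_eq_of_homotopy hF (a := 0) (b := 2) (fun τ t _ h => by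
      have h2 := congrArg norm (sub_eq_zero.1 h)
      rw [norm_arc, norm_mul, Complex.norm_real, Real.norm_of_nonneg τ.2.1] at h2
      nlinarith [τ.2.2, norm_nonneg q])
    (fun τ => by simp only [F]; rw [(arc_eq_iff k 0 2).2 ⟨1, by norm_num⟩]) 1 0
  rw [← wind_arc_zero k]
  simpa [F] using h1

theorem wind_arc_outside (k : Fin g) {q : ℂ} (hq : rad g k.succ < ‖q‖) :
    logChange (fun t => arc g k t - q) 0 2 = 0 := by
  have hr := rad_pos k.succ
  let F : unitInterval → ℝ → ℂ := fun τ t => τ * arc g k t - q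
  have hF : Continuous fun q : unitInterval × ℝ => F q.1 q.2 := by
    have := continuous_arc k
    simp only [F]; fun_prop
  have h1 := logChange_eq_of_homotopy hF (a := 0) (b := 2) (fun τ t _ h => by
      have h2 := congrArg norm (sub_eq_zero.1 h)
      rw [norm_mul, norm_arc, Complex.norm_real, Real.norm_of_nonneg τ.2.1] at h2
      nlinarith [τ.2.2, τ.2.1])
    (fun τ => by simp only [F]; rw [(arc_eq_iff k 0 2).2 ⟨1, by norm_num⟩]) 1 0
  have h2 : F 0 = fun _ => -q := by funext s; simp [F]
  rw [h2, logChange_const] at h1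
  simpa [F] using h1

/-- The ambient isotopy does not change winding numbers. -/
theorem wind_toHomeo (k : Fin g) {q : ℂ} (hq : ‖q‖ ≠ rad g k.succ) :
    logChange (fun t => R.toHomeo (arc g k t) - R.toHomeo q) 0 2 =
      logChange (fun t => arc g k t - q) 0 2 := by
  let F : unitInterval → ℝ → ℂ := fun τ t => R.isotopy τ (arc g k t) - R.isotopy τ q
  have hF : Continuous fun q : unitInterval × ℝ => F q.1 q.2 := by
    have h1 := R.continuous_isotopy
    exact (h1.comp (continuous_fst.prodMk ((continuous_arc k).comp continuous_snd))).sub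
      (h1.comp (continuous_fst.prodMk continuous_const))
  have h1 := logChange_eq_of_homotopy hF (a := 0) (b := 2) (fun τ t _ h => by
      have h2 := congrArg norm ((R.isotopy τ).injective (sub_eq_zero.1 h))
      rw [norm_arc] at h2
      exact hq h2.symm)
    (fun τ => by simp only [F]; rw [(arc_eq_iff k 0 2).2 ⟨1, by norm_num⟩]) 1 0
  simp only [F, R.isotopy_zero] at h1
  exact h1

/-- The image under the braid action of the circle that contains the arc `a_k`. On `[0, 1]` it
parametrizes the arc `a_k'`. -/
noncomputable def arcLoop (k : Fin g) : LoopCurve where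
  γ t := R.toHomeo (arc g k t)
  T := 2
  σ := -1
  In := R.toHomeo '' {q | ‖q‖ < rad g k.succ}
  Out := R.toHomeo '' {q | rad g k.succ < ‖q‖}
  continuous := R.toHomeo.continuous.comp (continuous_arc k)
  T_pos := two_pos
  sign := Or.inr rfl
  eq_iff t t' := by rw [R.toHomeo.injective.eq_iff, arc_eq_iff]
  cover p := by
    obtain ⟨q, rfl⟩ := R.toHomeo.surjective p
    rcases lt_trichotomy ‖q‖ (rad g k.succ) with h | h | h
    · exact Or.inl ⟨q, h, rfl⟩
    · exact Or.inr (Or.inr ⟨_, congrArg R.toHomeo (arc_arg k h)⟩)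
    · exact Or.inr (Or.inl ⟨q, h, rfl⟩)
  notMem_In t h := by
    rw [R.toHomeo.injective.mem_set_image, mem_ofPred_eq, norm_arc] at h
    exact lt_irrefl _ h
  notMem_Out t h := by
    rw [R.toHomeo.injective.mem_set_image, mem_ofPred_eq, norm_arc] at h
    exact lt_irrefl _ h
  mem_closure_In t := by
    rw [← R.toHomeo.image_closure]
    refine mem_image_of_mem _ ?_
    have hlim : Tendsto (fun τ : ℝ => τ * arc g k t) (𝓝[<] 1) (𝓝 (arc g k t)) := by
      have h := Continuous.tendsto (f := fun τ : ℝ => τ * arc g k t) (by fun_prop) 1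
      simp only [Complex.ofReal_one, one_mul] at h
      exact h.mono_left nhdsWithin_le_nhds
    refine mem_closure_of_tendsto hlim ?_
    filter_upwards [Ioo_mem_nhdsLT (show (0 : ℝ) < 1 by norm_num)] with τ hτ
    have hr := rad_pos k.succ
    change ‖(τ : ℂ) * arc g k t‖ < rad g k.succ
    rw [norm_mul, norm_arc, Complex.norm_real, Real.norm_of_nonneg hτ.1.le]
    nlinarith [hτ.2]
  mem_closure_Out t := by
    rw [← R.toHomeo.image_closure]
    refine mem_image_of_mem _ ?_
    have hlim : Tendsto (fun τ : ℝ => τ * arc g k t) (𝓝[>] 1) (𝓝 (arc g k t)) := by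
      have h := Continuous.tendsto (f := fun τ : ℝ => τ * arc g k t) (by fun_prop) 1
      simp only [Complex.ofReal_one, one_mul] at h
      exact h.mono_left nhdsWithin_le_nhds
    refine mem_closure_of_tendsto hlim ?_
    filter_upwards [self_mem_nhdsWithin] with τ hτ
    have hr := rad_pos k.succ
    have hτ : 1 < τ := hτ
    change rad g k.succ < ‖(τ : ℂ) * arc g k t‖
    rw [norm_mul, norm_arc, Complex.norm_real, Real.norm_of_nonneg (by linarith)]
    nlinarith
  wind_In p hp := by
    obtain ⟨q, hq, rfl⟩ := hp
    rw [wind_toHomeo R k (ne_of_lt hq), wind_arc_inside k hq]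
    push_cast; ring
  wind_Out p hp := by
    obtain ⟨q, hq, rfl⟩ := hp
    rw [wind_toHomeo R k (ne_of_gt hq), wind_arc_outside k hq]

end Arc

/-! ### The grading in the disc as a winding number -/

section Grading

variable {g : ℕ} {β : BraidGroup g} {R : BraidRep β}

/-- The change of `log (γ - p)` along a path `γ` in a subset of the plane. -/
noncomputable def pathChange {S : Set ℂ} {a b : S} (γ : Path a b) (p : ℂ) : ℂ :=
  logChange (fun t => (γ.extend t : ℂ) - p) 0 1

theorem pathChange_trans {S : Set ℂ} {a b c : S} (γ : Path a b) (γ' : Path b c) {p : ℂ}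
    (hp : p ∉ S) : pathChange (γ.trans γ') p = pathChange γ p + pathChange γ' p := by
  have hc : ∀ {a b : S} (γ : Path a b), Continuous fun t => (γ.extend t : ℂ) - p := fun γ =>
    (continuous_subtype_val.comp γ.continuous_extend).sub continuous_const
  have h0 : ∀ {a b : S} (γ : Path a b) t, (γ.extend t : ℂ) - p ≠ 0 := fun γ t =>
    sub_ne_zero.2 fun h => hp (h ▸ (γ.extend t).2)
  rw [pathChange, ← logChange_add (b := 1 / 2) (hc _) (fun t _ => h0 _ t) (fun t _ => h0 _ t)]
  have h1 : EqOn (fun t => (((γ.trans γ').extend t : S) : ℂ) - p)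
      (fun t => (fun t => (γ.extend t : ℂ) - p) (2 * t + 0)) (uIcc 0 (1 / 2)) := by
    intro t ht
    rw [uIcc_of_le (by norm_num)] at ht
    simp only
    have ht1 : 0 ≤ t := ht.1
    have ht2 : t ≤ 1 / 2 := ht.2
    have e0 : (γ.trans γ').extend t = γ.extend (2 * t + 0) := by
      rw [add_zero, Path.extend_apply _ ⟨ht1, by linarith⟩, Path.trans_apply, dif_pos ht2,
        Path.extend_apply _ ⟨by linarith, by linarith⟩]
    rw [e0]
  have h2 : EqOn (fun t => (((γ.trans γ').extend t : S) : ℂ) - p)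
      (fun t => (fun t => (γ'.extend t : ℂ) - p) (2 * t + -1)) (uIcc (1 / 2) 1) := by
    intro t ht
    rw [uIcc_of_le (by norm_num)] at ht
    simp only
    have ht1 : 1 / 2 ≤ t := ht.1
    have ht2 : t ≤ 1 := ht.2
    have e0 : (γ.trans γ').extend t = γ'.extend (2 * t + -1) := by
      rw [Path.extend_apply _ ⟨by linarith, ht2⟩, Path.trans_apply, ← sub_eq_add_neg,
        Path.extend_apply _ ⟨by linarith, by linarith⟩]
      split_ifs with h
      · obtain rfl : t = 1 / 2 := le_antisymm h ht1
        have e1 : (⟨2 * (1 / 2), by norm_num, by norm_num⟩ : unitInterval) = 1 :=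
          Subtype.ext (by norm_num)
        have e2 : (⟨2 * (1 / 2) - 1, by norm_num, by norm_num⟩ : unitInterval) = 0 :=
          Subtype.ext (by norm_num)
        rw [e1, e2, γ.target, γ'.source]
      · rfl
    rw [e0]
  rw [logChange_congr h1, logChange_congr h2,
    logChange_comp_affine _ _ (hc γ).continuousOn (fun t _ => h0 γ t),
    logChange_comp_affine _ _ (hc γ').continuousOn (fun t _ => h0 γ' t), pathChange, pathChange]
  norm_num

theorem pathChange_segment {f : ℝ → ℂ} (hf : Continuous f) {r₀ r₁ : ℝ}
    (h : ∀ τ : unitInterval, f (r₀ + τ * (r₁ - r₀)) ∈ puncturedDisc g)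
    {a b : puncturedDisc g} (ha : (a : ℂ) = f r₀) (hb : (b : ℂ) = f r₁) {p : ℂ}
    (hp : p ∉ puncturedDisc g) :
    pathChange (segment f hf r₀ r₁ h ha hb) p = logChange (fun t => f t - p) r₀ r₁ := by
  have h1 : EqOn (fun t => (((segment f hf r₀ r₁ h ha hb).extend t : puncturedDisc g) : ℂ) - p)
      (fun t => (fun t => f t - p) ((r₁ - r₀) * t + r₀)) (uIcc 0 1) := by
    intro t ht
    rw [uIcc_of_le (by norm_num)] at ht
    simp only
    rw [Path.extend_apply _ ht]
    change f (r₀ + t * (r₁ - r₀)) - p = _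
    congr 2; ring
  have h0 : ∀ t ∈ uIcc r₀ r₁, f t - p ≠ 0 := by
    intro t ht h'
    obtain ⟨τ, hτ, rfl⟩ : ∃ τ ∈ Icc (0 : ℝ) 1, r₀ + τ * (r₁ - r₀) = t := by
      rw [← segment_eq_uIcc, segment_eq_image'] at ht
      obtain ⟨τ, hτ, rfl⟩ := ht
      exact ⟨τ, hτ, by simp⟩
    exact hp (sub_eq_zero.1 h' ▸ h ⟨τ, hτ⟩)
  have e0 : (r₁ - r₀) * 0 + r₀ = r₀ := by ring
  have e1 : (r₁ - r₀) * 1 + r₀ = r₁ := by ring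
  have h2 := logChange_comp_affine (f := fun t => f t - p) (r₁ - r₀) r₀ (a := 0) (b := 1)
    (hf.sub continuous_const).continuousOn (by rw [e0, e1]; exact h0)
  rw [e0, e1] at h2
  rw [pathChange, logChange_congr h1, h2]

/-- The monodromy of `exp` along the image of a path of configurations under `{x_k} ↦ ∏ (x_k - p)`
is the sum of the changes of `log (x_k - p)`. -/
theorem monodromy_confPath {m : ℕ} {S : Set ℂ} {p : ℂ} (hp : p ∉ S) {c c' : Conf m S}
    (q : Path c c') {a b : Fin m → S} (γ : ∀ k, Path (a k) (b k))
    (hγ : ∀ t, Function.Injective fun k => γ k t) (hq : ∀ t, q t = Conf.mk ⟨fun k => γ k t, hγ t⟩)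
    (e : expCover ⁻¹' {Conf.prodSub p hp c}) :
    (isCoveringMap_expCover.monodromy
      (Path.Homotopic.Quotient.mk (q.map (Conf.prodSub p hp).continuous)) e).1 =
      e.1 + ∑ k, pathChange (γ k) p := by
  have h0 : ∀ k t, ((γ k).extend t : ℂ) - p ≠ 0 := fun k t =>
    sub_ne_zero.2 fun h => hp (h ▸ ((γ k).extend t).2)
  have hlog : ∀ k, ∃ L : ℝ → ℂ, Continuous L ∧
      ∀ t ∈ uIcc (0 : ℝ) 1, Complex.exp (L t) = ((γ k).extend t : ℂ) - p := fun k =>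
    exists_continuous_log_uIcc ((continuous_subtype_val.comp (γ k).continuous_extend).sub
      continuous_const).continuousOn fun t _ => h0 k t
  choose L hL hL' using hlog
  have hL'' : ∀ k (t : unitInterval), Complex.exp (L k t) = (γ k t : ℂ) - p := fun k t => by
    rw [hL' k t (by rw [uIcc_of_le zero_le_one]; exact t.2), Path.extend_apply _ t.2]
  have hsource : (q.map (Conf.prodSub p hp).continuous) 0 = expCover e.1 :=
    (Path.source _).trans (show expCover e.1 = _ from e.2).symm
  have hc : Continuous fun t : unitInterval => e.1 + ∑ k, (L k t - L k 0) := by fun_prop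
  have hval : ∀ t, ((Conf.prodSub p hp (q t) : {u : ℂ // u ≠ 0}) : ℂ) =
      ∏ k, ((γ k t : ℂ) - p) := fun t => by rw [hq]; rfl
  have key : (⟨_, hc⟩ : C(unitInterval, ℂ)) = isCoveringMap_expCover.liftPath
      (q.map (Conf.prodSub p hp).continuous) e.1 hsource := by
    rw [isCoveringMap_expCover.eq_liftPath_iff']
    constructor
    · funext t
      refine Subtype.ext ?_
      have he : Complex.exp e.1 = ∏ k, ((γ k 0 : ℂ) - p) := by
        rw [← hval, q.source]
        exact congrArg Subtype.val (show expCover e.1 = _ from e.2)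
      have hprod : (∏ k, ((γ k 0 : ℂ) - p)) ≠ 0 :=
        Finset.prod_ne_zero_iff.2 fun k _ => by rw [← hL'']; exact Complex.exp_ne_zero _
      have h1 : ∀ k, Complex.exp (L k 0) = (γ k 0 : ℂ) - p := fun k => by simpa using hL'' k 0
      change Complex.exp (e.1 + ∑ k, (L k t - L k 0)) = (Conf.prodSub p hp (q t)).1
      rw [hval, Complex.exp_add, Complex.exp_sum, he]
      simp only [Complex.exp_sub, hL'', h1, Finset.prod_div_distrib]
      rw [mul_div_cancel₀ _ hprod]
    · simp
  change isCoveringMap_expCover.liftPath (q.map (Conf.prodSub p hp).continuous) e.1 hsource 1 = _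
  rw [← key]
  change e.1 + ∑ k, (L k ((1 : unitInterval) : ℝ) - L k 0) = _
  congr 1
  refine Finset.sum_congr rfl fun k _ => ?_
  rw [pathChange, logChange_eq (hL k).continuousOn (hL' k)]
  simp

theorem windingAbout_loop (P : InterData R) {p : ℂ} (hp : p ∉ puncturedDisc g) :
    ((windingAbout p hp (baseConf g) (FundamentalGroup.fromPath
      (Path.Homotopic.Quotient.mk P.loop))).toAdd : ℂ) * (2 * Real.pi * Complex.I) =
      ∑ k, (pathChange (P.nuBar k) p + pathChange (P.nu k) p) := by
  have e : expCover ⁻¹' {Conf.prodSub p hp (baseConf g)} :=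
    ⟨Complex.log (Conf.prodSub p hp (baseConf g)).1,
      Subtype.ext (Complex.exp_log (Conf.prodSub p hp (baseConf g)).2)⟩
  have h1 := monodromy_eq_winding (Path.Homotopic.Quotient.mk
    (P.loop.map (Conf.prodSub p hp).continuous)) e
  have h2 : Path.Homotopic.Quotient.mk (P.loop.map (Conf.prodSub p hp).continuous) =
      (Path.Homotopic.Quotient.mk (P.firstHalf.map (Conf.prodSub p hp).continuous)).trans
        (Path.Homotopic.Quotient.mk (P.secondHalf.map (Conf.prodSub p hp).continuous)) := by
    rw [InterData.loop, Path.map_trans]; rfl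
  have h3 : (windingAbout p hp (baseConf g) (FundamentalGroup.fromPath
      (Path.Homotopic.Quotient.mk P.loop))).toAdd =
      winding (Path.Homotopic.Quotient.mk (P.loop.map (Conf.prodSub p hp).continuous)) := rfl
  have h4 : (isCoveringMap_expCover.monodromy (Path.Homotopic.Quotient.mk
      (P.loop.map (Conf.prodSub p hp).continuous)) e).1 =
      e.1 + ∑ k, pathChange (P.nuBar k) p + ∑ k, pathChange (P.nu k) p := by
    rw [h2, IsCoveringMap.monodromy_trans_apply,
      monodromy_confPath hp P.secondHalf P.nu P.nu_injective (fun t => rfl),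
      monodromy_confPath hp P.firstHalf P.nuBar P.nuBar_injective (fun t => rfl)]
  rw [h3, Finset.sum_add_distrib]
  linear_combination h4 - h1

theorem logChange_neg_conj {γ : ℝ → ℂ} (hγ : Continuous γ) {a b : ℝ} {p : ℂ}
    (h0 : ∀ t ∈ uIcc a b, γ t - p ≠ 0) :
    logChange (fun t => -starRingEnd ℂ (γ t - p)) a b =
      starRingEnd ℂ (logChange (fun t => γ t - p) a b) := by
  obtain ⟨L, hL, h⟩ := exists_continuous_log_uIcc (f := fun t => γ t - p)
    (hγ.sub continuous_const).continuousOn h0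
  rw [logChange_eq hL.continuousOn h,
    logChange_eq (L := fun t => starRingEnd ℂ (L t) + Real.pi * Complex.I)
      ((Complex.continuous_conj.comp hL).add continuous_const).continuousOn fun t ht => by
        rw [Complex.exp_add, Complex.exp_pi_mul_I, ← h t ht, Complex.exp_conj, mul_neg_one],
    map_sub]
  ring

/-- The reflection that exchanges the punctures `z_j` and `w_j`. -/
theorem neg_conj_ovalCoord (k : Fin g) (u v : ℝ) :
    -starRingEnd ℂ (ovalCoord g k u v) = ovalCoord g k u (-v) := by
  rw [ovalCoord_eq, ovalCoord_eq]
  simp only [map_mul, map_neg, Complex.conj_I, Complex.conj_ofReal, ← Complex.exp_conj]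
  push_cast
  ring_nf

/-- The change of `log (γ - p)` along the path from `d_k` to the innermost point of `b_k` that passes
on the left-hand side (`e = -1`) or on the right-hand side (`e = 1`). -/
noncomputable def approach (k : Fin g) (e : ℝ) (p : ℂ) : ℂ :=
  logChange (fun τ => etaCurve k e τ - p) 0 1 + logChange (fun s => oval g k s - p) (landing e) Real.pi

theorem etaCurve_sub_ne_zero (k : Fin g) {e : ℝ} (he : e = 1 ∨ e = -1) {p : ℂ}
    (hp : p ∉ puncturedDisc g) {t : ℝ} (ht : t ∈ uIcc (0 : ℝ) 1) : etaCurve k e t - p ≠ 0 := by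
  rw [uIcc_of_le zero_le_one] at ht
  exact sub_ne_zero.2 fun h => hp (h ▸ etaCurve_mem k he ⟨t, ht⟩)

theorem oval_sub_ne_zero (k : Fin g) {p : ℂ} (hp : p ∉ puncturedDisc g) (s : ℝ) :
    oval g k s - p ≠ 0 :=
  sub_ne_zero.2 fun h => hp (h ▸ oval_mem k s)

theorem exp_approach (k : Fin g) {e : ℝ} (he : e = 1 ∨ e = -1) {p : ℂ}
    (hp : p ∉ puncturedDisc g) :
    Complex.exp (approach k e p) = (oval g k Real.pi - p) / (basePt k - p) := by
  rw [approach, Complex.exp_add,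
    exp_logChange_sub (continuous_etaCurve k e)
      (fun t ht => etaCurve_sub_ne_zero k he hp ht),
    exp_logChange_sub (continuous_oval k)
      (fun t _ => oval_sub_ne_zero k hp t), ← basePt_eq k he, oval_landing k he]
  have := etaCurve_sub_ne_zero k he hp (t := 1) right_mem_uIcc
  field_simp

theorem approach_neg (k : Fin g) (j : Fin (g + 1)) {e : ℝ} (he : e = 1 ∨ e = -1) :
    approach k (-e) (wPt g j) = starRingEnd ℂ (approach k e (zPt g j)) := by
  have hz := zPt_notMem g j
  have hzw : -starRingEnd ℂ (zPt g j) = wPt g j := by simp [zPt, wPt]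
  rw [approach, approach, map_add,
    ← logChange_neg_conj (continuous_etaCurve k e)
      (fun t ht => etaCurve_sub_ne_zero k he hz ht),
    ← logChange_neg_conj (continuous_oval k)
      (fun t _ => oval_sub_ne_zero k hz t)]
  congr 1
  · congr 1
    funext τ
    rw [etaCurve, ← hzw, etaCurve, neg_mul, ← neg_conj_ovalCoord, map_sub]
    ring
  · have h1 := logChange_comp_affine (f := fun s => oval g k s - wPt g j) (-1) (2 * Real.pi)
      (a := landing e) (b := Real.pi) ((continuous_oval k).sub continuous_const).continuousOn
      (fun t _ => oval_sub_ne_zero k (wPt_notMem g j) t)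
    have e1 : -1 * landing e + 2 * Real.pi = landing (-e) := by simp only [landing]; ring
    have e2 : -1 * Real.pi + 2 * Real.pi = Real.pi := by ring
    rw [e1, e2] at h1
    rw [← h1]
    congr 1
    funext s
    have e3 : -1 * s + 2 * Real.pi = 2 * Real.pi - s := by ring
    rw [e3, oval, oval, Real.cos_two_pi_sub, Real.sin_two_pi_sub, ← neg_conj_ovalCoord, ← hzw,
      map_sub]
    ring

/-- The loop formed by the two ways from `d_k` to `b_k` winds equally often about `z_j` and `w_j`,
because it is invariant under the reflection up to orientation. -/
theorem approach_sub (k : Fin g) (j : Fin (g + 1)) {e e' : ℝ} (he : e = 1 ∨ e = -1)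
    (he' : e' = 1 ∨ e' = -1) :
    approach k e (zPt g j) - approach k e' (zPt g j) =
      approach k e (wPt g j) - approach k e' (wPt g j) := by
  have key : approach k 1 (zPt g j) - approach k (-1) (zPt g j) =
      approach k 1 (wPt g j) - approach k (-1) (wPt g j) := by
    have h1 := approach_neg k j (Or.inl rfl : (1 : ℝ) = 1 ∨ _)
    have h2 := approach_neg k j (Or.inr rfl : (-1 : ℝ) = 1 ∨ _)
    rw [neg_neg] at h2
    obtain ⟨n, hn⟩ := Complex.exp_eq_exp_iff_exists_int.1
      ((exp_approach k (Or.inl rfl : (1 : ℝ) = 1 ∨ _) (zPt_notMem g j)).trans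
        (exp_approach k (Or.inr rfl : (-1 : ℝ) = 1 ∨ _) (zPt_notMem g j)).symm)
    rw [h1, h2, hn]
    simp only [map_add, map_mul, map_intCast, map_ofNat, Complex.conj_ofReal, Complex.conj_I]
    ring
  rcases he with rfl | rfl <;> rcases he' with rfl | rfl
  · simp
  · exact key
  · linear_combination -key
  · simp

theorem pathChange_nuBar (P : InterData R) (k : Fin g) {p : ℂ} (hp : p ∉ puncturedDisc g) :
    pathChange (P.nuBar k) p =
      approach k (sideSign (P.s k)) p + logChange (fun s => oval g k s - p) Real.pi (P.s k) := by
  rw [InterData.nuBar, pathChange_trans _ _ hp, etaPath, ovalPath, pathChange_segment _ _ _ _ hp,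
    pathChange_segment _ _ _ _ hp, approach, add_assoc,
    logChange_sub_add (continuous_oval k)
      (fun t _ => oval_sub_ne_zero k hp t) (fun t _ => oval_sub_ne_zero k hp t)]

theorem pathChange_nu (P : InterData R) (k : Fin g) {p : ℂ} (hp : p ∉ puncturedDisc g) :
    pathChange (P.nu k) p =
      logChange (fun t => R.toHomeo (arc g (P.perm k) t) - p) (P.t k) (1 / 2) :=
  pathChange_segment _ _ _ _ hp

/-- The parameter on the `i`-th arc of an intersection point. -/
def InterData.arcParam (P : InterData R) (i : Fin g) : ℝ := P.t (P.perm.symm i)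

theorem InterData.arcParam_mem (P : InterData R) (i : Fin g) : P.arcParam i ∈ Ioo (0 : ℝ) 1 :=
  P.t_mem _

theorem InterData.toHomeo_arcParam (P : InterData R) (i : Fin g) :
    R.toHomeo (arc g i (P.arcParam i)) = oval g (P.perm.symm i) (P.s (P.perm.symm i)) := by
  have := P.eq (P.perm.symm i)
  rwa [P.perm.apply_symm_apply] at this

theorem uIcc_subset_Ioo_zero_one {a b : ℝ} (ha : a ∈ Ioo (0 : ℝ) 1) (hb : b ∈ Ioo (0 : ℝ) 1) :
    uIcc a b ⊆ Ioo 0 1 :=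
  ordConnected_Ioo.uIcc_subset ha hb

/-- The cycle formed by two intersection points `x` and `y`: it runs along the ovals from `y` to `x`
and along the arcs from `x` to `y`. -/
noncomputable def interCycle (P Q : InterData R) : CurveCycle (Fin g ⊕ Fin g) where
  C := Sum.elim (ovalLoop g) (arcLoop R)
  x := Sum.elim P.s P.arcParam
  y := Sum.elim Q.s Q.arcParam
  cycle p hp := by
    have hb : ∀ k, Complex.exp (logChange (fun t => oval g k t - p) (Q.s k) (P.s k)) =
        (oval g k (P.s k) - p) / (oval g k (Q.s k) - p) := fun k =>
      exp_logChange_sub (continuous_oval k) fun t ht h =>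
        hp (Sum.inl k) ⟨t, ht, sub_eq_zero.1 h⟩
    have ha : ∀ i, Complex.exp (logChange (fun t => R.toHomeo (arc g i t) - p)
        (Q.arcParam i) (P.arcParam i)) =
        (R.toHomeo (arc g i (P.arcParam i)) - p) / (R.toHomeo (arc g i (Q.arcParam i)) - p) :=
      fun i => exp_logChange_sub (γ := fun t => R.toHomeo (arc g i t))
        (R.toHomeo.continuous.comp (continuous_arc i)) fun t ht h =>
          hp (Sum.inr i) ⟨t, ht, sub_eq_zero.1 h⟩
    have hre : ∀ S : InterData R, ∏ i, (R.toHomeo (arc g i (S.arcParam i)) - p) =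
        ∏ k, (oval g k (S.s k) - p) := fun S => by
      simp only [S.toHomeo_arcParam]
      exact Equiv.prod_comp S.perm.symm fun k => oval g k (S.s k) - p
    have hne : ∀ k, oval g k (P.s k) - p ≠ 0 ∧ oval g k (Q.s k) - p ≠ 0 := fun k =>
      ⟨fun h => hp (Sum.inl k) ⟨_, right_mem_uIcc, sub_eq_zero.1 h⟩,
        fun h => hp (Sum.inl k) ⟨_, left_mem_uIcc, sub_eq_zero.1 h⟩⟩
    have hP : ∏ k, (oval g k (P.s k) - p) ≠ 0 := Finset.prod_ne_zero_iff.2 fun k _ => (hne k).1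
    have hQ : ∏ k, (oval g k (Q.s k) - p) ≠ 0 := Finset.prod_ne_zero_iff.2 fun k _ => (hne k).2
    rw [Fintype.sum_sum_type]
    simp only [Sum.elim_inl, Sum.elim_inr, ovalLoop, arcLoop]
    rw [Complex.exp_add, Complex.exp_sum, Complex.exp_sum]
    simp only [Int.cast_one, one_mul, Int.cast_neg, neg_mul, Complex.exp_neg, hb, ha,
      Finset.prod_inv_distrib, Finset.prod_div_distrib, hre]
    exact mul_inv_cancel₀ (div_ne_zero hP hQ)

theorem interCycle_support_subset (P Q : InterData R) :
    (interCycle P Q).support ⊆ puncturedDisc g := by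
  rintro p hp
  obtain ⟨j, t, ht, rfl⟩ := mem_iUnion.1 hp
  rcases j with k | i
  · exact oval_mem k t
  · exact toHomeo_mem R (arc_mem i
      (uIcc_subset_Ioo_zero_one (Q.arcParam_mem i) (P.arcParam_mem i) ht))

theorem sum_pathChange_sub (P Q : InterData R) {p : ℂ} (hp : p ∉ puncturedDisc g) :
    ∑ k, (pathChange (P.nuBar k) p + pathChange (P.nu k) p) -
      ∑ k, (pathChange (Q.nuBar k) p + pathChange (Q.nu k) p) =
      ∑ k, (approach k (sideSign (P.s k)) p - approach k (sideSign (Q.s k)) p) +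
        (interCycle P Q).wnum p * (2 * Real.pi * Complex.I) := by
  have hre : ∀ S : InterData R, ∑ k, pathChange (S.nu k) p =
      ∑ i, logChange (fun t => R.toHomeo (arc g i t) - p) (S.arcParam i) (1 / 2) := fun S => by
    rw [← Equiv.sum_comp S.perm fun i =>
      logChange (fun t => R.toHomeo (arc g i t) - p) (S.arcParam i) (1 / 2)]
    simp only [pathChange_nu _ _ hp, InterData.arcParam, Equiv.symm_apply_apply]
  have hhalf : (1 / 2 : ℝ) ∈ Ioo (0 : ℝ) 1 := by norm_num
  have ha0 : ∀ i, ∀ t ∈ Ioo (0 : ℝ) 1, R.toHomeo (arc g i t) - p ≠ 0 := fun i t ht =>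
    sub_ne_zero.2 fun h => hp (h ▸ toHomeo_mem R (arc_mem i ht))
  have ha : ∀ i, logChange (fun t => R.toHomeo (arc g i t) - p) (P.arcParam i) (1 / 2) -
      logChange (fun t => R.toHomeo (arc g i t) - p) (Q.arcParam i) (1 / 2) =
      -logChange (fun t => R.toHomeo (arc g i t) - p) (Q.arcParam i) (P.arcParam i) := fun i => by
    rw [← logChange_sub_add (γ := fun t => R.toHomeo (arc g i t)) (a := Q.arcParam i)
      (b := P.arcParam i) (c := 1 / 2) (R.toHomeo.continuous.comp (continuous_arc i))
      (fun t ht => ha0 i t (uIcc_subset_Ioo_zero_one (Q.arcParam_mem i) (P.arcParam_mem i) ht))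
      (fun t ht => ha0 i t (uIcc_subset_Ioo_zero_one (P.arcParam_mem i) hhalf ht))]
    ring
  have hb : ∀ k, logChange (fun s => oval g k s - p) Real.pi (P.s k) -
      logChange (fun s => oval g k s - p) Real.pi (Q.s k) =
      logChange (fun s => oval g k s - p) (Q.s k) (P.s k) := fun k => by
    rw [← logChange_sub_add (a := Real.pi) (b := Q.s k) (c := P.s k) (continuous_oval k)
      (fun t _ => oval_sub_ne_zero k hp t) (fun t _ => oval_sub_ne_zero k hp t)]
    ring
  have hturns := (interCycle P Q).turns_eq fun h => hp (interCycle_support_subset P Q h)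
  rw [CurveCycle.turns, div_eq_iff Complex.two_pi_I_ne_zero, Fintype.sum_sum_type] at hturns
  simp only [interCycle, Sum.elim_inl, Sum.elim_inr, ovalLoop, arcLoop, Int.cast_one, one_mul,
    Int.cast_neg, neg_mul] at hturns
  rw [Finset.sum_add_distrib, Finset.sum_add_distrib, hre, hre]
  simp only [pathChange_nuBar _ _ hp]
  rw [interCycle, ← hturns]
  simp only [← ha, ← hb, Finset.sum_add_distrib, Finset.sum_sub_distrib]
  ring

/-- The relative grading in the disc is the winding number of the cycle of the two intersection
points about the `z_j` minus that about the `w_j`. -/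
theorem exists_gradingPd_sub (x y : intersectionPoints R) :
    ∃ P Q : InterData R, P.conf = x ∧ Q.conf = y ∧ gradingPd R x - gradingPd R y =
      ∑ j, ((interCycle P Q).wnum (zPt g j) - (interCycle P Q).wnum (wPt g j)) := by
  refine ⟨(exists_interData R x.2).choose, (exists_interData R y.2).choose,
    (exists_interData R x.2).choose_spec, (exists_interData R y.2).choose_spec, ?_⟩
  set P := (exists_interData R x.2).choose with hP
  set Q := (exists_interData R y.2).choose with hQ
  have hgr : ∀ S : InterData R, (localSystem g (baseConf g) (FundamentalGroup.fromPath
      (Path.Homotopic.Quotient.mk S.loop))).toAdd =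
      ∑ j, (windingAbout (zPt g j) (zPt_notMem g j) (baseConf g) (FundamentalGroup.fromPath
        (Path.Homotopic.Quotient.mk S.loop))).toAdd -
      ∑ j, (windingAbout (wPt g j) (wPt_notMem g j) (baseConf g) (FundamentalGroup.fromPath
        (Path.Homotopic.Quotient.mk S.loop))).toAdd := fun S => by
    rw [localSystem, MonoidHom.div_apply, toAdd_div, MonoidHom.finsetProd_apply,
      MonoidHom.finsetProd_apply, toAdd_prod, toAdd_prod]
  have key : ∀ j, (((windingAbout (zPt g j) (zPt_notMem g j) (baseConf g)
      (FundamentalGroup.fromPath (Path.Homotopic.Quotient.mk P.loop))).toAdd -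
      (windingAbout (wPt g j) (wPt_notMem g j) (baseConf g)
      (FundamentalGroup.fromPath (Path.Homotopic.Quotient.mk P.loop))).toAdd) -
      ((windingAbout (zPt g j) (zPt_notMem g j) (baseConf g)
      (FundamentalGroup.fromPath (Path.Homotopic.Quotient.mk Q.loop))).toAdd -
      (windingAbout (wPt g j) (wPt_notMem g j) (baseConf g)
      (FundamentalGroup.fromPath (Path.Homotopic.Quotient.mk Q.loop))).toAdd)) =
      (interCycle P Q).wnum (zPt g j) - (interCycle P Q).wnum (wPt g j) := fun j => by
    have hz := sum_pathChange_sub P Q (zPt_notMem g j)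
    have hw := sum_pathChange_sub P Q (wPt_notMem g j)
    rw [← windingAbout_loop P (zPt_notMem g j), ← windingAbout_loop Q (zPt_notMem g j)] at hz
    rw [← windingAbout_loop P (wPt_notMem g j), ← windingAbout_loop Q (wPt_notMem g j)] at hw
    have happ : ∑ k, (approach k (sideSign (P.s k)) (zPt g j) -
        approach k (sideSign (Q.s k)) (zPt g j)) =
        ∑ k, (approach k (sideSign (P.s k)) (wPt g j) -
        approach k (sideSign (Q.s k)) (wPt g j)) :=
      Finset.sum_congr rfl fun k _ => approach_sub k j (sideSign_eq _) (sideSign_eq _)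
    have h := Complex.two_pi_I_ne_zero
    rw [← @Int.cast_inj ℂ]
    push_cast
    refine mul_right_cancel₀ h ?_
    linear_combination hz - hw + happ
  rw [gradingPd, gradingPd, hgr, hgr, ← Finset.sum_sub_distrib, ← Finset.sum_sub_distrib,
    ← Finset.sum_sub_distrib]
  exact Finset.sum_congr rfl fun j _ => key j

end Grading

/-! ### Domains on the Heegaard surface as functions on the plane -/

section Surface

variable {g : ℕ} {β : BraidGroup g} {R : BraidRep β} {ε : ℝ}

variable (R) in
/-- The union of the arcs `a_i'` and the ovals `b_k` in the plane. -/
def curveSet : Set ℂ := (⋃ i, R.toHomeo '' (arc g i '' Icc 0 1)) ∪ ⋃ k, range (oval g k)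

theorem isCompact_curveSet : IsCompact (curveSet R) :=
  (isCompact_iUnion fun i => (isCompact_Icc.image (continuous_arc i)).image
    R.toHomeo.continuous).union (isCompact_iUnion fun k => (ovalLoop g k).isCompact_range)

theorem oval_mem_curveSet (k : Fin g) (s : ℝ) : oval g k s ∈ curveSet R :=
  Or.inr (mem_iUnion.2 ⟨k, s, rfl⟩)

theorem arc_mem_curveSet (i : Fin g) {t : ℝ} (ht : t ∈ Icc (0 : ℝ) 1) :
    R.toHomeo (arc g i t) ∈ curveSet R :=
  Or.inl (mem_iUnion.2 ⟨i, _, ⟨t, ht, rfl⟩, rfl⟩)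

theorem toHomeo_of_re_nonneg {q : ℂ} (h : 0 ≤ q.re) : R.toHomeo q = q :=
  toHomeo_of_notMem R fun h' => (re_of_mem_braidDisc h').not_ge h

theorem dist_neg_conj (j : Fin (g + 1)) (ζ : ℂ) :
    dist (-starRingEnd ℂ ζ) (wPt g j) = dist ζ (zPt g j) := by
  have : -starRingEnd ℂ ζ - wPt g j = -starRingEnd ℂ (ζ - zPt g j) := by
    simp [zPt, wPt]; ring
  rw [dist_eq_norm, dist_eq_norm, this, norm_neg, Complex.norm_conj]

theorem re_pos_of_dist_wPt {j : Fin (g + 1)} {q : ℂ} (h : dist q (wPt g j) < 1) : 0 < q.re := by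
  have h1 := (Complex.abs_re_le_norm (q - wPt g j)).trans_lt (dist_eq_norm q _ ▸ h)
  rw [Complex.sub_re, abs_lt] at h1
  have h2 := rad_pos j
  have h3 : (wPt g j).re = rad g j := Complex.ofReal_re _
  linarith [h1.1]

/-- The removed discs before the braid action. -/
def modelDiscs (g : ℕ) (ε : ℝ) : Set ℂ :=
  ⋃ i : Fin g, Metric.ball (zPt g i.succ) ε ∪ Metric.ball (wPt g i.succ) ε

theorem toHomeo_image_ball_wPt (j : Fin (g + 1)) (hε : ε ≤ 1) :
    R.toHomeo '' Metric.ball (wPt g j) ε = Metric.ball (wPt g j) ε := by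
  have : ∀ q ∈ Metric.ball (wPt g j) ε, R.toHomeo q = q := fun q hq =>
    toHomeo_of_re_nonneg (re_pos_of_dist_wPt (hq.trans_le hε)).le
  rw [image_congr this, image_id']

theorem removedDiscs_eq (hε : ε ≤ 1) : removedDiscs R ε = R.toHomeo '' modelDiscs g ε := by
  simp only [removedDiscs, modelDiscs, image_iUnion, image_union, toHomeo_image_ball_wPt _ hε]

theorem toHomeo_mem_removedDiscs (hε : ε ≤ 1) {q : ℂ} :
    R.toHomeo q ∈ removedDiscs R ε ↔ q ∈ modelDiscs g ε := by
  rw [removedDiscs_eq hε, R.toHomeo.injective.mem_set_image]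

theorem one_le_dist_zPt {i j : Fin (g + 1)} (h : i ≠ j) : 1 ≤ dist (zPt g i) (zPt g j) := by
  obtain ⟨N, hN, hN'⟩ := rad_sub i j
  have h1 : zPt g i - zPt g j = ((-N : ℤ) : ℂ) := by
    have : ((rad g i - rad g j : ℝ) : ℂ) = N := by rw [hN]; simp
    simp only [zPt]; push_cast at this ⊢; linear_combination -this
  rw [dist_eq_norm, h1, Complex.norm_intCast]
  have : N ≠ 0 := fun h' => h (hN'.1 h')
  exact_mod_cast Int.one_le_abs (neg_ne_zero.2 this)

theorem one_le_dist_zPt_wPt (i j : Fin (g + 1)) : 1 ≤ dist (zPt g i) (wPt g j) := by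
  have h1 : zPt g i - wPt g j = -((rad g i + rad g j : ℝ) : ℂ) := by
    simp only [zPt, wPt]; push_cast; ring
  have h2 := rad_pos i
  have h3 := rad_pos j
  rw [dist_eq_norm, h1, norm_neg, Complex.norm_real, Real.norm_of_nonneg] <;> linarith

/-- Near `z_i` only the disc around `z_i` is removed. -/
theorem notMem_modelDiscs_of_dist {i : Fin g} {ζ : ℂ} (hε : ε ≤ 1 / 2)
    (h1 : ε ≤ dist ζ (zPt g i.succ)) (h2 : dist ζ (zPt g i.succ) ≤ 1 / 2) :
    ζ ∉ modelDiscs g ε := by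
  intro h
  obtain ⟨j, hj⟩ := mem_iUnion.1 h
  rcases hj with hj | hj
  · rw [Metric.mem_ball] at hj
    by_cases hij : i = j
    · subst hij; linarith
    · have := one_le_dist_zPt (g := g) (fun h => hij (Fin.succ_injective _ h))
      have h3 := dist_triangle_left (zPt g i.succ) (zPt g j.succ) ζ
      linarith
  · rw [Metric.mem_ball] at hj
    have := one_le_dist_zPt_wPt (g := g) i.succ j.succ
    have h3 := dist_triangle_left (zPt g i.succ) (wPt g j.succ) ζ
    linarith

theorem neg_conj_mem_modelDiscs {ζ : ℂ} :
    -starRingEnd ℂ ζ ∈ modelDiscs g ε ↔ ζ ∈ modelDiscs g ε := by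
  have key : ∀ ξ : ℂ, ξ ∈ modelDiscs g ε → -starRingEnd ℂ ξ ∈ modelDiscs g ε := fun ξ h => by
    obtain ⟨j, hj⟩ := mem_iUnion.1 h
    refine mem_iUnion.2 ⟨j, ?_⟩
    rcases hj with hj | hj
    · right; rwa [Metric.mem_ball, dist_neg_conj]
    · left
      have := dist_neg_conj j.succ (-starRingEnd ℂ ξ)
      simp only [map_neg, Complex.conj_conj, neg_neg] at this
      rwa [Metric.mem_ball, ← this]
  refine ⟨fun h => ?_, key ζ⟩
  have := key _ h
  simpa using this

theorem neg_conj_mem_arc (k : Fin g) {ζ : ℂ} :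
    -starRingEnd ℂ ζ ∈ arc g k '' Icc 0 1 ↔ ζ ∈ arc g k '' Icc 0 1 := by
  rw [mem_arc_image_iff, mem_arc_image_iff, norm_neg, Complex.norm_conj]
  simp

theorem IsTubeRadius.le_half (hε : IsTubeRadius R ε) : ε ≤ 1 / 2 := hε.lt_half.le

theorem IsTubeRadius.le_one (hε : IsTubeRadius R ε) : ε ≤ 1 := hε.le_half.trans (by norm_num)

theorem re_neg_conj_pos {i : Fin (g + 1)} {ζ : ℂ} (h : dist ζ (zPt g i) < 1) :
    0 < (-starRingEnd ℂ ζ).re :=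
  re_pos_of_dist_wPt (j := i) (by rwa [dist_neg_conj])

theorem curveSet_glue (hε : IsTubeRadius R ε) {i : Fin g} {ζ : ℂ}
    (hζ : dist ζ (zPt g i.succ) ≤ ε) :
    R.toHomeo ζ ∈ curveSet R ↔ -starRingEnd ℂ ζ ∈ curveSet R := by
  have hfix : R.toHomeo (-starRingEnd ℂ ζ) = -starRingEnd ℂ ζ :=
    toHomeo_of_re_nonneg (re_neg_conj_pos (i := i.succ) (by linarith [hε.lt_half])).le
  have h1 : R.toHomeo ζ ∉ ⋃ k, range (oval g k) := fun h => by
    obtain ⟨k, s, hs⟩ := mem_iUnion.1 h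
    exact hε.disjoint_z i k s ⟨ζ, hζ, hs.symm⟩
  have h2 : -starRingEnd ℂ ζ ∉ ⋃ k, range (oval g k) := fun h => by
    obtain ⟨k, s, hs⟩ := mem_iUnion.1 h
    refine hε.disjoint_w i k s ?_
    rw [hs, Metric.mem_closedBall, dist_neg_conj]
    exact hζ
  rw [curveSet, mem_union, mem_union, or_iff_left h1, or_iff_left h2, ← hfix]
  simp only [mem_iUnion, R.toHomeo.injective.mem_set_image, neg_conj_mem_arc]

theorem coe_mem_planarPart {p : ℂ} :
    (p : OnePoint ℂ) ∈ planarPart R ε ↔ p ∉ removedDiscs R ε := by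
  rw [planarPart, mem_compl_iff, OnePoint.coe_injective.mem_set_image]

theorem toSurface_mem_curves (hε : IsTubeRadius R ε) (p : planarPart R ε) :
    toSurface p ∈ curves R ε ↔ (p : OnePoint ℂ) ∈ ((↑) : ℂ → OnePoint ℂ) '' curveSet R := by
  have hglue : ∀ q q' : planarPart R ε, glue R ε q q' →
      ((q : OnePoint ℂ) ∈ ((↑) : ℂ → OnePoint ℂ) '' curveSet R) =
        ((q' : OnePoint ℂ) ∈ ((↑) : ℂ → OnePoint ℂ) '' curveSet R) := by
    rintro q q' ⟨i, ζ, hζ, hq, hq'⟩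
    rw [hq, hq', OnePoint.coe_injective.mem_set_image, OnePoint.coe_injective.mem_set_image,
      curveSet_glue hε (le_of_eq hζ)]
  have hlift : ∀ q q' : planarPart R ε, toSurface q = toSurface q' →
      (q : OnePoint ℂ) ∈ ((↑) : ℂ → OnePoint ℂ) '' curveSet R →
        (q' : OnePoint ℂ) ∈ ((↑) : ℂ → OnePoint ℂ) '' curveSet R := fun q q' h hq =>
    (congrArg (Quot.lift (fun q : planarPart R ε =>
      (q : OnePoint ℂ) ∈ ((↑) : ℂ → OnePoint ℂ) '' curveSet R) hglue) h).mp hq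
  constructor
  · rintro (h | h)
    · obtain ⟨i, q, hq, t, ht, hqt⟩ := mem_iUnion.1 h
      exact hlift q p hq ⟨_, arc_mem_curveSet i ht, hqt.symm⟩
    · obtain ⟨k, q, hq, s, hqs⟩ := mem_iUnion.1 h
      exact hlift q p hq ⟨_, oval_mem_curveSet k s, hqs.symm⟩
  · rintro ⟨c, hc | hc, hcp⟩
    · obtain ⟨i, _, ⟨t, ht, rfl⟩, rfl⟩ := mem_iUnion.1 hc
      exact Or.inl (mem_iUnion.2 ⟨i, p, rfl, t, ht, hcp.symm⟩)
    · obtain ⟨k, s, rfl⟩ := mem_iUnion.1 hc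
      exact Or.inr (mem_iUnion.2 ⟨k, p, rfl, s, hcp.symm⟩)

theorem toSurface_coe_mem_compl_curves (hε : IsTubeRadius R ε) {p : ℂ}
    (hp : (p : OnePoint ℂ) ∈ planarPart R ε) (hK : p ∉ curveSet R) :
    toSurface ⟨p, hp⟩ ∈ (curves R ε)ᶜ := fun h => by
  rw [toSurface_mem_curves hε, OnePoint.coe_injective.mem_set_image] at h
  exact hK h

theorem planarMultiplicity_eq (hε : IsTubeRadius R ε) (D : Domain R ε) {p : ℂ}
    (hp : (p : OnePoint ℂ) ∈ planarPart R ε) (hK : p ∉ curveSet R) :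
    D.planarMultiplicity p =
      D (ConnectedComponents.mk ⟨_, toSurface_coe_mem_compl_curves hε hp hK⟩) := by
  rw [Domain.planarMultiplicity, dif_pos hp, Domain.multiplicity,
    dif_pos (toSurface_coe_mem_compl_curves hε hp hK)]

/-- The multiplicity of a domain is constant on connected sets that avoid the curves. -/
theorem planarMultiplicity_eq_of_isPreconnected (hε : IsTubeRadius R ε) (D : Domain R ε)
    {S : Set ℂ} (hS : IsPreconnected S) (h1 : ∀ p ∈ S, p ∉ removedDiscs R ε)
    (h2 : ∀ p ∈ S, p ∉ curveSet R) {p q : ℂ} (hp : p ∈ S) (hq : q ∈ S) :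
    D.planarMultiplicity p = D.planarMultiplicity q := by
  let φ : S → ConnectedComponents ((curves R ε)ᶜ : Set (HeegaardSurface R ε)) := fun p =>
    ConnectedComponents.mk ⟨toSurface ⟨(p : ℂ), coe_mem_planarPart.2 (h1 p p.2)⟩,
      toSurface_coe_mem_compl_curves hε _ (h2 p p.2)⟩
  have hφ : Continuous φ := by
    refine ConnectedComponents.continuous_coe.comp (Continuous.subtype_mk ?_ _)
    exact continuous_quot_mk.comp (Continuous.subtype_mk
      (OnePoint.continuous_coe.comp continuous_subtype_val) _)
  have : PreconnectedSpace S := isPreconnected_iff_preconnectedSpace.1 hS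
  have : φ ⟨p, hp⟩ = φ ⟨q, hq⟩ :=
    (isPreconnected_range hφ).subsingleton (mem_range_self _) (mem_range_self _)
  rw [planarMultiplicity_eq hε D (coe_mem_planarPart.2 (h1 p hp)) (h2 p hp),
    planarMultiplicity_eq hε D (coe_mem_planarPart.2 (h1 q hq)) (h2 q hq)]
  exact congrArg D this

theorem planarMultiplicity_glue (hε : IsTubeRadius R ε) (D : Domain R ε) {i : Fin g} {ζ : ℂ}
    (hζ : dist ζ (zPt g i.succ) = ε) :
    D.planarMultiplicity (R.toHomeo ζ) = D.planarMultiplicity (-starRingEnd ℂ ζ) := by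
  have hmodel := notMem_modelDiscs_of_dist (ε := ε) hε.le_half hζ.ge (hζ.le.trans hε.le_half)
  have hfix : R.toHomeo (-starRingEnd ℂ ζ) = -starRingEnd ℂ ζ :=
    toHomeo_of_re_nonneg (re_neg_conj_pos (i := i.succ) (by linarith [hε.lt_half])).le
  have h1 : ((R.toHomeo ζ : ℂ) : OnePoint ℂ) ∈ planarPart R ε :=
    coe_mem_planarPart.2 fun h => hmodel ((toHomeo_mem_removedDiscs hε.le_one).1 h)
  have h2 : ((-starRingEnd ℂ ζ : ℂ) : OnePoint ℂ) ∈ planarPart R ε := by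
    refine coe_mem_planarPart.2 fun h => hmodel ?_
    rw [← hfix, toHomeo_mem_removedDiscs hε.le_one, neg_conj_mem_modelDiscs] at h
    exact h
  have : (toSurface ⟨_, h1⟩ : HeegaardSurface R ε) = toSurface ⟨_, h2⟩ :=
    Quot.sound ⟨i, ζ, hζ, rfl, rfl⟩
  rw [Domain.planarMultiplicity, dif_pos h1, Domain.planarMultiplicity, dif_pos h2, this]

/-- A locally constant function on the complement of the curves in the sphere that is compatible
with the gluing is the multiplicity function of a domain. -/
theorem exists_domain (hε : IsTubeRadius R ε) (f : ℂ → ℤ)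
    (hf : ∀ p ∉ curveSet R, ∀ᶠ q in 𝓝 p, f q = f p)
    (hinf : ∃ c, ∀ᶠ p in cocompact ℂ, f p = c)
    (hglue : ∀ i : Fin g, ∀ ζ, dist ζ (zPt g i.succ) = ε →
      f (R.toHomeo ζ) = f (-starRingEnd ℂ ζ)) :
    ∃ D : Domain R ε, ∀ p ∉ removedDiscs R ε, p ∉ curveSet R → D.planarMultiplicity p = f p := by
  obtain ⟨c, hc⟩ := hinf
  let F : OnePoint ℂ → ℤ := fun p => OnePoint.elim p c f
  let G : HeegaardSurface R ε → ℤ := Quot.lift (fun p : planarPart R ε => F p) (by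
    rintro q q' ⟨i, ζ, hζ, hq, hq'⟩
    simp only [hq, hq']
    exact hglue i ζ hζ)
  have hF : ∀ n, IsOpen {p : OnePoint ℂ | p ∉ ((↑) : ℂ → OnePoint ℂ) '' curveSet R ∧ F p = n} := by
    intro n
    rw [isOpen_iff_mem_nhds]
    intro p hp
    induction p using OnePoint.rec with
    | infty =>
      rw [OnePoint.nhds_infty_eq, Filter.coclosedCompact_eq_cocompact]
      refine ⟨?_, hp⟩
      rw [mem_map]
      filter_upwards [hc, isCompact_curveSet.compl_mem_cocompact] with q hq hq'
      refine ⟨by rwa [OnePoint.coe_injective.mem_set_image], ?_⟩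
      exact hq.trans hp.2
    | coe p =>
      have hp1 : p ∉ curveSet R := by
        have := hp.1
        rwa [OnePoint.coe_injective.mem_set_image] at this
      rw [OnePoint.nhds_coe_eq, mem_map]
      filter_upwards [hf p hp1,
        isCompact_curveSet.isClosed.isOpen_compl.eventually_mem hp1] with q hq hq'
      refine ⟨by rwa [OnePoint.coe_injective.mem_set_image], ?_⟩
      exact hq.trans hp.2
  have hG : Continuous fun x : ((curves R ε)ᶜ : Set (HeegaardSurface R ε)) => G x := by
    rw [continuous_discrete_rng]
    intro n
    have hopen : IsOpen {x : HeegaardSurface R ε | x ∉ curves R ε ∧ G x = n} := by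
      refine (isQuotientMap_quot_mk (r := glue R ε)).isOpen_preimage.1 ?_
      convert (hF n).preimage (continuous_subtype_val (p := (· ∈ planarPart R ε))) using 1
      ext p
      exact and_congr_left' (not_congr (toSurface_mem_curves hε p))
    convert hopen.preimage continuous_subtype_val using 1
    ext x
    exact ⟨fun h => ⟨x.2, h⟩, fun h => h.2⟩
  refine ⟨hG.connectedComponentsLift, fun p hp hK => ?_⟩
  rw [planarMultiplicity_eq hε _ (coe_mem_planarPart.2 hp) hK]
  exact hG.connectedComponentsLift_apply_coe _

end Surface

/-! ### The multiplicities of a domain near the tubes -/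

section Tubes

variable {g : ℕ} {β : BraidGroup g} {R : BraidRep β} {ε ε' : ℝ}

theorem eventually_closedBall_subset {x : ℂ} {r : ℝ} {U : Set ℂ} (hr : 0 ≤ r) (hU : IsOpen U)
    (h : Metric.closedBall x r ⊆ U) : ∀ᶠ r' in 𝓝[>] r, Metric.closedBall x r' ⊆ U := by
  obtain ⟨δ, hδ, h1⟩ := (isCompact_closedBall x r).exists_cthickening_subset_open hU h
  rw [cthickening_closedBall hδ.le hr] at h1
  filter_upwards [Ioo_mem_nhdsGT (show r < r + δ by linarith)] with r' hr'
  exact (Metric.closedBall_subset_closedBall (by linarith [hr'.2])).trans h1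

theorem IsTubeRadius.exists_gt (hε : IsTubeRadius R ε) : ∃ ε' > ε, IsTubeRadius R ε' := by
  have hU : IsOpen (⋃ k, range (oval g k))ᶜ :=
    (isCompact_iUnion fun k => (ovalLoop g k).isCompact_range).isClosed.isOpen_compl
  have hz : ∀ᶠ r in 𝓝[>] ε, ∀ i : Fin g, Metric.closedBall (zPt g i.succ) r ⊆
      R.toHomeo ⁻¹' (⋃ k, range (oval g k))ᶜ := by
    refine eventually_all.2 fun i => eventually_closedBall_subset hε.pos.le
      (hU.preimage R.toHomeo.continuous) fun q hq h => ?_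
    obtain ⟨k, s, hs⟩ := mem_iUnion.1 h
    exact hε.disjoint_z i k s ⟨q, hq, hs.symm⟩
  have hw : ∀ᶠ r in 𝓝[>] ε, ∀ i : Fin g, Metric.closedBall (wPt g i.succ) r ⊆
      (⋃ k, range (oval g k))ᶜ := by
    refine eventually_all.2 fun i => eventually_closedBall_subset hε.pos.le hU fun q hq h => ?_
    obtain ⟨k, s, hs⟩ := mem_iUnion.1 h
    exact hε.disjoint_w i k s (hs ▸ hq)
  obtain ⟨r, hrz, hrw, hr⟩ := (hz.and (hw.and (Ioo_mem_nhdsGT hε.lt_half))).exists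
  refine ⟨r, hr.1, hε.pos.trans hr.1, hr.2, fun i k s => ?_, fun i k s h => ?_⟩
  · rintro ⟨q, hq, hqs⟩
    exact hrz i hq (mem_iUnion.2 ⟨k, s, hqs.symm⟩)
  · exact hrw i h (mem_iUnion.2 ⟨k, s, rfl⟩)

/-- A point of the arc `a_k` is determined by its distance from the end point `z_{k.succ}`. -/
theorem eq_of_dist_zPt_eq (k : Fin g) {ζ ξ : ℂ} (h1 : ‖ζ‖ = ‖ξ‖)
    (h2 : dist ζ (zPt g k.succ) = dist ξ (zPt g k.succ)) (h3 : 0 ≤ ζ.im) (h4 : 0 ≤ ξ.im) :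
    ζ = ξ := by
  have hr := rad_pos k.succ
  have e1 : Complex.normSq ζ = Complex.normSq ξ := by
    rw [Complex.normSq_eq_norm_sq, Complex.normSq_eq_norm_sq, h1]
  have e2 : Complex.normSq (ζ - zPt g k.succ) = Complex.normSq (ξ - zPt g k.succ) := by
    rw [Complex.normSq_eq_norm_sq, Complex.normSq_eq_norm_sq, ← dist_eq_norm, ← dist_eq_norm, h2]
  rw [Complex.normSq_apply, Complex.normSq_apply] at e1 e2
  simp only [zPt, Complex.sub_re, Complex.sub_im, Complex.neg_re, Complex.neg_im,
    Complex.ofReal_re, Complex.ofReal_im] at e2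
  have hre : ζ.re = ξ.re := by
    have : rad g k.succ * (ζ.re - ξ.re) = 0 := by linear_combination (e2 - e1) / 2
    rcases mul_eq_zero.1 this with h | h <;> linarith
  refine Complex.ext hre ?_
  rw [hre] at e1
  rcases mul_self_eq_mul_self_iff.1 (add_left_cancel e1) with h | h
  · exact h
  · linarith

/-- An annulus around `z_{k.succ}`, cut along the arc `a_k`. -/
def slitAnnulus (g : ℕ) (k : Fin g) (ε ε' : ℝ) : Set ℂ :=
  {ζ | ε ≤ dist ζ (zPt g k.succ) ∧ dist ζ (zPt g k.succ) < ε'} \ arc g k '' Icc 0 1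

theorem isPreconnected_slitAnnulus (k : Fin g) (hε : 0 < ε) (hε' : ε' ≤ 1 / 2) :
    IsPreconnected (slitAnnulus g k ε ε') := by
  have hr := rad_pos k.succ
  -- The arc meets the circle of radius `ρ` around its end point at the angle `θ ρ`.
  let θ : ℝ → ℝ := fun ρ => Real.pi / 2 - Real.arcsin (ρ / (2 * rad g k.succ))
  let Φ : ℝ × ℝ → ℂ := fun q =>
    zPt g k.succ + q.1 * Complex.exp ((θ q.1 + q.2 : ℝ) * Complex.I)
  have hΦ : Continuous Φ := by
    have : Continuous θ := continuous_const.sub (Real.continuous_arcsin.comp (by fun_prop))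
    simp only [Φ]; fun_prop
  have hdist : ∀ ρ φ : ℝ, 0 ≤ ρ → dist (Φ (ρ, φ)) (zPt g k.succ) = ρ := fun ρ φ h => by
    simp only [Φ]
    rw [dist_self_add_left, norm_mul, Complex.norm_exp_ofReal_mul_I, mul_one, Complex.norm_real,
      Real.norm_of_nonneg h]
  have harc : ∀ ρ, 0 ≤ ρ → ρ ≤ 1 / 2 → ‖Φ (ρ, 0)‖ = rad g k.succ ∧ 0 ≤ (Φ (ρ, 0)).im := by
    intro ρ h0 h1
    have h2 : ρ / (2 * rad g k.succ) ≤ 1 := by rw [div_le_one (by linarith)]; linarith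
    have h3 : 0 ≤ ρ / (2 * rad g k.succ) := by positivity
    have hc : Real.cos (θ ρ) = ρ / (2 * rad g k.succ) := by
      rw [Real.cos_pi_div_two_sub, Real.sin_arcsin (by linarith) h2]
    have hs : 0 ≤ Real.sin (θ ρ) := by
      rw [Real.sin_pi_div_two_sub]; exact Real.cos_arcsin_nonneg _
    have hre : (Φ (ρ, 0)).re = -rad g k.succ + ρ * Real.cos (θ ρ) := by
      simp only [Φ, zPt, add_zero]
      rw [Complex.add_re, Complex.re_ofReal_mul, Complex.exp_ofReal_mul_I_re, Complex.neg_re,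
        Complex.ofReal_re]
    have him : (Φ (ρ, 0)).im = ρ * Real.sin (θ ρ) := by
      simp only [Φ, zPt, add_zero]
      rw [Complex.add_im, Complex.im_ofReal_mul, Complex.exp_ofReal_mul_I_im, Complex.neg_im,
        Complex.ofReal_im, neg_zero, zero_add]
    refine ⟨?_, him ▸ mul_nonneg h0 hs⟩
    rw [Complex.norm_def, Real.sqrt_eq_iff_mul_self_eq (Complex.normSq_nonneg _) (by linarith),
      Complex.normSq_apply, hre, him]
    have h4 : 2 * rad g k.succ * Real.cos (θ ρ) = ρ := by
      rw [hc]; field_simp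
    have h5 := Real.sin_sq_add_cos_sq (θ ρ)
    linear_combination ρ ^ 2 * h5 - ρ * h4
  have himage : slitAnnulus g k ε ε' = Φ '' (Ico ε ε' ×ˢ Ioo 0 (2 * Real.pi)) := by
    ext ζ
    constructor
    · rintro ⟨⟨h1, h2⟩, h3⟩
      set ρ := dist ζ (zPt g k.succ) with hρ
      have hζ : ζ = zPt g k.succ + ρ * Complex.exp ((ζ - zPt g k.succ).arg * Complex.I) := by
        rw [hρ, dist_eq_norm, Complex.norm_mul_exp_arg_mul_I]; ring
      set φ := toIcoMod Real.two_pi_pos 0 ((ζ - zPt g k.succ).arg - θ ρ) with hφ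
      have hζ' : Φ (ρ, φ) = ζ := by
        have h4 := toIcoMod_add_toIcoDiv_zsmul Real.two_pi_pos 0 ((ζ - zPt g k.succ).arg - θ ρ)
        rw [← hφ] at h4
        conv_rhs => rw [hζ]
        simp only [Φ]
        congr 2
        rw [Complex.exp_eq_exp_iff_exists_int]
        refine ⟨-toIcoDiv Real.two_pi_pos 0 ((ζ - zPt g k.succ).arg - θ ρ), ?_⟩
        rw [zsmul_eq_mul] at h4
        have h5 : θ ρ + φ = (ζ - zPt g k.succ).arg -
            toIcoDiv Real.two_pi_pos 0 ((ζ - zPt g k.succ).arg - θ ρ) * (2 * Real.pi) := by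
          linarith
        rw [h5]; push_cast; ring
      have hφ' := toIcoMod_mem_Ico Real.two_pi_pos 0 ((ζ - zPt g k.succ).arg - θ ρ)
      rw [← hφ, zero_add] at hφ'
      refine ⟨(ρ, φ), ⟨⟨h1, h2⟩, lt_of_le_of_ne hφ'.1 fun h => h3 ?_, hφ'.2⟩, hζ'⟩
      have h : 0 = φ := h
      rw [mem_arc_image_iff, ← hζ', ← h]
      exact harc ρ (hε.le.trans h1) (by linarith)
    · rintro ⟨⟨ρ, φ⟩, ⟨hρ, hφ⟩, rfl⟩
      simp only at hρ hφ
      have hρ0 : 0 < ρ := hε.trans_le hρ.1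
      refine ⟨?_, fun h => ?_⟩
      · simp only [mem_ofPred_eq]
        rw [hdist _ _ hρ0.le]; exact hρ
      · rw [mem_arc_image_iff] at h
        obtain ⟨h1, h2⟩ := harc ρ hρ0.le (by linarith [hρ.2])
        have h3 := eq_of_dist_zPt_eq k (h.1.trans h1.symm)
          ((hdist _ _ hρ0.le).trans (hdist _ _ hρ0.le).symm) h.2 h2
        simp only [Φ] at h3
        have h4 := mul_left_cancel₀ (Complex.ofReal_ne_zero.2 hρ0.ne') (add_left_cancel h3)
        obtain ⟨n, hn⟩ := Complex.exp_eq_exp_iff_exists_int.1 h4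
        have h5 := congrArg Complex.im hn
        simp at h5
        have h6 : (0 : ℝ) < n := by
          by_contra h; nlinarith [hφ.1, Real.pi_pos]
        have h7 : (n : ℝ) < 1 := by
          by_contra h; nlinarith [hφ.2, Real.pi_pos]
        norm_cast at h6 h7
        omega
  rw [himage]
  exact (isPreconnected_Ico.prod isPreconnected_Ioo).image _ hΦ.continuousOn

/-- Near `z_i` only the arc `a_i` is present. -/
theorem toHomeo_mem_curveSet_iff_near (hε : IsTubeRadius R ε) {i : Fin g} {ζ : ℂ}
    (hζ : dist ζ (zPt g i.succ) ≤ ε) :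
    R.toHomeo ζ ∈ curveSet R ↔ ζ ∈ arc g i '' Icc 0 1 := by
  constructor
  · rintro (h | h)
    · obtain ⟨j, hj⟩ := mem_iUnion.1 h
      rw [R.toHomeo.injective.mem_set_image] at hj
      have h1 := ((mem_arc_image_iff j).1 hj).1
      have h2 := norm_sub_norm_le ζ (zPt g i.succ)
      have h3 := norm_sub_norm_le (zPt g i.succ) ζ
      rw [norm_sub_rev (zPt g i.succ)] at h3
      rw [dist_eq_norm] at hζ
      rw [norm_zPt, h1] at h2 h3
      have h4 := hε.lt_half
      obtain ⟨N, hN, hN'⟩ := rad_sub j.succ i.succ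
      have h5 : (N : ℝ) < 1 := by linarith
      have h6 : (-1 : ℝ) < N := by linarith
      norm_cast at h5 h6
      obtain rfl := Fin.succ_injective _ (hN'.1 (by omega))
      exact hj
    · obtain ⟨k, s, hs⟩ := mem_iUnion.1 h
      exact absurd ⟨ζ, hζ, hs.symm⟩ (hε.disjoint_z i k s)
  · exact fun h => Or.inl (mem_iUnion.2 ⟨i, ζ, h, rfl⟩)

/-- A domain has the same multiplicity on both sides of an arc near the tube, and at both ends of the
tube. Hence `∂D` does not run through the tubes. -/
theorem exists_tube_multiplicity (hε : IsTubeRadius R ε) (hε' : IsTubeRadius R ε') (hlt : ε < ε')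
    (D : Domain R ε) (i : Fin g) :
    ∃ M : ℤ, ∀ ζ ∈ slitAnnulus g i ε ε', D.planarMultiplicity (R.toHomeo ζ) = M ∧
      D.planarMultiplicity (-starRingEnd ℂ ζ) = M := by
  have hA := isPreconnected_slitAnnulus i hε.pos hε'.le_half
  have hmodel : ∀ ζ ∈ slitAnnulus g i ε ε', ζ ∉ modelDiscs g ε := fun ζ hζ =>
    notMem_modelDiscs_of_dist hε.le_half hζ.1.1 (hζ.1.2.le.trans hε'.le_half)
  have hK : ∀ ζ ∈ slitAnnulus g i ε ε', R.toHomeo ζ ∉ curveSet R := fun ζ hζ h =>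
    hζ.2 ((toHomeo_mem_curveSet_iff_near hε' hζ.1.2.le).1 h)
  have hfix : ∀ ζ ∈ slitAnnulus g i ε ε',
      R.toHomeo (-starRingEnd ℂ ζ) = -starRingEnd ℂ ζ := fun ζ hζ =>
    toHomeo_of_re_nonneg (re_neg_conj_pos (i := i.succ) (by
      linarith [hε'.lt_half, hζ.1.2])).le
  -- the point of the inner circle that is opposite to the arc
  let ζ₀ : ℂ := zPt g i.succ - ε
  have hd : dist ζ₀ (zPt g i.succ) = ε := by
    rw [dist_eq_norm, sub_sub_cancel_left, norm_neg, Complex.norm_real,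
      Real.norm_of_nonneg hε.pos.le]
  have hζ₀ : ζ₀ ∈ slitAnnulus g i ε ε' := by
    refine ⟨⟨hd.ge, hd.trans_lt hlt⟩, fun h => ?_⟩
    have h1 := ((mem_arc_image_iff i).1 h).1
    have h2 : ζ₀ = -((rad g i.succ + ε : ℝ) : ℂ) := by
      simp only [ζ₀, zPt]; push_cast; ring
    have h3 := rad_pos i.succ
    have h4 := hε.pos
    rw [h2, norm_neg, Complex.norm_real, Real.norm_of_nonneg (by linarith)] at h1
    linarith
  refine ⟨D.planarMultiplicity (R.toHomeo ζ₀), fun ζ hζ => ⟨?_, ?_⟩⟩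
  · refine planarMultiplicity_eq_of_isPreconnected hε D
      (hA.image R.toHomeo R.toHomeo.continuous.continuousOn) ?_ ?_
      (mem_image_of_mem _ hζ) (mem_image_of_mem _ hζ₀)
    · rintro _ ⟨ξ, hξ, rfl⟩
      exact fun h => hmodel ξ hξ ((toHomeo_mem_removedDiscs hε.le_one).1 h)
    · rintro _ ⟨ξ, hξ, rfl⟩
      exact hK ξ hξ
  · rw [planarMultiplicity_glue hε D hd]
    refine planarMultiplicity_eq_of_isPreconnected hε D
      (hA.image (fun ζ => -starRingEnd ℂ ζ) Complex.continuous_conj.neg.continuousOn) ?_ ?_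
      (mem_image_of_mem _ hζ) (mem_image_of_mem _ hζ₀)
    · rintro _ ⟨ξ, hξ, rfl⟩ h
      simp only at h
      rw [← hfix ξ hξ, toHomeo_mem_removedDiscs hε.le_one, neg_conj_mem_modelDiscs] at h
      exact hmodel ξ hξ h
    · rintro _ ⟨ξ, hξ, rfl⟩
      exact fun h => hK ξ hξ ((curveSet_glue hε' hξ.1.2.le).2 h)

end Tubes

/-! ### Locally constant functions off a countable set -/

/-- A relation between points of an interval and integers that has the same jumps as a function `κ`
holds for `κ` up to a constant, apart from isolated points. -/
theorem exists_eq_add_of_boundary {C : ℝ → ℤ → Prop} (huniq : ∀ s c c', C s c → C s c' → c = c')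
    {κ μ : ℝ → ℤ} {T : Set ℝ} (hT : IsPreconnected T)
    (hC : ∀ s ∈ T, IsBoundaryCoeff C s (μ s))
    (hκ : ∀ s ∈ T, IsBoundaryCoeff (fun r c => κ r = c) s (μ s)) :
    ∃ d : ℤ, ∀ s ∈ T, ∀ᶠ r in 𝓝[≠] s, C r (κ r + d) := by
  have h1 : ∀ s ∈ T, ∃ d : ℤ, ∀ᶠ r in 𝓝[≠] s, C r (κ r + d) := by
    intro s hs
    obtain ⟨c, c', hc, hc', h⟩ := hC s hs
    obtain ⟨e, e', he, he', h'⟩ := hκ s hs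
    refine ⟨c - e, ?_⟩
    rw [← nhdsLT_sup_nhdsGT, eventually_sup]
    constructor
    · filter_upwards [hc, he] with r h1 h2
      rw [h2, add_sub_cancel]; exact h1
    · filter_upwards [hc', he'] with r h1 h2
      rw [h2, show e' + (c - e) = c' by linarith]; exact h1
  choose! d hd using h1
  have hcont : ContinuousOn d T := by
    intro s hs
    have h2 : ∀ᶠ r in 𝓝[T] s, d r = d s := by
      have h3 := eventually_eventually_nhdsWithin.2 (hd s hs)
      rw [eventually_nhdsWithin_iff] at h3
      filter_upwards [h3.filter_mono nhdsWithin_le_nhds, self_mem_nhdsWithin] with r hr hrT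
      by_cases hrs : r = s
      · rw [hrs]
      · have h4 := hr hrs
        rw [nhdsWithin_eq_nhds.2 (isOpen_compl_singleton.mem_nhds hrs)] at h4
        obtain ⟨r', h5, h6⟩ := ((h4.filter_mono nhdsWithin_le_nhds).and (hd r hrT)).exists
        exact (add_left_cancel (huniq _ _ _ h5 h6)).symm
    exact tendsto_nhds_of_eventually_eq h2
  rcases T.eq_empty_or_nonempty with rfl | ⟨s₀, hs₀⟩
  · exact ⟨0, fun s hs => absurd hs (notMem_empty s)⟩
  · exact ⟨d s₀, fun s hs => hT.constant hcont hs₀ hs ▸ hd s hs⟩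

/-- A set of exceptions that are isolated from each other is countable. -/
theorem countable_of_eventually_notMem {B T : Set ℝ} (hBT : B ⊆ T)
    (h : ∀ s ∈ T, ∀ᶠ r in 𝓝[≠] s, r ∉ B) : B.Countable := by
  refine (countable_setOfPred_isolated_right_within (s := B)).mono fun s hs => ?_
  refine mem_ofPred_eq ▸ ⟨hs, ?_⟩
  rw [← empty_mem_iff_bot]
  have h1 : ∀ᶠ r in 𝓝[B ∩ Ioi s] s, r ∉ B :=
    (h s (hBT hs)).filter_mono (nhdsWithin_mono _ fun r hr => ne_of_gt hr.2)
  filter_upwards [h1, self_mem_nhdsWithin] with r h2 h3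
  exact h2 h3.1

/-- If a function on the plane is locally constant off a closed set `K` without interior, except near
the points of a countable set, then it is constant off `K`. The conclusion is stated for all points
near which the function takes its value at the point. -/
theorem exists_eq_of_eventually_const {F : ℂ → ℤ} {K E : Set ℂ} (hK : Dense Kᶜ)
    (hE : E.Countable) (h : ∀ p ∉ E, ∃ c, ∀ᶠ q in 𝓝[Kᶜ] p, F q = c) :
    ∃ c, ∀ p, (∀ᶠ q in 𝓝[Kᶜ] p, F q = F p) → F p = c := by
  have hne : ∀ p, (𝓝[Kᶜ] p).NeBot := fun p => mem_closure_iff_nhdsWithin_neBot.1 (hK p)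
  let G : Set ℂ := {p | ∃ c, ∀ᶠ q in 𝓝[Kᶜ] p, F q = c}
  have hG : IsPreconnected G := by
    have hr : 1 < Module.rank ℝ ℂ := by rw [Complex.rank_real_complex]; norm_num
    refine (hE.isConnected_compl_of_one_lt_rank hr).isPreconnected.subset_closure
      (fun p hp => h p hp) fun p _ => ?_
    exact hE.dense_compl ℝ p
  choose! c hc using fun p (hp : p ∈ G) => hp
  have hcont : ContinuousOn c G := by
    intro p hp
    have h1 : ∀ᶠ q in 𝓝 p, ∀ᶠ q' in 𝓝[Kᶜ] q, F q' = c p := by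
      have := hc p hp
      rw [eventually_nhdsWithin_iff] at this
      filter_upwards [eventually_eventually_nhds.2 this] with q hq
      exact eventually_nhdsWithin_iff.2 hq
    refine tendsto_nhds_of_eventually_eq ?_
    filter_upwards [h1.filter_mono nhdsWithin_le_nhds, self_mem_nhdsWithin] with q hq hqG
    have := hne q
    obtain ⟨q', h2, h3⟩ := (hq.and (hc q hqG)).exists
    exact h3.symm.trans h2
  have hp₀ : ∃ p₀, p₀ ∈ G := by
    obtain ⟨p₀, hp₀⟩ := (hE.dense_compl ℝ).nonempty
    exact ⟨p₀, h p₀ hp₀⟩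
  obtain ⟨p₀, hp₀⟩ := hp₀
  refine ⟨c p₀, fun p hp => ?_⟩
  have hpG : p ∈ G := ⟨_, hp⟩
  have := hne p
  obtain ⟨q, h2, h3⟩ := (hp.and (hc p hpG)).exists
  rw [hG.constant hcont hp₀ hpG, ← h2, h3]

namespace LoopCurve

variable (C : LoopCurve)

theorem eventually_ne (s : ℝ) (p : ℂ) : ∀ᶠ r in 𝓝[≠] s, C.γ r ≠ p := by
  by_cases h : C.γ s = p
  · have hT := C.T_pos
    have h1 : ∀ᶠ r in 𝓝[≠] s, r ∈ Ioo (s - C.T) (s + C.T) :=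
      nhdsWithin_le_nhds (Ioo_mem_nhds (by linarith) (by linarith))
    filter_upwards [h1, self_mem_nhdsWithin] with r hr hrs hrp
    obtain ⟨n, hn⟩ := (C.eq_iff s r).1 (h.trans hrp.symm)
    have h2 : (n : ℝ) * C.T < 1 * C.T := by linarith [hr.2]
    have h3 : (-1 : ℝ) * C.T < n * C.T := by linarith [hr.1]
    have h4 := lt_of_mul_lt_mul_right h2 hT.le
    have h5 := lt_of_mul_lt_mul_right h3 hT.le
    norm_cast at h4 h5
    obtain rfl : n = 0 := by omega
    exact hrs (by simpa using hn)
  · exact nhdsWithin_le_nhds (C.continuous.continuousAt.eventually_ne h)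

theorem eventually_notMem_finite (s : ℝ) {X : Set ℂ} (hX : X.Finite) :
    ∀ᶠ r in 𝓝[≠] s, C.γ r ∉ X := by
  have := (eventually_all_finite hX).2 fun p _ => C.eventually_ne s p
  filter_upwards [this] with r hr h
  exact hr _ h rfl

instance neBot_In (s : ℝ) : (𝓝[C.In] (C.γ s)).NeBot :=
  mem_closure_iff_nhdsWithin_neBot.1 (C.mem_closure_In s)

instance neBot_Out (s : ℝ) : (𝓝[C.Out] (C.γ s)).NeBot :=
  mem_closure_iff_nhdsWithin_neBot.1 (C.mem_closure_Out s)

theorem dense_compl_range : Dense (range C.γ)ᶜ := by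
  intro p
  by_cases h : p ∈ range C.γ
  · obtain ⟨s, rfl⟩ := h
    exact closure_mono (fun q hq => C.notMem_range_of_In hq) (C.mem_closure_In s)
  · exact subset_closure h

variable {C} in
theorem eventually_In_of_eq_add {s : ℝ} {f : ℂ → ℤ} {c κ : ℤ}
    (hf : ∀ᶠ q in 𝓝[(range C.γ)ᶜ] (C.γ s), f q = c + κ * C.ind q) :
    ∀ᶠ q in 𝓝[C.In] (C.γ s), f q = c + κ := by
  filter_upwards [hf.filter_mono (nhdsWithin_mono _ fun q hq => C.notMem_range_of_In hq),
    self_mem_nhdsWithin] with q hq hq'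
  rw [hq, C.ind_of_mem hq', mul_one]

variable {C} in
theorem eventually_Out_of_eq_add {s : ℝ} {f : ℂ → ℤ} {c κ : ℤ}
    (hf : ∀ᶠ q in 𝓝[(range C.γ)ᶜ] (C.γ s), f q = c + κ * C.ind q) :
    ∀ᶠ q in 𝓝[C.Out] (C.γ s), f q = c := by
  filter_upwards [hf.filter_mono (nhdsWithin_mono _ fun q hq => C.notMem_range_of_Out hq),
    self_mem_nhdsWithin] with q hq hq'
  rw [hq, C.ind_of_Out hq', mul_zero, add_zero]

variable {C} in
/-- Two functions with the same jump across the curve differ by a constant near the curve. -/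
theorem eventually_sub_eq_of_jump {s : ℝ} {f m : ℂ → ℤ} {c κ a b : ℤ}
    (hf : ∀ᶠ q in 𝓝[(range C.γ)ᶜ] (C.γ s), f q = c + κ * C.ind q)
    (ha : ∀ᶠ q in 𝓝[C.In] (C.γ s), m q = a) (hb : ∀ᶠ q in 𝓝[C.Out] (C.γ s), m q = b)
    (hab : a - b = κ) : ∀ᶠ q in 𝓝[(range C.γ)ᶜ] (C.γ s), m q - f q = b - c := by
  rw [eventually_nhdsWithin_iff] at ha hb
  filter_upwards [hf, ha.filter_mono nhdsWithin_le_nhds, hb.filter_mono nhdsWithin_le_nhds,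
    self_mem_nhdsWithin] with q h1 h2 h3 h4
  rcases C.cover q with h | h | h
  · rw [h1, h2 h, C.ind_of_mem h]; linarith
  · rw [h1, h3 h, C.ind_of_Out h]; linarith
  · exact absurd h h4

end LoopCurve

/-! ### The function of the plane defined by two intersection points -/

section CycleFun

variable {g : ℕ} {β : BraidGroup g} {R : BraidRep β}

variable (g) in
/-- The union of the ovals. -/
def ovalSet : Set ℂ := ⋃ k, range (oval g k)

variable (R) in
/-- The union of the arcs `a_i'`. -/
def arcSet : Set ℂ := ⋃ i, R.toHomeo '' (arc g i '' Icc 0 1)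

theorem isClosed_ovalSet : IsClosed (ovalSet g) :=
  (isCompact_iUnion fun k => (ovalLoop g k).isCompact_range).isClosed

theorem isClosed_arcSet : IsClosed (arcSet R) :=
  (isCompact_iUnion fun i => (isCompact_Icc.image (continuous_arc i)).image
    R.toHomeo.continuous).isClosed

theorem oval_mem_ovalSet (k : Fin g) (s : ℝ) : oval g k s ∈ ovalSet g :=
  mem_iUnion.2 ⟨k, s, rfl⟩

theorem arc_mem_arcSet (i : Fin g) {t : ℝ} (ht : t ∈ Icc (0 : ℝ) 1) :
    R.toHomeo (arc g i t) ∈ arcSet R :=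
  mem_iUnion.2 ⟨i, _, ⟨t, ht, rfl⟩, rfl⟩

theorem eq_of_oval_eq {k k' : Fin g} {s s' : ℝ} (h : oval g k s = oval g k' s') : k = k' := by
  have h1 := norm_ovalCoord k (Real.abs_cos_le_one s) (Real.sin s)
  have h2 := norm_ovalCoord k' (Real.abs_cos_le_one s') (Real.sin s')
  have h3 : ‖ovalCoord g k (Real.cos s) (Real.sin s)‖ =
      ‖ovalCoord g k' (Real.cos s') (Real.sin s')‖ := congrArg norm h
  rw [h1, h2] at h3
  have key : ∀ r, |Real.cos r / 4| ≤ 1 / 4 := fun r => by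
    rw [abs_div, abs_of_pos (by norm_num : (0 : ℝ) < 4)]
    linarith [Real.abs_cos_le_one r]
  exact Fin.succ_injective _ (rad_eq_of_near (key s) (key s') h3)

theorem eq_of_arc_eq {i j : Fin g} {t t' : ℝ} (h : arc g i t = arc g j t') : i = j := by
  have h1 := congrArg norm h
  rw [norm_arc, norm_arc] at h1
  exact Fin.succ_injective _
    (rad_eq_of_near (c := 0) (d := 0) (by norm_num) (by norm_num) (by simpa using h1))

open Classical in
theorem pointCoeff_oval (P : InterData R) (k : Fin g) (s : ℝ) :
    pointCoeff P.conf (oval g k s) = if oval g k s = oval g k (P.s k) then 1 else 0 := by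
  unfold pointCoeff
  refine if_congr ?_ rfl rfl
  constructor
  · rintro ⟨_, ⟨k', rfl⟩, h⟩
    obtain rfl := eq_of_oval_eq h
    exact h.symm
  · intro h
    exact ⟨_, ⟨k, rfl⟩, h.symm⟩

open Classical in
theorem pointCoeff_arc (P : InterData R) (i : Fin g) (t : ℝ) :
    pointCoeff P.conf (R.toHomeo (arc g i t)) =
      if R.toHomeo (arc g i t) = R.toHomeo (arc g i (P.arcParam i)) then 1 else 0 := by
  unfold pointCoeff
  refine if_congr ?_ rfl rfl
  constructor
  · rintro ⟨_, ⟨k, rfl⟩, h⟩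
    have h1 : R.toHomeo (arc g (P.perm k) (P.t k)) = R.toHomeo (arc g i t) := (P.eq k).trans h
    obtain rfl := eq_of_arc_eq (R.toHomeo.injective h1)
    rw [← h1, InterData.arcParam, Equiv.symm_apply_apply]
  · intro h
    rw [h, P.toHomeo_arcParam]
    exact ⟨_, ⟨_, rfl⟩, rfl⟩

theorem InterData.oval_mem_arcSet (P : InterData R) (k : Fin g) :
    oval g k (P.s k) ∈ arcSet R := by
  rw [← P.eq]
  exact arc_mem_arcSet _ (Ioo_subset_Icc_self (P.t_mem k))

theorem InterData.arc_mem_ovalSet (P : InterData R) (i : Fin g) :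
    R.toHomeo (arc g i (P.arcParam i)) ∈ ovalSet g := by
  rw [P.toHomeo_arcParam]
  exact oval_mem_ovalSet _ _

/-- The winding number of the cycle of two intersection points, plus a combination of the indicator
functions of the discs bounded by the ovals. -/
noncomputable def cycleFun (P Q : InterData R) (N : Fin g → ℤ) (p : ℂ) : ℤ :=
  (interCycle P Q).wnum p + ∑ k, N k * (ovalLoop g k).ind p

theorem eventually_cycleFun_eq (P Q : InterData R) (N : Fin g → ℤ) {p : ℂ}
    (h1 : p ∉ (interCycle P Q).support) (h2 : p ∉ ovalSet g) :
    ∀ᶠ q in 𝓝 p, cycleFun P Q N q = cycleFun P Q N p := by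
  have h3 : ∀ᶠ q in 𝓝 p, ∀ k, (ovalLoop g k).ind q = (ovalLoop g k).ind p :=
    eventually_all.2 fun k => (ovalLoop g k).eventually_ind_eq fun h => h2 (mem_iUnion.2 ⟨k, h⟩)
  filter_upwards [(interCycle P Q).eventually_wnum_eq h1, h3] with q hq hq'
  simp only [cycleFun, hq, hq']

theorem exists_cycleFun_eq_oval (P Q : InterData R) (N : Fin g → ℤ) (k : Fin g) {s : ℝ}
    (h : oval g k s ∉ arcSet R) :
    ∃ c : ℤ, ∀ᶠ q in 𝓝[(range (oval g k))ᶜ] (oval g k s), cycleFun P Q N q =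
      c + ((interCycle P Q).mult (Sum.inl k) s + N k) * (ovalLoop g k).ind q := by
  classical
  have hne : ∀ S : InterData R, ∀ n : ℤ, S.s k ≠ s + n * (2 * Real.pi) := fun S n hn => by
    rw [(oval_eq_iff k s (S.s k)).2 ⟨n, hn⟩] at h
    exact h (S.oval_mem_arcSet k)
  obtain ⟨c, hc⟩ := (interCycle P Q).exists_wnum_eq (Sum.inl k) (s := s) (hne P) (hne Q) (by
    rintro (k' | i) hi ⟨t, ht, hts⟩
    · exact hi (congrArg Sum.inl (eq_of_oval_eq hts))
    · refine h ?_
      have h1 : R.toHomeo (arc g i t) = oval g k s := hts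
      rw [← h1]
      exact arc_mem_arcSet i (Ioo_subset_Icc_self
        (uIcc_subset_Ioo_zero_one (Q.arcParam_mem i) (P.arcParam_mem i) ht)))
  have h3 : ∀ᶠ q in 𝓝 (oval g k s), ∀ k', k' ≠ k →
      (ovalLoop g k').ind q = (ovalLoop g k').ind (oval g k s) := by
    refine eventually_all.2 fun k' => ?_
    by_cases hk : k' = k
    · simp [hk]
    · filter_upwards [(ovalLoop g k').eventually_ind_eq (p := oval g k s)
        (by rintro ⟨s', hs'⟩; exact hk (eq_of_oval_eq hs'))] with q hq _
      exact hq
  refine ⟨c + ∑ k' ∈ Finset.univ.erase k, N k' * (ovalLoop g k').ind (oval g k s), ?_⟩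
  have hc' : ∀ᶠ q in 𝓝[(range (oval g k))ᶜ] (oval g k s), (interCycle P Q).wnum q =
    c + (interCycle P Q).mult (Sum.inl k) s * (ovalLoop g k).ind q := hc
  filter_upwards [hc', h3.filter_mono nhdsWithin_le_nhds] with q h4 h5
  rw [cycleFun, h4, ← Finset.add_sum_erase _ _ (Finset.mem_univ k),
    Finset.sum_congr rfl fun k' hk' => by rw [h5 k' (Finset.ne_of_mem_erase hk')]]
  ring

theorem exists_cycleFun_eq_arc (P Q : InterData R) (N : Fin g → ℤ) (i : Fin g) {t : ℝ}
    (h : R.toHomeo (arc g i t) ∉ ovalSet g) :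
    ∃ c : ℤ, ∀ᶠ q in 𝓝[(range (arcLoop R i).γ)ᶜ] (R.toHomeo (arc g i t)), cycleFun P Q N q =
      c + (interCycle P Q).mult (Sum.inr i) t * (arcLoop R i).ind q := by
  have hne : ∀ S : InterData R, ∀ n : ℤ, S.arcParam i ≠ t + n * 2 := fun S n hn => by
    rw [(arc_eq_iff i t (S.arcParam i)).2 ⟨n, hn⟩] at h
    exact h (S.arc_mem_ovalSet i)
  obtain ⟨c, hc⟩ := (interCycle P Q).exists_wnum_eq (Sum.inr i) (s := t) (hne P) (hne Q) (by
    rintro (k | j) hj ⟨t', ht', hts⟩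
    · refine h ?_
      have h1 : oval g k t' = R.toHomeo (arc g i t) := hts
      rw [← h1]
      exact oval_mem_ovalSet k t'
    · exact hj (congrArg Sum.inr (eq_of_arc_eq (R.toHomeo.injective hts))))
  have h3 : ∀ᶠ q in 𝓝 (R.toHomeo (arc g i t)), ∀ k,
      (ovalLoop g k).ind q = (ovalLoop g k).ind (R.toHomeo (arc g i t)) :=
    eventually_all.2 fun k => (ovalLoop g k).eventually_ind_eq fun h' =>
      h (mem_iUnion.2 ⟨k, h'⟩)
  refine ⟨c + ∑ k, N k * (ovalLoop g k).ind (R.toHomeo (arc g i t)), ?_⟩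
  have hc' : ∀ᶠ q in 𝓝[(range (arcLoop R i).γ)ᶜ] (R.toHomeo (arc g i t)),
    (interCycle P Q).wnum q =
    c + (interCycle P Q).mult (Sum.inr i) t * (arcLoop R i).ind q := hc
  filter_upwards [hc', h3.filter_mono nhdsWithin_le_nhds] with q h4 h5
  rw [cycleFun, h4, Finset.sum_congr rfl fun k _ => by rw [h5 k]]
  ring

/-- The jumps of the multiplicities of the cycle along an oval. -/
theorem mult_oval_boundary (P Q : InterData R) (k : Fin g) (s : ℝ) :
    ∃ c c' : ℤ, (∀ᶠ r in 𝓝[<] s, (interCycle P Q).mult (Sum.inl k) r = c) ∧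
      (∀ᶠ r in 𝓝[>] s, (interCycle P Q).mult (Sum.inl k) r = c') ∧
      c - c' = pointCoeff P.conf (oval g k s) - pointCoeff Q.conf (oval g k s) := by
  rw [pointCoeff_oval, pointCoeff_oval]
  exact (interCycle P Q).mult_jump (Sum.inl k) s

/-- The jumps of the multiplicities of the cycle along an arc. -/
theorem mult_arc_boundary (P Q : InterData R) (i : Fin g) (t : ℝ) :
    ∃ c c' : ℤ, (∀ᶠ r in 𝓝[<] t, (interCycle P Q).mult (Sum.inr i) r = c) ∧
      (∀ᶠ r in 𝓝[>] t, (interCycle P Q).mult (Sum.inr i) r = c') ∧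
      c - c' = pointCoeff P.conf (R.toHomeo (arc g i t)) -
        pointCoeff Q.conf (R.toHomeo (arc g i t)) := by
  rw [pointCoeff_arc, pointCoeff_arc]
  exact (interCycle P Q).mult_jump (Sum.inr i) t

end CycleFun

/-! ### The position of the arcs, the ovals and the tubes -/

section Position

variable {g : ℕ} {β : BraidGroup g} {R : BraidRep β} {ε : ℝ}

theorem arc_zero (k : Fin g) : arc g k 0 = zPt g k.succ := by
  simp [arc, zPt, Complex.exp_pi_mul_I]

theorem arc_one (k : Fin g) : arc g k 1 = wPt g k.succ := by
  simp [arc, wPt]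

theorem toHomeo_wPt (j : Fin (g + 1)) : R.toHomeo (wPt g j) = wPt g j := by
  refine toHomeo_of_re_nonneg ?_
  have := rad_pos j
  rw [wPt, Complex.ofReal_re]; linarith

theorem notMem_ovalSet_of_notMem {p : ℂ} (h : p ∉ puncturedDisc g) : p ∉ ovalSet g := fun h' => by
  obtain ⟨k, s, rfl⟩ := mem_iUnion.1 h'
  exact h (oval_mem k s)

theorem toHomeo_zPt_notMem_ovalSet (j : Fin (g + 1)) : R.toHomeo (zPt g j) ∉ ovalSet g := by
  obtain ⟨π, hπ⟩ := exists_perm R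
  rw [hπ]
  exact notMem_ovalSet_of_notMem (zPt_notMem g _)

theorem finite_arcSet_inter_ovalSet
    (hfin : ∀ i k : Fin g, {t : ℝ | t ∈ Ioo (0 : ℝ) 1 ∧
      R.toHomeo (arc g i t) ∈ range (oval g k)}.Finite) : (arcSet R ∩ ovalSet g).Finite := by
  refine (finite_iUnion fun i : Fin g => finite_iUnion fun k : Fin g =>
    (hfin i k).image fun t => R.toHomeo (arc g i t)).subset ?_
  rintro q ⟨hq, hq'⟩
  obtain ⟨i, _, ⟨t, ht, rfl⟩, rfl⟩ := mem_iUnion.1 hq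
  obtain ⟨k, hk⟩ := mem_iUnion.1 hq'
  refine mem_iUnion.2 ⟨i, mem_iUnion.2 ⟨k, t, ⟨⟨?_, ?_⟩, hk⟩, rfl⟩⟩
  · refine lt_of_le_of_ne ht.1 ?_
    rintro rfl
    rw [arc_zero] at hq'
    exact toHomeo_zPt_notMem_ovalSet _ hq'
  · refine lt_of_le_of_ne ht.2 ?_
    rintro rfl
    rw [arc_one, toHomeo_wPt] at hq'
    exact notMem_ovalSet_of_notMem (wPt_notMem g _) hq'

theorem eventually_oval_notMem_arcSet (hX : (arcSet R ∩ ovalSet g).Finite) (k : Fin g) (s : ℝ) :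
    ∀ᶠ r in 𝓝[≠] s, oval g k r ∉ arcSet R := by
  filter_upwards [(ovalLoop g k).eventually_notMem_finite s hX] with r hr h
  exact hr ⟨h, oval_mem_ovalSet k r⟩

theorem eventually_arc_notMem_ovalSet (hX : (arcSet R ∩ ovalSet g).Finite) (i : Fin g) {t : ℝ}
    (ht : t ∈ Ioo (0 : ℝ) 1) : ∀ᶠ r in 𝓝[≠] t, R.toHomeo (arc g i r) ∉ ovalSet g := by
  filter_upwards [(arcLoop R i).eventually_notMem_finite t hX,
    nhdsWithin_le_nhds (Ioo_mem_nhds ht.1 ht.2)] with r hr h1 h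
  exact hr ⟨arc_mem_arcSet i (Ioo_subset_Icc_self h1), h⟩

theorem dense_compl_curveSet : Dense (curveSet R)ᶜ := by
  have h1 : Dense (⋂ i, (range (arcLoop R i).γ)ᶜ) := dense_iInter_of_isOpen
    (fun i => (arcLoop R i).isCompact_range.isClosed.isOpen_compl)
    fun i => (arcLoop R i).dense_compl_range
  have h2 : Dense (⋂ k, (range (ovalLoop g k).γ)ᶜ) := dense_iInter_of_isOpen
    (fun k => (ovalLoop g k).isCompact_range.isClosed.isOpen_compl)
    fun k => (ovalLoop g k).dense_compl_range
  have h3 : IsOpen (⋂ i, (range (arcLoop R i).γ)ᶜ) := isOpen_iInter_of_finite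
    fun i => (arcLoop R i).isCompact_range.isClosed.isOpen_compl
  refine (h1.inter_of_isOpen_left h2 h3).mono ?_
  rintro p ⟨hp1, hp2⟩ (hp | hp)
  · obtain ⟨i, _, ⟨t, -, rfl⟩, rfl⟩ := mem_iUnion.1 hp
    exact mem_iInter.1 hp1 i ⟨t, rfl⟩
  · obtain ⟨k, s, rfl⟩ := mem_iUnion.1 hp
    exact mem_iInter.1 hp2 k ⟨s, rfl⟩

theorem nhdsWithin_compl_curveSet_le_oval (k : Fin g) (s : ℝ) :
    𝓝[(curveSet R)ᶜ] (oval g k s) ≤ 𝓝[(range (oval g k))ᶜ] (oval g k s) :=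
  nhdsWithin_mono _ (compl_subset_compl.2 (by rintro _ ⟨r, rfl⟩; exact oval_mem_curveSet k r))

/-- Near a point that lies on no arc, the only curve is the oval. -/
theorem nhdsWithin_compl_oval_le {k : Fin g} {s : ℝ} (h : oval g k s ∉ arcSet R) :
    𝓝[(range (oval g k))ᶜ] (oval g k s) ≤ 𝓝[(curveSet R)ᶜ] (oval g k s) := by
  have h1 : ∀ᶠ q in 𝓝 (oval g k s), ∀ k', k' ≠ k → q ∉ range (oval g k') := by
    refine eventually_all.2 fun k' => ?_
    by_cases hk : k' = k
    · simp [hk]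
    · filter_upwards [(ovalLoop g k').isCompact_range.isClosed.isOpen_compl.eventually_mem
        (x := oval g k s) (by rintro ⟨s', hs'⟩; exact hk (eq_of_oval_eq hs'))] with q hq _
      exact hq
  refine le_inf nhdsWithin_le_nhds (le_principal_iff.2 ?_)
  filter_upwards [h1.filter_mono nhdsWithin_le_nhds, self_mem_nhdsWithin,
    nhdsWithin_le_nhds (isClosed_arcSet.isOpen_compl.mem_nhds h)] with q h2 h3 h4
  rintro (h5 | h5)
  · exact h4 h5
  · obtain ⟨k', h6⟩ := mem_iUnion.1 h5
    by_cases hk : k' = k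
    · exact h3 (hk ▸ h6)
    · exact h2 k' hk h6

/-- Near an interior point of an arc, the lower half of the circle is absent. -/
theorem nhdsWithin_compl_curveSet_le_arc (i : Fin g) {t : ℝ} (ht : t ∈ Ioo (0 : ℝ) 1) :
    𝓝[(curveSet R)ᶜ] (R.toHomeo (arc g i t)) ≤
      𝓝[(range (arcLoop R i).γ)ᶜ] (R.toHomeo (arc g i t)) := by
  have h1 : ∀ᶠ q in 𝓝 (R.toHomeo (arc g i t)), 0 < (R.toHomeo.symm q).im := by
    refine (Complex.continuous_im.comp R.toHomeo.symm.continuous).continuousAt.eventually_const_lt ?_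
    simpa using im_arc_pos i ht
  refine le_inf nhdsWithin_le_nhds (le_principal_iff.2 ?_)
  filter_upwards [h1.filter_mono nhdsWithin_le_nhds, self_mem_nhdsWithin] with q h2 h3
  rintro ⟨r, rfl⟩
  change 0 < (R.toHomeo.symm (R.toHomeo (arc g i r))).im at h2
  rw [Homeomorph.symm_apply_apply] at h2
  exact h3 (Or.inl (mem_iUnion.2 ⟨i, _, (mem_arc_image_iff i).2 ⟨norm_arc i r, h2.le⟩, rfl⟩))

/-- Near a point that lies on no oval, the only curve is the arc. -/
theorem nhdsWithin_compl_arc_le {i : Fin g} {t : ℝ} (h : R.toHomeo (arc g i t) ∉ ovalSet g) :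
    𝓝[(range (arcLoop R i).γ)ᶜ] (R.toHomeo (arc g i t)) ≤
      𝓝[(curveSet R)ᶜ] (R.toHomeo (arc g i t)) := by
  have h1 : ∀ᶠ q in 𝓝 (R.toHomeo (arc g i t)), ∀ j, j ≠ i → q ∉ range (arcLoop R j).γ := by
    refine eventually_all.2 fun j => ?_
    by_cases hj : j = i
    · simp [hj]
    · filter_upwards [(arcLoop R j).isCompact_range.isClosed.isOpen_compl.eventually_mem
        (x := R.toHomeo (arc g i t))
        (by rintro ⟨s', hs'⟩; exact hj (eq_of_arc_eq (R.toHomeo.injective hs')))] with q hq _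
      exact hq
  refine le_inf nhdsWithin_le_nhds (le_principal_iff.2 ?_)
  filter_upwards [h1.filter_mono nhdsWithin_le_nhds, self_mem_nhdsWithin,
    nhdsWithin_le_nhds (isClosed_ovalSet.isOpen_compl.mem_nhds h)] with q h2 h3 h4
  rintro (h5 | h5)
  · obtain ⟨j, _, ⟨r, -, rfl⟩, h6⟩ := mem_iUnion.1 h5
    by_cases hj : j = i
    · subst hj; exact h3 ⟨r, h6⟩
    · exact h2 j hj ⟨r, h6⟩
  · exact h4 h5

theorem dist_arc_zPt_sq (k : Fin g) (t : ℝ) :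
    dist (arc g k t) (zPt g k.succ) ^ 2 = 2 * rad g k.succ ^ 2 * (1 - Real.cos (Real.pi * t)) := by
  have hre : (arc g k t).re = rad g k.succ * -Real.cos (Real.pi * t) := by
    rw [arc, Complex.re_ofReal_mul, Complex.exp_ofReal_mul_I_re, ← Real.cos_pi_sub]
    ring_nf
  have him : (arc g k t).im = rad g k.succ * Real.sin (Real.pi * t) := by
    rw [im_arc, ← Real.sin_pi_sub]
    ring_nf
  rw [dist_eq_norm, ← Complex.normSq_eq_norm_sq, Complex.normSq_apply, Complex.sub_re,
    Complex.sub_im, hre, him]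
  simp only [zPt, Complex.neg_re, Complex.neg_im, Complex.ofReal_re, Complex.ofReal_im]
  linear_combination rad g k.succ ^ 2 * Real.sin_sq_add_cos_sq (Real.pi * t)

theorem neg_conj_arc (k : Fin g) (t : ℝ) : -starRingEnd ℂ (arc g k t) = arc g k (1 - t) := by
  have h : ((Real.pi * (1 - (1 - t)) : ℝ) : ℂ) * Complex.I =
      Real.pi * Complex.I + starRingEnd ℂ (((Real.pi * (1 - t) : ℝ) : ℂ) * Complex.I) := by
    rw [map_mul, Complex.conj_I, Complex.conj_ofReal]; push_cast; ring
  rw [arc, arc, h, Complex.exp_add, Complex.exp_pi_mul_I, Complex.exp_conj, map_mul,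
    Complex.conj_ofReal]
  ring

theorem dist_arc_wPt (k : Fin g) (t : ℝ) :
    dist (arc g k t) (wPt g k.succ) = dist (arc g k (1 - t)) (zPt g k.succ) := by
  rw [← dist_neg_conj, neg_conj_arc, sub_sub_cancel]

theorem strictMonoOn_dist_arc_zPt (k : Fin g) :
    StrictMonoOn (fun t => dist (arc g k t) (zPt g k.succ)) (Icc 0 1) := by
  intro s hs t ht hst
  have hr := rad_pos k.succ
  refine lt_of_pow_lt_pow_left₀ 2 dist_nonneg ?_
  rw [dist_arc_zPt_sq, dist_arc_zPt_sq]
  have hπ := Real.pi_pos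
  have := Real.strictAntiOn_cos (a := Real.pi * s) ⟨mul_nonneg hπ.le hs.1, by nlinarith [hs.2]⟩
    (b := Real.pi * t) ⟨mul_nonneg hπ.le ht.1, by nlinarith [ht.2]⟩ (by nlinarith)
  have h2 : 0 < rad g k.succ ^ 2 := by positivity
  nlinarith

/-- The parameters of the part of an arc outside the tubes. -/
def coreParams (g : ℕ) (i : Fin g) (ε : ℝ) : Set ℝ :=
  {t | t ∈ Ioo (0 : ℝ) 1 ∧ ε < dist (arc g i t) (zPt g i.succ) ∧
    ε < dist (arc g i t) (wPt g i.succ)}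

theorem ordConnected_coreParams (i : Fin g) : (coreParams g i ε).OrdConnected := by
  refine ⟨fun s hs t ht r hr => ?_⟩
  have h1 : r ∈ Ioo (0 : ℝ) 1 := ⟨hs.1.1.trans_le hr.1, hr.2.trans_lt ht.1.2⟩
  refine ⟨h1, hs.2.1.trans_le ?_, ht.2.2.trans_le ?_⟩
  · exact (strictMonoOn_dist_arc_zPt i).monotoneOn (Ioo_subset_Icc_self hs.1)
      (Ioo_subset_Icc_self h1) hr.1
  · rw [dist_arc_wPt, dist_arc_wPt]
    exact (strictMonoOn_dist_arc_zPt i).monotoneOn ⟨by linarith [ht.1.2], by linarith [ht.1.1]⟩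
      ⟨by linarith [h1.2], by linarith [h1.1]⟩ (by linarith [hr.2])

theorem arcParam_mem_coreParams (hε : IsTubeRadius R ε) (P : InterData R) (i : Fin g) :
    P.arcParam i ∈ coreParams g i ε := by
  have h := P.toHomeo_arcParam i
  refine ⟨P.arcParam_mem i, not_le.1 fun h' => ?_, not_le.1 fun h' => ?_⟩
  · exact hε.disjoint_z i _ _ ⟨_, h', h⟩
  · rw [toHomeo_of_re_nonneg (re_pos_of_dist_wPt (h'.trans_lt
      (hε.lt_half.trans (by norm_num)))).le] at h
    exact hε.disjoint_w i (P.perm.symm i) (P.s (P.perm.symm i)) (h ▸ h')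

theorem eq_of_near {i j : Fin (g + 1)} {ζ : ℂ}
    (h1 : dist ζ (zPt g i) < 1 / 2 ∨ dist ζ (wPt g i) < 1 / 2)
    (h2 : dist ζ (zPt g j) < 1 / 2 ∨ dist ζ (wPt g j) < 1 / 2) : i = j := by
  have key : ∀ {i : Fin (g + 1)}, (dist ζ (zPt g i) < 1 / 2 ∨ dist ζ (wPt g i) < 1 / 2) →
      |‖ζ‖ - rad g i| < 1 / 2 := by
    rintro i (h | h)
    · rw [← norm_zPt i]; exact (abs_norm_sub_norm_le _ _).trans_lt (dist_eq_norm ζ _ ▸ h)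
    · rw [← norm_wPt i]; exact (abs_norm_sub_norm_le _ _).trans_lt (dist_eq_norm ζ _ ▸ h)
  obtain ⟨N, hN, hN'⟩ := rad_sub i j
  have h3 := abs_lt.1 (key h1)
  have h4 := abs_lt.1 (key h2)
  have h5 : (N : ℝ) < 1 := by linarith
  have h6 : (-1 : ℝ) < N := by linarith
  norm_cast at h5 h6
  exact hN'.1 (by omega)

/-- The point `ζ` is at distance less than `ε` from one of the end points of the arc `a_i`. -/
def NearTube (g : ℕ) (i : Fin g) (ε : ℝ) (ζ : ℂ) : Prop :=
  dist ζ (zPt g i.succ) < ε ∨ dist ζ (wPt g i.succ) < ε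

theorem notMem_support_of_dist (hε : IsTubeRadius R ε) (P Q : InterData R) {i : Fin g} {ζ : ℂ}
    (h : dist ζ (zPt g i.succ) ≤ ε ∨ dist ζ (wPt g i.succ) ≤ ε) :
    R.toHomeo ζ ∉ (interCycle P Q).support ∧ R.toHomeo ζ ∉ ovalSet g := by
  have hoval : ∀ k s, oval g k s ≠ R.toHomeo ζ := by
    rintro k s hs
    rcases h with h | h
    · exact hε.disjoint_z i k s ⟨ζ, h, hs.symm⟩
    · rw [toHomeo_of_re_nonneg (re_pos_of_dist_wPt (h.trans_lt
        (hε.lt_half.trans (by norm_num)))).le] at hs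
      exact hε.disjoint_w i k s (hs ▸ h)
  refine ⟨fun hs => ?_, fun hs => ?_⟩
  · obtain ⟨j, hj⟩ := mem_iUnion.1 hs
    rcases j with k | j
    · obtain ⟨s, -, hs⟩ := hj
      exact hoval k s hs
    · obtain ⟨t, ht, hts⟩ := hj
      have hζ : arc g j t = ζ := R.toHomeo.injective hts
      have htc : t ∈ coreParams g j ε := (ordConnected_coreParams j).uIcc_subset
        (arcParam_mem_coreParams hε Q j) (arcParam_mem_coreParams hε P j) ht
      have hn := norm_arc j t
      rw [hζ] at hn
      have hij : i = j := by
        have key : |‖ζ‖ - rad g i.succ| ≤ ε := by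
          rcases h with h | h
          · rw [← norm_zPt i.succ]; exact (abs_norm_sub_norm_le _ _).trans (dist_eq_norm ζ _ ▸ h)
          · rw [← norm_wPt i.succ]; exact (abs_norm_sub_norm_le _ _).trans (dist_eq_norm ζ _ ▸ h)
        obtain ⟨N, hN, hN'⟩ := rad_sub j.succ i.succ
        rw [hn, hN] at key
        have h3 := abs_le.1 key
        have h4 := hε.lt_half
        have h5 : (N : ℝ) < 1 := by linarith
        have h6 : (-1 : ℝ) < N := by linarith
        norm_cast at h5 h6
        exact (Fin.succ_injective _ (hN'.1 (by omega))).symm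
      subst hij
      rw [coreParams, mem_ofPred_eq, hζ] at htc
      rcases h with h | h
      · exact htc.2.1.not_ge h
      · exact htc.2.2.not_ge h
  · obtain ⟨k, s, hs⟩ := mem_iUnion.1 hs
    exact hoval k s hs

theorem mult_arc_eq_zero (P Q : InterData R) {i : Fin g} {r : ℝ} (h0 : 0 < r)
    (hP : r < P.arcParam i) (hQ : r < Q.arcParam i) :
    (interCycle P Q).mult (Sum.inr i) r = 0 := by
  have key : ∀ S : InterData R, r < S.arcParam i → ⌈(S.arcParam i - r) / 2⌉ = 1 := fun S hS => by
    rw [Int.ceil_eq_iff]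
    have := (S.arcParam_mem i).2
    constructor <;> push_cast <;> linarith
  change ⌈(P.arcParam i - r) / 2⌉ - ⌈(Q.arcParam i - r) / 2⌉ = 0
  rw [key P hP, key Q hQ, sub_self]

theorem notMem_ovalInside_of_norm {j : Fin (g + 1)} {k : Fin g} (h : j ≠ k.succ) {p : ℂ}
    (hp : ‖p‖ = rad g j) : p ∉ ovalInside g k := by
  rintro ⟨u, v, huv, rfl⟩
  have hu := (abs_le_one_of_sq_add_sq_le huv.le).1
  rw [norm_ovalCoord k hu] at hp
  refine h (rad_eq_of_near (c := 0) (d := u / 4) (by norm_num) ?_ (by linarith))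
  rw [abs_div, abs_of_pos (by norm_num : (0 : ℝ) < 4)]
  linarith

theorem wPt_mem_ovalInside (k : Fin g) : wPt g k.succ ∈ ovalInside g k := by
  refine ⟨0, 2 / 3, by norm_num, ?_⟩
  have : -(Real.pi / 2) + 3 * Real.pi / 4 * (2 / 3) = 0 := by ring
  simp [ovalCoord, wPt, this]

theorem zPt_mem_ovalInside (k : Fin g) : zPt g k.succ ∈ ovalInside g k := by
  refine ⟨0, -(2 / 3), by norm_num, ?_⟩
  have : -(Real.pi / 2) + 3 * Real.pi / 4 * -(2 / 3) = -Real.pi := by ring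
  rw [ovalCoord, this]
  simp [zPt, Complex.exp_neg, Complex.exp_pi_mul_I]

theorem ind_zPt (k : Fin g) (j : Fin (g + 1)) :
    (ovalLoop g k).ind (zPt g j) = if j = k.succ then 1 else 0 := by
  split_ifs with h
  · rw [h]; exact (ovalLoop g k).ind_of_mem (zPt_mem_ovalInside k)
  · exact (ovalLoop g k).ind_of_notMem (notMem_ovalInside_of_norm h (norm_zPt j))

theorem ind_wPt (k : Fin g) (j : Fin (g + 1)) :
    (ovalLoop g k).ind (wPt g j) = if j = k.succ then 1 else 0 := by
  split_ifs with h
  · rw [h]; exact (ovalLoop g k).ind_of_mem (wPt_mem_ovalInside k)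
  · exact (ovalLoop g k).ind_of_notMem (notMem_ovalInside_of_norm h (norm_wPt j))

end Position

/-! ### The multiplicities of a domain that connects two intersection points -/

section Connecting

variable {g : ℕ} {β : BraidGroup g} {R : BraidRep β} {ε ε' : ℝ}

theorem isBetaCoeff_unique {D : Domain R ε} {k : Fin g} {s : ℝ} {c c' : ℤ}
    (h : D.IsBetaCoeff k s c) (h' : D.IsBetaCoeff k s c') : c = c' := by
  obtain ⟨l, r, hl, hr, rfl⟩ := h
  obtain ⟨l', r', hl', hr', rfl⟩ := h'
  have h1 : (𝓝[ovalOutside g k] (oval g k s)).NeBot := (ovalLoop g k).neBot_Out s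
  have h2 : (𝓝[ovalInside g k] (oval g k s)).NeBot := (ovalLoop g k).neBot_In s
  obtain ⟨q, hq, hq'⟩ := (hl.and hl').exists
  obtain ⟨p, hp, hp'⟩ := (hr.and hr').exists
  rw [← hq, ← hp, hq', hp']

theorem isAlphaCoeff_unique {D : Domain R ε} {i : Fin g} {t : ℝ} {c c' : ℤ}
    (h : D.IsAlphaCoeff i t c) (h' : D.IsAlphaCoeff i t c') : c = c' := by
  obtain ⟨l, r, hl, hr, rfl⟩ := h
  obtain ⟨l', r', hl', hr', rfl⟩ := h'
  have h1 : (𝓝[R.toHomeo '' {q | rad g i.succ < ‖q‖}] (R.toHomeo (arc g i t))).NeBot :=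
    (arcLoop R i).neBot_Out t
  have h2 : (𝓝[R.toHomeo '' {q | ‖q‖ < rad g i.succ}] (R.toHomeo (arc g i t))).NeBot :=
    (arcLoop R i).neBot_In t
  obtain ⟨q, hq, hq'⟩ := (hr.and hr').exists
  obtain ⟨p, hp, hp'⟩ := (hl.and hl').exists
  rw [← hq, ← hp, hq', hp']

/-- The multiplicity of a domain is locally constant outside the curves and the removed discs. -/
theorem eventually_planarMultiplicity_eq (hε : IsTubeRadius R ε) (D : Domain R ε) {p : ℂ}
    (h1 : ∀ᶠ q in 𝓝 p, q ∉ removedDiscs R ε) (h2 : p ∉ curveSet R) :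
    ∀ᶠ q in 𝓝 p, D.planarMultiplicity q = D.planarMultiplicity p := by
  obtain ⟨δ, hδ, hball⟩ := Metric.eventually_nhds_iff_ball.1
    (h1.and (isCompact_curveSet.isClosed.isOpen_compl.eventually_mem h2))
  filter_upwards [Metric.ball_mem_nhds p hδ] with q hq
  exact planarMultiplicity_eq_of_isPreconnected hε D (convex_ball p δ).isPreconnected
    (fun q hq => (hball q hq).1) (fun q hq => (hball q hq).2) hq (Metric.mem_ball_self hδ)

theorem eventually_notMem_removedDiscs (hε : ε ≤ 1) (hlt : ε < ε') {ζ : ℂ}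
    (h : ∀ i, ¬ NearTube g i ε' ζ) : ∀ᶠ q in 𝓝 (R.toHomeo ζ), q ∉ removedDiscs R ε := by
  have h1 : ∀ᶠ ξ in 𝓝 ζ, ξ ∉ modelDiscs g ε := by
    have hc : IsClosed (⋃ i : Fin g,
        Metric.closedBall (zPt g i.succ) ε ∪ Metric.closedBall (wPt g i.succ) ε) :=
      isClosed_iUnion_of_finite fun i => Metric.isClosed_closedBall.union Metric.isClosed_closedBall
    have h2 : ζ ∉ ⋃ i : Fin g,
        Metric.closedBall (zPt g i.succ) ε ∪ Metric.closedBall (wPt g i.succ) ε := by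
      intro hζ
      obtain ⟨i, hi⟩ := mem_iUnion.1 hζ
      exact h i (hi.imp (fun h => lt_of_le_of_lt h hlt) fun h => lt_of_le_of_lt h hlt)
    filter_upwards [hc.isOpen_compl.eventually_mem h2] with ξ hξ hξ'
    exact hξ (iUnion_mono (fun i => union_subset_union Metric.ball_subset_closedBall
      Metric.ball_subset_closedBall) hξ')
  have h3 := (R.toHomeo.symm.continuous.tendsto (R.toHomeo ζ)).eventually
    (p := fun ξ => ξ ∉ modelDiscs g ε) (by rwa [Homeomorph.symm_apply_apply])
  filter_upwards [h3] with q hq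
  rw [← R.toHomeo.apply_symm_apply q, toHomeo_mem_removedDiscs hε]
  exact hq

theorem dist_neg_conj_zPt_lt {i : Fin g} {ζ : ℂ} (h : dist ζ (wPt g i.succ) < ε) :
    dist (-starRingEnd ℂ ζ) (zPt g i.succ) < ε := by
  rw [← dist_neg_conj]
  simpa using h

open Classical in
/-- The multiplicity of a domain, continued over the two removed discs of the `i`-th tube by the
constant `M i`. -/
noncomputable def capped (D : Domain R ε) (M : Fin g → ℤ) (p : ℂ) : ℤ :=
  if h : ∃ i, NearTube g i ε (R.toHomeo.symm p) then M h.choose else D.planarMultiplicity p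

theorem capped_of_notMem (hε : IsTubeRadius R ε) (D : Domain R ε) (M : Fin g → ℤ) {p : ℂ}
    (h : p ∉ removedDiscs R ε) : capped D M p = D.planarMultiplicity p := by
  refine dif_neg ?_
  rintro ⟨i, hi⟩
  refine h ?_
  rw [← R.toHomeo.apply_symm_apply p, toHomeo_mem_removedDiscs hε.le_one]
  exact mem_iUnion.2 ⟨i, hi⟩

theorem capped_of_near (hε : IsTubeRadius R ε) (D : Domain R ε) (M : Fin g → ℤ) {i : Fin g}
    {ζ : ℂ} (h : NearTube g i ε ζ) : capped D M (R.toHomeo ζ) = M i := by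
  have h1 : ∃ j, NearTube g j ε (R.toHomeo.symm (R.toHomeo ζ)) :=
    ⟨i, by rwa [Homeomorph.symm_apply_apply]⟩
  have h2 : NearTube g h1.choose ε ζ := (R.toHomeo.symm_apply_apply ζ).subst
    (motive := fun ξ => NearTube g h1.choose ε ξ) h1.choose_spec
  have hl := hε.lt_half
  rw [capped, dif_pos h1, Fin.succ_injective _ (eq_of_near
    (h2.imp (fun h => h.trans hl) fun h => h.trans hl)
    (h.imp (fun h => h.trans hl) fun h => h.trans hl))]

theorem capped_of_near_of_notMem (hε : IsTubeRadius R ε) (hε' : IsTubeRadius R ε')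
    (D : Domain R ε) {M : Fin g → ℤ}
    (hM : ∀ i, ∀ ζ ∈ slitAnnulus g i ε ε', D.planarMultiplicity (R.toHomeo ζ) = M i ∧
      D.planarMultiplicity (-starRingEnd ℂ ζ) = M i) {i : Fin g} {ζ : ℂ}
    (h : NearTube g i ε' ζ) (hK : R.toHomeo ζ ∉ curveSet R) :
    capped D M (R.toHomeo ζ) = M i := by
  by_cases hn : NearTube g i ε ζ
  · exact capped_of_near hε D M hn
  have hζ : R.toHomeo ζ ∉ removedDiscs R ε := by
    rw [toHomeo_mem_removedDiscs hε.le_one]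
    intro hm
    obtain ⟨j, hj⟩ := mem_iUnion.1 hm
    have hl := hε.lt_half
    have hl' := hε'.lt_half
    obtain rfl := Fin.succ_injective _ (eq_of_near
      (h.imp (fun h => h.trans hl') fun h => h.trans hl')
      (hj.imp (fun h => lt_trans h hl) fun h => lt_trans h hl))
    exact hn hj
  rw [capped_of_notMem hε D M hζ]
  rw [NearTube, not_or, not_lt, not_lt] at hn
  rcases h with h | h
  · refine (hM i ζ ⟨⟨hn.1, h⟩, fun h' => hK ?_⟩).1
    exact (toHomeo_mem_curveSet_iff_near hε' h.le).2 h'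
  · have hfix : R.toHomeo ζ = ζ := toHomeo_of_re_nonneg
      (re_pos_of_dist_wPt (h.trans (hε'.lt_half.trans (by norm_num)))).le
    have h1 := dist_neg_conj_zPt_lt h
    have h2 : dist (-starRingEnd ℂ ζ) (zPt g i.succ) = dist ζ (wPt g i.succ) := by
      rw [← dist_neg_conj]; simp
    have h3 := (hM i (-starRingEnd ℂ ζ) ⟨⟨h2 ▸ hn.2, h1⟩, fun h' => hK ?_⟩).2
    · simpa [hfix] using h3
    · have h4 := (curveSet_glue hε' h1.le).1 ((toHomeo_mem_curveSet_iff_near hε' h1.le).2 h')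
      simpa [hfix] using h4

theorem isOpen_coreParams (i : Fin g) : IsOpen (coreParams g i ε) := by
  have h1 : Continuous fun t => dist (arc g i t) (zPt g i.succ) :=
    (continuous_arc i).dist continuous_const
  have h2 : Continuous fun t => dist (arc g i t) (wPt g i.succ) :=
    (continuous_arc i).dist continuous_const
  exact isOpen_Ioo.inter ((isOpen_lt continuous_const h1).inter (isOpen_lt continuous_const h2))

/-- The coefficients of `∂D` along the ovals agree with the multiplicities of the cycle up to a
constant on each oval. -/
theorem exists_beta_coeff {D : Domain R ε} (P Q : InterData R) (hD : D.Connects P.conf Q.conf)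
    (k : Fin g) : ∃ N : ℤ, ∀ s, ∀ᶠ r in 𝓝[≠] s,
      D.IsBetaCoeff k r (-(interCycle P Q).mult (Sum.inl k) r - N) := by
  obtain ⟨d, hd⟩ := exists_eq_add_of_boundary (C := D.IsBetaCoeff k)
    (κ := fun s => -(interCycle P Q).mult (Sum.inl k) s)
    (μ := fun s => pointCoeff Q.conf (oval g k s) - pointCoeff P.conf (oval g k s))
    (fun s c c' => isBetaCoeff_unique) isPreconnected_univ (fun s _ => hD.beta k s) (fun s _ => by
      obtain ⟨c, c', h1, h2, h3⟩ := mult_oval_boundary P Q k s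
      refine ⟨-c, -c', ?_, ?_, by linarith⟩
      · filter_upwards [h1] with r hr; rw [hr]
      · filter_upwards [h2] with r hr; rw [hr])
  exact ⟨-d, fun s => by simpa using hd s (mem_univ s)⟩

/-- The coefficients of `∂D` along the arcs are the multiplicities of the cycle. -/
theorem exists_alpha_coeff (hε : IsTubeRadius R ε) {D : Domain R ε} (P Q : InterData R)
    (hD : D.Connects P.conf Q.conf) (i : Fin g) : ∀ t ∈ coreParams g i ε, ∀ᶠ r in 𝓝[≠] t,
      D.IsAlphaCoeff i r ((interCycle P Q).mult (Sum.inr i) r) := by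
  obtain ⟨d, hd⟩ := exists_eq_add_of_boundary (C := D.IsAlphaCoeff i)
    (κ := fun s => (interCycle P Q).mult (Sum.inr i) s)
    (μ := fun t => pointCoeff P.conf (R.toHomeo (arc g i t)) -
      pointCoeff Q.conf (R.toHomeo (arc g i t)))
    (fun s c c' => isAlphaCoeff_unique) (ordConnected_coreParams i (ε := ε)).isPreconnected
    (fun t ht => hD.alpha i t ht.1 (fun h => ht.2.1.not_ge h) (fun h => ht.2.2.not_ge h))
    (fun t _ => mult_arc_boundary P Q i t)
  suffices d = 0 by simpa [this] using hd
  -- Near the tube the coefficient vanishes, because both sides of the arc are connected by a path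
  -- around the tube.
  obtain ⟨ε', hlt, hε'⟩ := hε.exists_gt
  obtain ⟨M, hM⟩ := exists_tube_multiplicity hε hε' hlt D i
  have hcont : Continuous fun t => dist (arc g i t) (zPt g i.succ) :=
    (continuous_arc i).dist continuous_const
  have hr := rad_pos i.succ
  have hl' := hε'.lt_half
  obtain ⟨t₁, ht₁, hdist⟩ : ∃ t ∈ Icc (0 : ℝ) 1,
      dist (arc g i t) (zPt g i.succ) = (ε + ε') / 2 := by
    refine intermediate_value_Icc zero_le_one hcont.continuousOn ⟨?_, ?_⟩
    · rw [arc_zero, dist_self]; linarith [hε.pos]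
    · rw [arc_one, dist_comm]
      linarith [one_le_dist_zPt_wPt i.succ i.succ]
  have hw : ε < dist (arc g i t₁) (wPt g i.succ) := by
    have h1 := one_le_dist_zPt_wPt i.succ i.succ
    have h2 := dist_triangle_left (zPt g i.succ) (wPt g i.succ) (arc g i t₁)
    linarith
  have ht₁0 : 0 < t₁ := by
    refine lt_of_le_of_ne ht₁.1 ?_
    rintro rfl
    rw [arc_zero, dist_self] at hdist
    linarith [hε.pos]
  have ht₁1 : t₁ < 1 := by
    refine lt_of_le_of_ne ht₁.2 ?_
    rintro rfl
    rw [arc_one, dist_self] at hw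
    linarith [hε.pos]
  have hcore : t₁ ∈ coreParams g i ε := ⟨⟨ht₁0, ht₁1⟩, by linarith, hw⟩
  have hnear : ∀ᶠ r in 𝓝[≠] t₁, dist (arc g i r) (zPt g i.succ) < ε' :=
    nhdsWithin_le_nhds (hcont.continuousAt.eventually_lt_const (by linarith))
  have hnear' : ∀ᶠ r in 𝓝[≠] t₁, r ∈ coreParams g i ε :=
    nhdsWithin_le_nhds ((isOpen_coreParams i).mem_nhds hcore)
  obtain ⟨r, h1, h2, h3⟩ := ((hd t₁ hcore).and (hnear.and hnear')).exists
  have hlt' : ∀ S : InterData R, r < S.arcParam i := fun S => by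
    have h4 := arcParam_mem_coreParams hε' S i
    exact ((strictMonoOn_dist_arc_zPt i).lt_iff_lt (Ioo_subset_Icc_self h3.1)
      (Ioo_subset_Icc_self h4.1)).1 (h2.trans h4.2.1)
  rw [mult_arc_eq_zero P Q h3.1.1 (hlt' P) (hlt' Q), zero_add] at h1
  refine isAlphaCoeff_unique h1 ?_
  have hev : ∀ᶠ q in 𝓝 (R.toHomeo (arc g i r)),
      ε < dist (R.toHomeo.symm q) (zPt g i.succ) ∧ dist (R.toHomeo.symm q) (zPt g i.succ) < ε' := by
    have hc : Continuous fun q => dist (R.toHomeo.symm q) (zPt g i.succ) :=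
      R.toHomeo.symm.continuous.dist continuous_const
    refine (hc.continuousAt.eventually_const_lt ?_).and (hc.continuousAt.eventually_lt_const ?_)
    · simpa only [Homeomorph.symm_apply_apply] using h3.2.1
    · simpa only [Homeomorph.symm_apply_apply] using h2
  have hside : ∀ S : Set ℂ, (∀ q ∈ S, ‖q‖ ≠ rad g i.succ) →
      D.IsSideMultiplicity (R.toHomeo '' S) (R.toHomeo (arc g i r)) M := by
    intro S hS
    filter_upwards [hev.filter_mono nhdsWithin_le_nhds, self_mem_nhdsWithin] with q hq hqS
    obtain ⟨ζ, hζ, rfl⟩ := hqS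
    rw [Homeomorph.symm_apply_apply] at hq
    exact (hM ζ ⟨⟨hq.1.le, hq.2⟩, fun h => hS ζ hζ ((mem_arc_image_iff i).1 h).1⟩).1
  exact ⟨M, M, hside _ fun q hq => ne_of_lt hq, hside _ fun q hq => ne_of_gt hq, (sub_self M).symm⟩

theorem notMem_support_of_notMem_curveSet (P Q : InterData R) {p : ℂ} (hp : p ∉ curveSet R) :
    p ∉ (interCycle P Q).support ∧ p ∉ ovalSet g := by
  refine ⟨fun h => hp ?_, fun h => hp (Or.inr h)⟩
  obtain ⟨j, hj⟩ := mem_iUnion.1 h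
  rcases j with k | i
  · obtain ⟨s, -, rfl⟩ := hj
    exact oval_mem_curveSet k s
  · obtain ⟨t, ht, rfl⟩ := hj
    exact arc_mem_curveSet i (Ioo_subset_Icc_self
      (uIcc_subset_Ioo_zero_one (Q.arcParam_mem i) (P.arcParam_mem i) ht))

/-- The parameters at which a coefficient differs from its generic value form a countable set. -/
theorem countable_not_of_eventually {T : Set ℝ} {p : ℝ → Prop}
    (h : ∀ s ∈ T, ∀ᶠ r in 𝓝[≠] s, p r) : {s ∈ T | ¬ p s}.Countable := by
  refine countable_of_eventually_notMem (T := T) (fun s hs => hs.1) fun s hs => ?_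
  filter_upwards [h s hs] with r hr h'
  exact h'.2 hr

/-- The multiplicity of a domain that connects two intersection points, continued over the removed
discs, is the winding number of the cycle of the two intersection points, up to multiples of the
discs bounded by the ovals and a constant. -/
theorem exists_capped_eq (hX : (arcSet R ∩ ovalSet g).Finite) (hε : IsTubeRadius R ε)
    {D : Domain R ε} (P Q : InterData R) (hD : D.Connects P.conf Q.conf) :
    ∃ (N : Fin g → ℤ) (M : Fin g → ℤ) (c : ℤ),
      (∀ i ζ, NearTube g i ε ζ → capped D M (R.toHomeo ζ) = cycleFun P Q N (R.toHomeo ζ) + c) ∧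
      ∀ p, (∀ᶠ q in 𝓝 p, q ∉ removedDiscs R ε) → p ∉ curveSet R →
        capped D M p = cycleFun P Q N p + c := by
  obtain ⟨ε', hlt, hε'⟩ := hε.exists_gt
  choose M hM using exists_tube_multiplicity hε hε' hlt D
  choose N hN using exists_beta_coeff P Q hD
  have hα := exists_alpha_coeff hε P Q hD
  let E : Set ℂ := (arcSet R ∩ ovalSet g) ∪
    ((⋃ k, oval g k '' {s ∈ univ | ¬ D.IsBetaCoeff k s (-(interCycle P Q).mult (Sum.inl k) s - N k)}) ∪
    ⋃ i, (fun t => R.toHomeo (arc g i t)) '' {t ∈ coreParams g i ε |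
      ¬ D.IsAlphaCoeff i t ((interCycle P Q).mult (Sum.inr i) t)})
  have hE : E.Countable := hX.countable.union
    ((countable_iUnion fun k => (countable_not_of_eventually fun s _ => hN k s).image _).union
      (countable_iUnion fun i => (countable_not_of_eventually (hα i)).image _))
  -- near the ends of the tubes
  have hF1 : ∀ i ζ, NearTube g i ε' ζ → ∀ᶠ q in 𝓝[(curveSet R)ᶜ] (R.toHomeo ζ),
      capped D M q - cycleFun P Q N q = M i - cycleFun P Q N (R.toHomeo ζ) := by
    intro i ζ hζ
    have h1 : ∀ᶠ q in 𝓝 (R.toHomeo ζ), NearTube g i ε' (R.toHomeo.symm q) := by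
      have ho : IsOpen {ξ | NearTube g i ε' ξ} := Metric.isOpen_ball.union Metric.isOpen_ball
      refine R.toHomeo.symm.continuous.continuousAt.eventually_mem (ho.mem_nhds ?_)
      rwa [Homeomorph.symm_apply_apply]
    have h2 := notMem_support_of_dist hε' P Q (hζ.imp le_of_lt le_of_lt)
    filter_upwards [h1.filter_mono nhdsWithin_le_nhds, self_mem_nhdsWithin,
      (eventually_cycleFun_eq P Q N h2.1 h2.2).filter_mono nhdsWithin_le_nhds] with q h3 h4 h5
    rw [h5, ← R.toHomeo.apply_symm_apply q, capped_of_near_of_notMem hε hε' D hM h3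
      (by rwa [Homeomorph.apply_symm_apply])]
  -- outside the curves and the removed discs
  have hF2 : ∀ p, (∀ᶠ q in 𝓝 p, q ∉ removedDiscs R ε) → p ∉ curveSet R →
      ∀ᶠ q in 𝓝[(curveSet R)ᶜ] p,
        capped D M q - cycleFun P Q N q = capped D M p - cycleFun P Q N p := by
    intro p h1 h2
    filter_upwards [h1.filter_mono nhdsWithin_le_nhds,
      (eventually_planarMultiplicity_eq hε D h1 h2).filter_mono nhdsWithin_le_nhds,
      (eventually_cycleFun_eq P Q N (notMem_support_of_notMem_curveSet P Q h2).1
        (notMem_support_of_notMem_curveSet P Q h2).2).filter_mono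
        nhdsWithin_le_nhds] with q h3 h4 h5
    rw [h5, capped_of_notMem hε D M h3, capped_of_notMem hε D M h1.self_of_nhds, h4]
  have hF : ∀ p ∉ E, ∃ c, ∀ᶠ q in 𝓝[(curveSet R)ᶜ] p,
      capped D M q - cycleFun P Q N q = c := by
    intro p hp
    obtain ⟨ζ, rfl⟩ := R.toHomeo.surjective p
    by_cases hnear : ∃ i, NearTube g i ε' ζ
    · obtain ⟨i, hi⟩ := hnear
      exact ⟨_, hF1 i ζ hi⟩
    rw [not_exists] at hnear
    have hrem := eventually_notMem_removedDiscs (R := R) hε.le_one hlt hnear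
    by_cases hK : R.toHomeo ζ ∉ curveSet R
    · exact ⟨_, hF2 _ hrem hK⟩
    rw [not_not] at hK
    have hrem' : ∀ᶠ q in 𝓝[(curveSet R)ᶜ] (R.toHomeo ζ),
        capped D M q = D.planarMultiplicity q := by
      filter_upwards [hrem.filter_mono nhdsWithin_le_nhds] with q hq
      exact capped_of_notMem hε D M hq
    by_cases hoval : R.toHomeo ζ ∈ ovalSet g
    · have harc : R.toHomeo ζ ∉ arcSet R := fun h => hp (Or.inl ⟨h, hoval⟩)
      obtain ⟨k, s, hs⟩ := mem_iUnion.1 hoval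
      rw [← hs] at harc hp hrem' ⊢
      obtain ⟨c, hc⟩ := exists_cycleFun_eq_oval P Q N k harc
      have hcoef : D.IsBetaCoeff k s (-(interCycle P Q).mult (Sum.inl k) s - N k) := by
        by_contra h
        exact hp (Or.inr (Or.inl (mem_iUnion.2 ⟨k, s, ⟨mem_univ s, h⟩, rfl⟩)))
      obtain ⟨l, r, hl, hr, hlr⟩ := hcoef
      have := (ovalLoop g k).eventually_sub_eq_of_jump hc hr hl (by linarith)
      refine ⟨l - c, ?_⟩
      filter_upwards [this.filter_mono (nhdsWithin_compl_curveSet_le_oval k s), hrem'] with q h1 h2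
      rw [h2, h1]
    · obtain ⟨i, _, ⟨t, ht, rfl⟩, hi⟩ := mem_iUnion.1 (hK.resolve_right hoval)
      rw [← R.toHomeo.injective hi] at hp hnear hrem' hoval ⊢
      have hn := hnear i
      rw [NearTube, not_or, not_lt, not_lt] at hn
      have htc : t ∈ coreParams g i ε := by
        refine ⟨⟨lt_of_le_of_ne ht.1 ?_, lt_of_le_of_ne ht.2 ?_⟩, hlt.trans_le hn.1,
          hlt.trans_le hn.2⟩
        · rintro rfl
          rw [arc_zero, dist_self] at hn
          linarith [hn.1, hε'.pos]
        · rintro rfl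
          rw [arc_one, dist_self] at hn
          linarith [hn.2, hε'.pos]
      obtain ⟨c, hc⟩ := exists_cycleFun_eq_arc P Q N i hoval
      have hcoef : D.IsAlphaCoeff i t ((interCycle P Q).mult (Sum.inr i) t) := by
        by_contra h
        exact hp (Or.inr (Or.inr (mem_iUnion.2 ⟨i, t, ⟨htc, h⟩, rfl⟩)))
      obtain ⟨l, r, hl, hr, hlr⟩ := hcoef
      have := (arcLoop R i).eventually_sub_eq_of_jump (s := t) hc hl hr hlr.symm
      refine ⟨r - c, ?_⟩
      filter_upwards [this.filter_mono (nhdsWithin_compl_curveSet_le_arc i htc.1), hrem']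
        with q h1 h2
      rw [h2, h1]
  obtain ⟨c, hc⟩ := exists_eq_of_eventually_const dense_compl_curveSet hE hF
  refine ⟨N, M, c, fun i ζ hζ => ?_, fun p h1 h2 => ?_⟩
  · rw [← hc (R.toHomeo ζ)]
    · ring
    · rw [capped_of_near hε D M hζ]
      exact hF1 i ζ (hζ.imp (fun h => lt_trans h hlt) fun h => lt_trans h hlt)
  · rw [← hc p (hF2 p h1 h2)]; ring

theorem toHomeo_notMem_curveSet_of_norm {ζ : ℂ} (h1 : ‖ζ‖ = rad g 0)
    (h2 : R.toHomeo ζ ∉ puncturedDisc g) :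
    R.toHomeo ζ ∉ curveSet R := by
  rintro (h | h)
  · obtain ⟨i, hi⟩ := mem_iUnion.1 h
    rw [R.toHomeo.injective.mem_set_image, mem_arc_image_iff, h1] at hi
    obtain ⟨N, hN, hN'⟩ := rad_sub (0 : Fin (g + 1)) i.succ
    exact (Fin.succ_ne_zero i).symm (hN'.1 (by
      have : (N : ℝ) = 0 := by rw [← hN, hi.1, sub_self]
      exact_mod_cast this))
  · exact notMem_ovalSet_of_notMem h2 h

theorem not_nearTube_of_norm (hε : ε ≤ 1 / 2) {ζ : ℂ} (h : ‖ζ‖ = rad g 0) (i : Fin g) :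
    ¬ NearTube g i ε ζ := by
  have h1 : 1 ≤ rad g 0 - rad g i.succ := by
    simp only [rad, Fin.val_succ, Fin.val_zero]
    push_cast
    have : (0 : ℝ) ≤ (i : ℕ) := Nat.cast_nonneg _
    linarith
  rintro (h' | h')
  · have := (norm_sub_norm_le ζ (zPt g i.succ)).trans_lt (dist_eq_norm ζ _ ▸ h')
    rw [h, norm_zPt] at this
    linarith
  · have := (norm_sub_norm_le ζ (wPt g i.succ)).trans_lt (dist_eq_norm ζ _ ▸ h')
    rw [h, norm_wPt] at this
    linarith

/-- The Alexander grading of a domain that connects two intersection points: the contributions of the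
tubes cancel in the sum over all base points. -/
theorem alexander_eq (hX : (arcSet R ∩ ovalSet g).Finite) (hε : IsTubeRadius R ε)
    {D : Domain R ε} (P Q : InterData R) (hD : D.Connects P.conf Q.conf) :
    D.alexander =
      ∑ j, ((interCycle P Q).wnum (zPt g j) - (interCycle P Q).wnum (wPt g j)) := by
  obtain ⟨N, M, c, h1, h2⟩ := exists_capped_eq hX hε P Q hD
  obtain ⟨ε', hlt, hε'⟩ := hε.exists_gt
  obtain ⟨π, hπ⟩ := exists_perm R
  have hbase : ∀ ζ, ‖ζ‖ = rad g 0 → R.toHomeo ζ ∉ puncturedDisc g →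
      D.planarMultiplicity (R.toHomeo ζ) = cycleFun P Q N (R.toHomeo ζ) + c := by
    intro ζ h3 h4
    have h5 := eventually_notMem_removedDiscs (R := R) hε.le_one hlt
      (not_nearTube_of_norm hε'.le_half h3)
    rw [← h2 _ h5 (toHomeo_notMem_curveSet_of_norm h3 h4), capped_of_notMem hε D M h5.self_of_nhds]
  have hz := hbase (zPt g 0) (norm_zPt 0) (by rw [hπ]; exact zPt_notMem g _)
  have hw := hbase (wPt g 0) (norm_wPt 0) (by rw [toHomeo_wPt]; exact wPt_notMem g _)
  rw [toHomeo_wPt] at hw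
  have hsucc : ∀ i : Fin g, cycleFun P Q N (R.toHomeo (zPt g i.succ)) =
      cycleFun P Q N (wPt g i.succ) := by
    intro i
    have h3 : NearTube g i ε (zPt g i.succ) := Or.inl (by rw [dist_self]; exact hε.pos)
    have h4 : NearTube g i ε (wPt g i.succ) := Or.inr (by rw [dist_self]; exact hε.pos)
    have h5 := h1 i _ h3
    have h6 := h1 i _ h4
    rw [capped_of_near hε D M h3] at h5
    rw [capped_of_near hε D M h4, toHomeo_wPt] at h6
    linarith
  have hsum : ∑ j, (cycleFun P Q N (R.toHomeo (zPt g j)) - cycleFun P Q N (wPt g j)) =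
      D.alexander := by
    rw [Fin.sum_univ_succ, Finset.sum_eq_zero fun i _ => by rw [hsucc, sub_self],
      Domain.alexander, hz, hw]
    ring
  rw [← hsum, Finset.sum_sub_distrib, Finset.sum_sub_distrib]
  simp only [hπ]
  rw [Equiv.sum_comp π fun j => cycleFun P Q N (zPt g j)]
  simp only [cycleFun, Finset.sum_add_distrib, ind_zPt, ind_wPt]
  ring

end Connecting

/-! ### The permutation of a braid whose closure is a knot -/

section Knot

variable {g : ℕ} {β : BraidGroup g} {R : BraidRep β}

variable (R) in
/-- The part of the braid closure formed by the strands that start at the points `z_j`, `j ∈ S`. -/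
def subClosure (S : Set (Fin (g + 1))) : Set (ℂ × AddCircle (1 : ℝ)) :=
  ⋃ j : S, range fun t : unitInterval => (R.isotopy t (zPt g j), ((t : ℝ) : AddCircle (1 : ℝ)))

theorem isClosed_subClosure (S : Set (Fin (g + 1))) : IsClosed (subClosure R S) := by
  refine (isCompact_iUnion fun j : S => isCompact_range ?_).isClosed
  have h1 := R.continuous_isotopy
  exact (h1.comp (continuous_id.prodMk continuous_const)).prodMk
    ((AddCircle.continuous_mk' 1).comp continuous_subtype_val)

theorem mem_braidClosure_iff {q : ℂ × AddCircle (1 : ℝ)} :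
    q ∈ braidClosure R.strands ↔ ∃ (t : unitInterval) (j : Fin (g + 1)),
      (R.isotopy t (zPt g j), ((t : ℝ) : AddCircle (1 : ℝ))) = q := by
  refine exists_congr fun t => ?_
  rw [← R.isotopy_strands t]
  constructor
  · rintro ⟨⟨j, hj⟩, h⟩
    exact ⟨j, Prod.ext hj h.symm⟩
  · rintro ⟨j, rfl⟩
    exact ⟨⟨j, rfl⟩, rfl⟩

theorem eq_or_endpoints_of_coe_eq {a b : unitInterval}
    (h : ((a : ℝ) : AddCircle (1 : ℝ)) = ((b : ℝ) : AddCircle (1 : ℝ))) :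
    a = b ∨ (a = 0 ∧ b = 1) ∨ (a = 1 ∧ b = 0) := by
  obtain ⟨n, hn⟩ := AddSubgroup.mem_zmultiples_iff.1 (QuotientAddGroup.eq.1 h)
  rw [zsmul_eq_mul, mul_one] at hn
  have ha := a.2
  have hb := b.2
  have h1 : (n : ℝ) < 2 := by linarith [ha.1, hb.2]
  have h2 : (-2 : ℝ) < n := by linarith [ha.2, hb.1]
  norm_cast at h1 h2
  obtain rfl | rfl | rfl : n = 0 ∨ n = 1 ∨ n = -1 := by omega
  · exact Or.inl (Subtype.ext (by push_cast at hn; linarith))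
  · refine Or.inr (Or.inl ⟨Subtype.ext ?_, Subtype.ext ?_⟩) <;> push_cast at hn ⊢ <;>
      linarith [ha.1, hb.2]
  · refine Or.inr (Or.inr ⟨Subtype.ext ?_, Subtype.ext ?_⟩) <;> push_cast at hn ⊢ <;>
      linarith [ha.2, hb.1]

/-- If the closure of the braid is a knot, then its permutation is a cycle of full length. -/
theorem sameCycle_of_closureIsKnot (hK : R.ClosureIsKnot) {π : Equiv.Perm (Fin (g + 1))}
    (hπ : ∀ j, R.toHomeo (zPt g j) = zPt g (π j)) (j : Fin (g + 1)) : π.SameCycle j 0 := by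
  by_contra hj
  let S : Set (Fin (g + 1)) := {j | π.SameCycle j 0}
  have hS : ∀ j, π j ∈ S ↔ j ∈ S := fun j => Equiv.Perm.sameCycle_apply_left
  have hcover : braidClosure R.strands ⊆ subClosure R S ∪ subClosure R Sᶜ := by
    intro q hq
    obtain ⟨t, j, hj⟩ := mem_braidClosure_iff.1 hq
    by_cases h : j ∈ S
    · exact Or.inl (mem_iUnion.2 ⟨⟨j, h⟩, t, hj⟩)
    · exact Or.inr (mem_iUnion.2 ⟨⟨j, h⟩, t, hj⟩)
  have hne : ∀ (S' : Set (Fin (g + 1))) (j), j ∈ S' →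
      (braidClosure R.strands ∩ subClosure R S').Nonempty := fun S' j h =>
    ⟨_, mem_braidClosure_iff.2 ⟨0, j, rfl⟩, mem_iUnion.2 ⟨⟨j, h⟩, 0, rfl⟩⟩
  obtain ⟨q, -, hq1, hq2⟩ := isPreconnected_closed_iff.1 hK.isPreconnected _ _
    (isClosed_subClosure S) (isClosed_subClosure Sᶜ) hcover
    (hne S 0 (Equiv.Perm.SameCycle.refl π 0)) (hne Sᶜ j hj)
  obtain ⟨⟨a, ha⟩, t, rfl⟩ := mem_iUnion.1 hq1
  obtain ⟨⟨b, hb⟩, t', hq⟩ := mem_iUnion.1 hq2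
  have h1 : R.isotopy t' (zPt g b) = R.isotopy t (zPt g a) := congrArg Prod.fst hq
  have h2 : ((t' : ℝ) : AddCircle (1 : ℝ)) = ((t : ℝ) : AddCircle (1 : ℝ)) := congrArg Prod.snd hq
  rcases eq_or_endpoints_of_coe_eq h2 with rfl | ⟨rfl, rfl⟩ | ⟨rfl, rfl⟩
  · rw [zPt_injective g ((R.isotopy t').injective h1)] at hb
    exact hb ha
  · rw [R.isotopy_zero] at h1
    rw [zPt_injective g (h1.trans (hπ a))] at hb
    exact hb ((hS a).2 ha)
  · rw [R.isotopy_zero] at h1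
    rw [← zPt_injective g ((hπ b).symm.trans h1)] at ha
    exact hb ((hS b).1 ha)

end Knot

/-- If all orbits of `f` run into `a`, then every function `c` is the difference of a function along
`f`, except at `a`. -/
theorem exists_sub_eq_of_iterate {α : Type*} [DecidableEq α] {f : α → α} {a : α}
    (h : ∀ i, ∃ n, f^[n] i = a) (c : α → ℤ) :
    ∃ N : α → ℤ, N a = 0 ∧ ∀ i ≠ a, N (f i) - N i = c i := by
  refine ⟨fun i => -∑ m ∈ Finset.range (Nat.find (h i)), c (f^[m] i), ?_, fun i hi => ?_⟩
  · have : Nat.find (h a) = 0 := (Nat.find_eq_zero (h a)).2 rfl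
    simp [this]
  · have h2 : Nat.find (h i) = Nat.find (h (f i)) + 1 :=
      Nat.find_comp_succ (h i) (h (f i)) hi
    simp only [h2, Finset.sum_range_succ', Function.iterate_succ, Function.comp_apply,
      Function.iterate_zero, id_eq]
    ring

/-! ### Existence of a connecting domain -/

section Existence

variable {g : ℕ} {β : BraidGroup g} {R : BraidRep β} {ε ε' : ℝ}

theorem cycleFun_eq_of_isPreconnected (P Q : InterData R) (N : Fin g → ℤ) {S : Set ℂ}
    (hS : IsPreconnected S) (h : ∀ p ∈ S, p ∉ (interCycle P Q).support ∧ p ∉ ovalSet g) {p q : ℂ}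
    (hp : p ∈ S) (hq : q ∈ S) : cycleFun P Q N p = cycleFun P Q N q := by
  refine hS.constant (fun p hp => ?_) hp hq
  exact tendsto_nhds_of_eventually_eq ((eventually_cycleFun_eq P Q N (h p hp).1
    (h p hp).2).filter_mono nhdsWithin_le_nhds)

theorem isPreconnected_compl_closedBall (r : ℝ) :
    IsPreconnected (Metric.closedBall (0 : ℂ) r)ᶜ := by
  have h : (Metric.closedBall (0 : ℂ) r)ᶜ =
      (fun q : ℝ × ℝ => (q.1 : ℂ) * Complex.exp (q.2 * Complex.I)) '' (Ioi r ×ˢ univ) := by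
    ext z
    rw [mem_compl_iff, mem_closedBall_zero_iff, not_le]
    constructor
    · exact fun hz => ⟨(‖z‖, z.arg), ⟨hz, mem_univ _⟩, Complex.norm_mul_exp_arg_mul_I z⟩
    · rintro ⟨q, ⟨hq, -⟩, rfl⟩
      rw [norm_mul, Complex.norm_exp_ofReal_mul_I, mul_one, Complex.norm_real]
      exact lt_of_lt_of_le hq (le_abs_self q.1)
  rw [h]
  exact (isPreconnected_Ioi.prod isPreconnected_univ).image _ (by fun_prop)

theorem exists_cycleFun_eq_at_infinity (P Q : InterData R) (N : Fin g → ℤ) :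
    ∃ c, ∀ᶠ p in cocompact ℂ, cycleFun P Q N p = c := by
  obtain ⟨r, hr⟩ := (isCompact_curveSet (R := R)).isBounded.subset_closedBall 0
  have hev : ∀ᶠ p in cocompact ℂ, p ∈ (Metric.closedBall (0 : ℂ) r)ᶜ :=
    (isCompact_closedBall (0 : ℂ) r).compl_mem_cocompact
  obtain ⟨p₀, hp₀⟩ := hev.exists
  refine ⟨cycleFun P Q N p₀, ?_⟩
  filter_upwards [hev] with p hp
  exact cycleFun_eq_of_isPreconnected P Q N
    (isPreconnected_compl_closedBall r)
    (fun q hq => notMem_support_of_notMem_curveSet P Q fun h => hq (hr h)) hp hp₀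

theorem isBetaCoeff_of_eq_cycleFun (hε : IsTubeRadius R ε) {D : Domain R ε} {P Q : InterData R}
    {N : Fin g → ℤ}
    (hD : ∀ p ∉ removedDiscs R ε, p ∉ curveSet R → D.planarMultiplicity p = cycleFun P Q N p)
    {k : Fin g} {s : ℝ} (h : oval g k s ∉ arcSet R) :
    D.IsBetaCoeff k s (-(interCycle P Q).mult (Sum.inl k) s - N k) := by
  obtain ⟨ε', hlt, hε'⟩ := hε.exists_gt
  have hrem : ∀ᶠ q in 𝓝 (oval g k s), q ∉ removedDiscs R ε := by
    rw [← R.toHomeo.apply_symm_apply (oval g k s)]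
    refine eventually_notMem_removedDiscs hε.le_one hlt fun i hi => ?_
    refine (notMem_support_of_dist hε' P Q (hi.imp le_of_lt le_of_lt)).2 ?_
    rw [R.toHomeo.apply_symm_apply]
    exact oval_mem_ovalSet k s
  obtain ⟨c, hc⟩ := exists_cycleFun_eq_oval P Q N k h
  have hf : ∀ᶠ q in 𝓝[(range (ovalLoop g k).γ)ᶜ] ((ovalLoop g k).γ s), D.planarMultiplicity q =
      c + ((interCycle P Q).mult (Sum.inl k) s + N k) * (ovalLoop g k).ind q := by
    filter_upwards [hc, hrem.filter_mono nhdsWithin_le_nhds,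
      nhdsWithin_compl_oval_le h self_mem_nhdsWithin] with q h1 h2 h3
    rw [hD q h2 h3, h1]
  exact ⟨_, _, LoopCurve.eventually_Out_of_eq_add hf, LoopCurve.eventually_In_of_eq_add hf,
    by ring⟩

theorem isAlphaCoeff_of_eq_cycleFun (hε : IsTubeRadius R ε) {D : Domain R ε} {P Q : InterData R}
    {N : Fin g → ℤ}
    (hD : ∀ p ∉ removedDiscs R ε, p ∉ curveSet R → D.planarMultiplicity p = cycleFun P Q N p)
    {i : Fin g} {t : ℝ} (ht : t ∈ coreParams g i ε) (h : R.toHomeo (arc g i t) ∉ ovalSet g) :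
    D.IsAlphaCoeff i t ((interCycle P Q).mult (Sum.inr i) t) := by
  let ε' : ℝ :=
    min (min (dist (arc g i t) (zPt g i.succ)) (dist (arc g i t) (wPt g i.succ))) (1 / 2)
  have hlt : ε < ε' := lt_min (lt_min ht.2.1 ht.2.2) hε.lt_half
  have hrem : ∀ᶠ q in 𝓝 (R.toHomeo (arc g i t)), q ∉ removedDiscs R ε := by
    refine eventually_notMem_removedDiscs hε.le_one hlt fun j hj => ?_
    have hij : j = i := by
      have key : |rad g i.succ - rad g j.succ| < 1 / 2 := by
        rw [← norm_arc i t]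
        rcases hj with hj | hj
        · rw [← norm_zPt j.succ]
          exact (abs_norm_sub_norm_le _ _).trans_lt
            (dist_eq_norm (arc g i t) _ ▸ hj.trans_le (min_le_right _ _))
        · rw [← norm_wPt j.succ]
          exact (abs_norm_sub_norm_le _ _).trans_lt
            (dist_eq_norm (arc g i t) _ ▸ hj.trans_le (min_le_right _ _))
      obtain ⟨N, hN, hN'⟩ := rad_sub i.succ j.succ
      rw [hN, abs_lt] at key
      have h5 : (N : ℝ) < 1 := by linarith
      have h6 : (-1 : ℝ) < N := by linarith
      norm_cast at h5 h6
      exact (Fin.succ_injective _ (hN'.1 (by omega))).symm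
    subst hij
    rcases hj with hj | hj
    · exact (hj.trans_le ((min_le_left _ _).trans (min_le_left _ _))).false
    · exact (hj.trans_le ((min_le_left _ _).trans (min_le_right _ _))).false
  obtain ⟨c, hc⟩ := exists_cycleFun_eq_arc P Q N i h
  have hf : ∀ᶠ q in 𝓝[(range (arcLoop R i).γ)ᶜ] ((arcLoop R i).γ t), D.planarMultiplicity q =
      c + (interCycle P Q).mult (Sum.inr i) t * (arcLoop R i).ind q := by
    filter_upwards [hc, hrem.filter_mono nhdsWithin_le_nhds,
      nhdsWithin_compl_arc_le h self_mem_nhdsWithin] with q h1 h2 h3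
    rw [hD q h2 h3, h1]
  exact ⟨_, _, LoopCurve.eventually_In_of_eq_add hf, LoopCurve.eventually_Out_of_eq_add hf,
    by ring⟩

/-- A domain whose multiplicities are given by the cycle of two intersection points connects them. -/
theorem connects_of_eq_cycleFun (hX : (arcSet R ∩ ovalSet g).Finite) (hε : IsTubeRadius R ε)
    {D : Domain R ε} {P Q : InterData R} {N : Fin g → ℤ}
    (hD : ∀ p ∉ removedDiscs R ε, p ∉ curveSet R → D.planarMultiplicity p = cycleFun P Q N p) :
    D.Connects P.conf Q.conf := by
  have hlt : ∀ s : ℝ, 𝓝[<] s ≤ 𝓝[≠] s := fun s => nhdsWithin_mono _ fun r hr => ne_of_lt hr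
  have hgt : ∀ s : ℝ, 𝓝[>] s ≤ 𝓝[≠] s := fun s => nhdsWithin_mono _ fun r hr => ne_of_gt hr
  constructor
  · intro i t ht hz hw
    have htc : t ∈ coreParams g i ε := ⟨ht, not_le.1 hz, not_le.1 hw⟩
    have hev : ∀ᶠ r in 𝓝[≠] t,
        D.IsAlphaCoeff i r ((interCycle P Q).mult (Sum.inr i) r) := by
      filter_upwards [eventually_arc_notMem_ovalSet hX i ht,
        nhdsWithin_le_nhds ((isOpen_coreParams i).mem_nhds htc)] with r h1 h2
      exact isAlphaCoeff_of_eq_cycleFun hε hD h2 h1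
    obtain ⟨c, c', h1, h2, h3⟩ := mult_arc_boundary P Q i t
    refine ⟨c, c', ?_, ?_, h3⟩
    · filter_upwards [hev.filter_mono (hlt t), h1] with r h4 h5
      rwa [← h5]
    · filter_upwards [hev.filter_mono (hgt t), h2] with r h4 h5
      rwa [← h5]
  · intro k s
    have hev : ∀ᶠ r in 𝓝[≠] s,
        D.IsBetaCoeff k r (-(interCycle P Q).mult (Sum.inl k) r - N k) := by
      filter_upwards [eventually_oval_notMem_arcSet hX k s] with r h1
      exact isBetaCoeff_of_eq_cycleFun hε hD h1
    obtain ⟨c, c', h1, h2, h3⟩ := mult_oval_boundary P Q k s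
    refine ⟨-c - N k, -c' - N k, ?_, ?_, by linarith⟩
    · filter_upwards [hev.filter_mono (hlt s), h1] with r h4 h5
      rwa [← h5]
    · filter_upwards [hev.filter_mono (hgt s), h2] with r h4 h5
      rwa [← h5]

theorem sum_mul_ite_succ (N : Fin (g + 1) → ℤ) (h0 : N 0 = 0) (j : Fin (g + 1)) :
    ∑ k : Fin g, N k.succ * (if j = k.succ then 1 else 0) = N j := by
  have := Fin.sum_univ_succ fun k : Fin (g + 1) => N k * (if j = k then 1 else 0)
  rw [h0, zero_mul, zero_add] at this
  rw [← this]
  simp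

/-- Since the permutation of the braid is a single cycle, the multiplicities of the discs bounded by
the ovals can be chosen such that the function of the cycle extends over the tubes. -/
theorem exists_connects (hK : R.ClosureIsKnot) (hX : (arcSet R ∩ ovalSet g).Finite)
    (hε : IsTubeRadius R ε) (P Q : InterData R) :
    ∃ D : Domain R ε, D.Connects P.conf Q.conf := by
  obtain ⟨π, hπ⟩ := exists_perm R
  have horbit : ∀ i, ∃ n, π^[n] i = 0 := fun i => by
    obtain ⟨n, -, hn⟩ := (sameCycle_of_closureIsKnot hK hπ i).exists_pow_eq'
    exact ⟨n, by rw [Equiv.Perm.iterate_eq_pow, hn]⟩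
  obtain ⟨N, hN0, hN⟩ := exists_sub_eq_of_iterate horbit fun i =>
    (interCycle P Q).wnum (wPt g i) - (interCycle P Q).wnum (zPt g (π i))
  let f : ℂ → ℤ := cycleFun P Q fun k => N k.succ
  have hfz : ∀ j, f (zPt g j) = (interCycle P Q).wnum (zPt g j) + N j := fun j => by
    simp only [f, cycleFun, ind_zPt, sum_mul_ite_succ N hN0]
  have hfw : ∀ j, f (wPt g j) = (interCycle P Q).wnum (wPt g j) + N j := fun j => by
    simp only [f, cycleFun, ind_wPt, sum_mul_ite_succ N hN0]
  have hends : ∀ i : Fin g, f (R.toHomeo (zPt g i.succ)) = f (wPt g i.succ) := fun i => by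
    have := hN i.succ (Fin.succ_ne_zero i)
    rw [hπ, hfz, hfw]
    linarith
  have hglue : ∀ i : Fin g, ∀ ζ, dist ζ (zPt g i.succ) = ε →
      f (R.toHomeo ζ) = f (-starRingEnd ℂ ζ) := by
    intro i ζ hζ
    have h1 : f (R.toHomeo ζ) = f (R.toHomeo (zPt g i.succ)) := by
      refine cycleFun_eq_of_isPreconnected P Q _ ((convex_closedBall (zPt g i.succ)
        ε).isPreconnected.image R.toHomeo R.toHomeo.continuous.continuousOn) ?_
        ⟨ζ, hζ.le, rfl⟩ ⟨_, Metric.mem_closedBall_self hε.pos.le, rfl⟩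
      rintro _ ⟨ξ, hξ, rfl⟩
      exact notMem_support_of_dist hε P Q (Or.inl hξ)
    have h2 : f (-starRingEnd ℂ ζ) = f (wPt g i.succ) := by
      refine cycleFun_eq_of_isPreconnected P Q _ (convex_closedBall (wPt g i.succ)
        ε).isPreconnected (fun ξ hξ => ?_) ?_ (Metric.mem_closedBall_self hε.pos.le)
      · have hfix : R.toHomeo ξ = ξ := toHomeo_of_re_nonneg
          (re_pos_of_dist_wPt (lt_of_le_of_lt hξ (hε.lt_half.trans (by norm_num)))).le
        have := notMem_support_of_dist hε P Q (i := i) (ζ := ξ) (Or.inr hξ)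
        rwa [hfix] at this
      · rw [Metric.mem_closedBall, dist_neg_conj, hζ]
    rw [h1, h2, hends]
  obtain ⟨D, hD⟩ := exists_domain hε f (fun p hp => eventually_cycleFun_eq P Q _
    (notMem_support_of_notMem_curveSet P Q hp).1 (notMem_support_of_notMem_curveSet P Q hp).2)
    (exists_cycleFun_eq_at_infinity P Q _) hglue
  exact ⟨D, connects_of_eq_cycleFun hX hε hD⟩

end Existence

end BraidModel

theorem theorem1p6 (g : ℕ) (β : BraidModel.BraidGroup g) (R : BraidModel.BraidRep β)
    (hK : R.ClosureIsKnot)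
    (hfin : ∀ i k : Fin g, {t : ℝ | t ∈ Set.Ioo (0 : ℝ) 1 ∧
      R.toHomeo (BraidModel.arc g i t) ∈ Set.range (BraidModel.oval g k)}.Finite)
    (ε : ℝ) (hε : BraidModel.IsTubeRadius R ε)
    (x y : BraidModel.intersectionPoints R) :
    (∃ D : BraidModel.Domain R ε, D.Connects x y) ∧
      ∀ D : BraidModel.Domain R ε, D.Connects x y →
        BraidModel.gradingPd R x - BraidModel.gradingPd R y = D.alexander := by
  obtain ⟨P, Q, hP, hQ, hPQ⟩ := BraidModel.exists_gradingPd_sub x y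
  have hX := BraidModel.finite_arcSet_inter_ovalSet hfin
  rw [← hP, ← hQ]
  refine ⟨BraidModel.exists_connects hK hX hε P Q, fun D hD => ?_⟩
  rw [hPQ, BraidModel.alexander_eq hX hε P Q hD]
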